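/- **Setting.** All modules are left modules (not necessarily finitely generated), $D(S\text{-}\mathsf{Mod})$ is the unbounded derived category of a ring $S$, $\mathrm{gl.dim}$ is the left global dimension, and $\mathrm{rad}$ is the Jacobson radical. A (one-dimensional) *order* is a ring $A$ whose center $R$ is a reduced noetherian ring of Krull dimension one, such that $A$ is a finitely generated torsion-free $R$-module and $A_K = K\otimes_R A$ is semisimple, where $K$ is the total ring of fractions of $R$. The order $A$ is *nodal*, with *hereditary cover* $H$, if $R$ is semilocal and $A \subseteq H \subseteq A_K$ is an overring that is finitely generated as an $A$-module, with $\mathrm{gl.dim}\,H = 1$, $\mathrm{rad}(A)=\mathrm{rad}(H)$, and such that $H\otimes_A U$ has length at most $2$ as an $A$-module for every simple $A$-module $U$. Let $A$ be a nodal order with hereditary cover $H$, let $C=\{a\in A \mid aH\subseteq A\}$ be its conductor (a two-sided ideal of both $A$ and $H$), put $\bar A = A/C$, and let $B=\begin{pmatrix} A & H\\ C & H\end{pmatrix}$ be its Auslander order. Let $e, f\in B$ be the two diagonal idempotents, $P = Be = \binom{A}{C}$, $Q = Bf = \binom{H}{H}$, $P^\vee = eB$, $Q^\vee = fB$, and consider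 the functors $$\mathsf F = P\otimes_A -,\quad \mathsf G = \mathrm{Hom}_B(P,-),\quad \mathsf H=\mathrm{Hom}_A(P^\vee,-),\qquad \tilde{\mathsf F} = Q\otimes_H -,\quad \tilde{\mathsf G} = \mathrm{Hom}_B(Q,-),\quad \tilde{\mathsf H}=\mathrm{Hom}_H(Q^\vee,-)$$ between $B\text{-}\mathsf{Mod}$ and $A\text{-}\mathsf{Mod}$, respectively $H\text{-}\mathsf{Mod}$; $\mathsf G$ and $\tilde{\mathsf G}$ are exact. Define the $B$-modules $S=\binom{A}{C}/\binom{C}{C}$ and $T=\binom{H}{H}/\binom{H}{C}$. For a $B$-module $E$ let ${}^\perp E$ (resp. $E^\perp$) be the class of all $X\in D(B\text{-}\mathsf{Mod})$ with $\mathrm{Hom}(X,E[i])=0$ (resp. $\mathrm{Hom}(E[i],X)=0$) for all $i\in\mathbb Z$. Let $D_T(B\text{-}\mathsf{Mod})$ be the full subcategory of complexes all of whose cohomologies lie in $\mathsf{Add}(T)$ (direct summands of arbitrary direct sums of copies of $T$), with left and right orthogonals ${}^\perp D_T(B\text{-}\mathsf{Mod})$ and $D_T(B\text{-}\mathsf{Mod})^\perp$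 in $D(B\text{-}\mathsf{Mod})$. **Theorem.** 1. The total derived functors $\mathsf{LF}, \mathsf{RH}, \mathsf L\tilde{\mathsf F}, \mathsf R\tilde{\mathsf H}$ exist on the unbounded derived categories, and $(\mathsf{LF},\mathsf{DG},\mathsf{RH})$ and $(\mathsf L\tilde{\mathsf F},\mathsf D\tilde{\mathsf G},\mathsf R\tilde{\mathsf H})$ are adjoint triples. 2. $\mathsf{LF}, \mathsf L\tilde{\mathsf F}, \mathsf{RH}, \mathsf R\tilde{\mathsf H}$ are fully faithful; $\mathsf{DG}$ and $\mathsf D\tilde{\mathsf G}$ are essentially surjective. 3. The essential image of $\mathsf L\tilde{\mathsf F}$ is ${}^\perp S$ and that of $\mathsf R\tilde{\mathsf H}$ is $S^\perp$. The essential image of $\mathsf{LF}$ is ${}^\perp D_T(B\text{-}\mathsf{Mod})$ and that of $\mathsf{RH}$ is $D_T(B\text{-}\mathsf{Mod})^\perp$. A complex $X$ with cohomology bounded above lies in the essential image of $\mathsf{LF}$ if and only if $X\in{}^\perp T$; a complex $X$ with cohomology bounded below lies in the essential image of $\mathsf{RH}$ if and only if $X\in T^\perp$. 4. There is a recollement of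 triangulated categories $$D(\bar A\text{-}\mathsf{Mod}) \xrightarrow{\ \mathsf I\ } D(B\text{-}\mathsf{Mod}) \xrightarrow{\ \mathsf D\tilde{\mathsf G}\ } D(H\text{-}\mathsf{Mod})$$ with adjoints $\mathsf I^*\dashv \mathsf I\dashv \mathsf I^!$ and $\mathsf L\tilde{\mathsf F}\dashv\mathsf D\tilde{\mathsf G}\dashv\mathsf R\tilde{\mathsf H}$, where $\mathsf I$ is induced by restriction along $B\to\bar A$, $\begin{pmatrix} a & x\\ c& y\end{pmatrix}\mapsto a+C$, and $\mathsf I(\bar A)\cong S$. 5. $D_T(B\text{-}\mathsf{Mod})$ is a triangulated subcategory and there is a recollement $$D_T(B\text{-}\mathsf{Mod}) \xrightarrow{\ \mathsf J\ } D(B\text{-}\mathsf{Mod}) \xrightarrow{\ \mathsf D\mathsf G\ } D(A\text{-}\mathsf{Mod})$$ with $\mathsf J$ the inclusion, adjoints $\mathsf J^*\dashv\mathsf J\dashv\mathsf J^!$ and $\mathsf{LF}\dashv\mathsf{DG}\dashv\mathsf{RH}$. 6. $\mathrm{gl.dim}\,B\le 2$, and $\mathrm{gl.dim}\,B=2$ if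 $A$ is not hereditary (i.e. $\mathrm{gl.dim}\,A\neq1$). -/

import Mathlib

open CategoryTheory Limits Pretriangulated
open scoped TensorProduct

universe w w₁ w₂ w₃ w₄ u

namespace NodalOrder

/-- The (left) global dimension of a ring. -/
noncomputable def globalDimension (S : Type u) [Ring S] : WithBot ℕ∞ :=
  ⨆ M : ModuleCat.{u} S, projectiveDimension M

section Tensor

variable (T : Type u) [Ring T] (P : Type u) [AddCommGroup P] [Module Tᵐᵒᵖ P]
  (M : Type u) [AddCommGroup M] [Module T M]

/-- The relations `p t ⊗ m = p ⊗ t m`. -/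
def tensorRel : AddSubgroup (P ⊗[ℤ] M) :=
  AddSubgroup.closure {z | ∃ (p : P) (t : T) (m : M),
    z = (MulOpposite.op t • p) ⊗ₜ[ℤ] m - p ⊗ₜ[ℤ] (t • m)}

/-- The tensor product `P ⊗_T M` of a right `T`-module and a left `T`-module. -/
def BalancedTensor : Type u := (P ⊗[ℤ] M) ⧸ tensorRel T P M

instance : AddCommGroup (BalancedTensor T P M) :=
  inferInstanceAs (AddCommGroup ((P ⊗[ℤ] M) ⧸ tensorRel T P M))

variable {M} in
/-- Functoriality of `P ⊗_T M` in both variables. -/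
def BalancedTensor.map {N : Type u} [AddCommGroup N] [Module T N]
    (f : P →ₗ[Tᵐᵒᵖ] P) (g : M →ₗ[T] N) : BalancedTensor T P M →+ BalancedTensor T P N :=
  QuotientAddGroup.map _ _
    (TensorProduct.map f.toAddMonoidHom.toIntLinearMap
      g.toAddMonoidHom.toIntLinearMap).toAddMonoidHom (by
    rw [tensorRel, AddSubgroup.closure_le]
    rintro _ ⟨p, t, m, rfl⟩
    refine AddSubgroup.subset_closure ⟨f p, t, g m, ?_⟩
    simp [TensorProduct.map_tmul])

variable {P M}

/-- The elementary tensor `p ⊗ m` in `P ⊗_T M`. -/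
def BalancedTensor.tmul (p : P) (m : M) : BalancedTensor T P M :=
  QuotientAddGroup.mk (p ⊗ₜ[ℤ] m)

@[simp]
theorem BalancedTensor.map_tmul {N : Type u} [AddCommGroup N] [Module T N]
    (f : P →ₗ[Tᵐᵒᵖ] P) (g : M →ₗ[T] N) (p : P) (m : M) :
    BalancedTensor.map T P f g (tmul T p m) = tmul T (f p) (g m) := rfl

variable {T} in
theorem BalancedTensor.addHom_ext {N : Type u} [AddCommGroup N]
    {f g : BalancedTensor T P M →+ N} (h : ∀ p m, f (tmul T p m) = g (tmul T p m)) : f = g := by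
  refine QuotientAddGroup.addMonoidHom_ext _ ?_
  have : (f.comp (QuotientAddGroup.mk' (tensorRel T P M))).toIntLinearMap =
      (g.comp (QuotientAddGroup.mk' (tensorRel T P M))).toIntLinearMap := TensorProduct.ext' h
  exact AddMonoidHom.ext fun z => DFunLike.congr_fun this z

variable (S : Type u) [Ring S] [Module S P] [SMulCommClass S Tᵐᵒᵖ P]

instance BalancedTensor.instModule : Module S (BalancedTensor T P M) where
  smul s z := BalancedTensor.map T P (Module.toModuleEnd Tᵐᵒᵖ P s) LinearMap.id z
  one_smul z := by
    refine DFunLike.congr_fun (f := BalancedTensor.map T P (Module.toModuleEnd Tᵐᵒᵖ P (1 : S))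
      (LinearMap.id (R := T) (M := M))) (g := AddMonoidHom.id _) (addHom_ext ?_) z
    intro p m
    simp
  mul_smul s s' z := by
    refine DFunLike.congr_fun (f := BalancedTensor.map T P (Module.toModuleEnd Tᵐᵒᵖ P (s * s'))
      (LinearMap.id (R := T) (M := M)))
      (g := (BalancedTensor.map T P (Module.toModuleEnd Tᵐᵒᵖ P s) LinearMap.id).comp
        (BalancedTensor.map T P (Module.toModuleEnd Tᵐᵒᵖ P s') LinearMap.id)) (addHom_ext ?_) z
    intro p m
    simp [mul_smul]
  smul_zero s := map_zero _
  smul_add s := map_add _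
  add_smul s s' z := by
    refine DFunLike.congr_fun (f := BalancedTensor.map T P (Module.toModuleEnd Tᵐᵒᵖ P (s + s'))
      (LinearMap.id (R := T) (M := M)))
      (g := (BalancedTensor.map T P (Module.toModuleEnd Tᵐᵒᵖ P s) LinearMap.id) +
        (BalancedTensor.map T P (Module.toModuleEnd Tᵐᵒᵖ P s') LinearMap.id)) (addHom_ext ?_) z
    intro p m
    simp only [map_tmul, AddMonoidHom.add_apply]
    exact congrArg QuotientAddGroup.mk (by simp [add_smul, TensorProduct.add_tmul])
  zero_smul z := by
    refine DFunLike.congr_fun (f := BalancedTensor.map T P (Module.toModuleEnd Tᵐᵒᵖ P (0 : S))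
      (LinearMap.id (R := T) (M := M))) (g := 0) (addHom_ext ?_) z
    intro p m
    simp only [map_tmul, AddMonoidHom.zero_apply]
    exact congrArg QuotientAddGroup.mk (by simp)

@[simp]
theorem BalancedTensor.smul_tmul (s : S) (p : P) (m : M) :
    s • tmul T p m = tmul T (s • p) m := rfl

/-- The `S`-linear map `P ⊗_T M → P ⊗_T N` induced by a `T`-linear map `M → N`. -/
def BalancedTensor.lTensor {N : Type u} [AddCommGroup N] [Module T N] (g : M →ₗ[T] N) :
    BalancedTensor T P M →ₗ[S] BalancedTensor T P N :=
  { BalancedTensor.map T P LinearMap.id g with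
    map_smul' := fun s z => by
      refine DFunLike.congr_fun (f := (BalancedTensor.map T P LinearMap.id g).comp
        (BalancedTensor.map T P (Module.toModuleEnd Tᵐᵒᵖ P s) LinearMap.id))
        (g := (BalancedTensor.map T P (Module.toModuleEnd Tᵐᵒᵖ P s) LinearMap.id).comp
        (BalancedTensor.map T P LinearMap.id g)) (addHom_ext ?_) z
      intro p m
      simp }

@[simp]
theorem BalancedTensor.lTensor_tmul {N : Type u} [AddCommGroup N] [Module T N] (g : M →ₗ[T] N)
    (p : P) (m : M) : BalancedTensor.lTensor T S g (tmul T p m) = tmul T p (g m) := rfl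

variable {T S} in
theorem BalancedTensor.hom_ext {N : Type u} [AddCommGroup N] [Module S N]
    {f g : BalancedTensor T P M →ₗ[S] N} (h : ∀ p m, f (tmul T p m) = g (tmul T p m)) :
    f = g := by
  have : f.toAddMonoidHom = g.toAddMonoidHom := addHom_ext h
  ext z
  exact DFunLike.congr_fun this z

end Tensor

section Functors

variable (S T : Type u) [Ring S] [Ring T] (P : Type u) [AddCommGroup P] [Module S P]
  [Module Tᵐᵒᵖ P] [SMulCommClass S Tᵐᵒᵖ P]

/-- The functor `P ⊗_T -` from left `T`-modules to left `S`-modules given by an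
`(S, T)`-bimodule `P`. -/
def tensorFunctor : ModuleCat.{u} T ⥤ ModuleCat.{u} S where
  obj M := ModuleCat.of S (BalancedTensor T P M)
  map g := ModuleCat.ofHom (BalancedTensor.lTensor T S g.hom)
  map_id M := by
    ext1
    exact BalancedTensor.hom_ext fun p m => by simp
  map_comp f g := by
    ext1
    exact BalancedTensor.hom_ext fun p m => by simp

instance : (tensorFunctor S T P).Additive where
  map_add {M N f g} := by
    ext1
    refine BalancedTensor.hom_ext fun p m => ?_
    exact congrArg QuotientAddGroup.mk (by simp [TensorProduct.tmul_add])

/-- The abelian group `Hom_S(P, M)`, for an `(S, T)`-bimodule `P` and a left `S`-module `M`. -/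
def BimoduleHom (M : Type u) [AddCommGroup M] [Module S M] : Type u := P →ₗ[S] M

instance (M : Type u) [AddCommGroup M] [Module S M] : AddCommGroup (BimoduleHom S P M) :=
  inferInstanceAs (AddCommGroup (P →ₗ[S] M))

instance (M : Type u) [AddCommGroup M] [Module S M] : FunLike (BimoduleHom S P M) P M :=
  inferInstanceAs (FunLike (P →ₗ[S] M) P M)

variable {S P} in
@[ext]
theorem BimoduleHom.ext {M : Type u} [AddCommGroup M] [Module S M] {f g : BimoduleHom S P M}
    (h : ∀ p, f p = g p) : f = g := LinearMap.ext h

/-- The left `T`-module structure on `Hom_S(P, M)` is `(t f)(p) = f(p t)`. -/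
instance BimoduleHom.instModule (M : Type u) [AddCommGroup M] [Module S M] :
    Module T (BimoduleHom S P M) where
  smul t f :=
    { toFun := fun p => f (MulOpposite.op t • p)
      map_add' := fun p q =>
        (congrArg f (smul_add _ p q)).trans (map_add (show P →ₗ[S] M from f) _ _)
      map_smul' := fun s p => (congrArg f (smul_comm s (MulOpposite.op t) p).symm).trans
        (map_smul (show P →ₗ[S] M from f) _ _) }
  one_smul f := by
    refine LinearMap.ext fun p => ?_
    exact congrArg (show P →ₗ[S] M from f) (one_smul Tᵐᵒᵖ p)
  mul_smul t t' f := by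
    refine LinearMap.ext fun p => ?_
    exact congrArg (show P →ₗ[S] M from f) (mul_smul (MulOpposite.op t') (MulOpposite.op t) p)
  smul_zero _ := rfl
  smul_add _ _ _ := rfl
  add_smul t t' f := by
    refine LinearMap.ext fun p => ?_
    exact (congrArg (show P →ₗ[S] M from f)
      (add_smul (MulOpposite.op t) (MulOpposite.op t') p)).trans (map_add _ _ _)
  zero_smul f := by
    refine LinearMap.ext fun p => ?_
    exact (congrArg (show P →ₗ[S] M from f) (zero_smul Tᵐᵒᵖ p)).trans (map_zero _)

/-- The functor `Hom_S(P, -)` from left `S`-modules to left `T`-modules given by an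
`(S, T)`-bimodule `P`. -/
def homFunctor : ModuleCat.{u} S ⥤ ModuleCat.{u} T where
  obj M := ModuleCat.of T (BimoduleHom S P M)
  map {M _} g := ModuleCat.ofHom
    { toFun := fun f => LinearMap.comp g.hom (show P →ₗ[S] M from f)
      map_add' := fun _ _ => LinearMap.comp_add _ _ _
      map_smul' := fun _ _ => rfl }
  map_id _ := rfl
  map_comp _ _ := rfl

instance : (homFunctor S T P).Additive where
  map_add := rfl

theorem homFunctor_map_shortExact [Module.Projective S P] (X : ShortComplex (ModuleCat.{u} S))
    (hX : X.ShortExact) : (X.map (homFunctor S T P)).ShortExact := by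
  have hinj := hX.moduleCat_injective_f
  have hsurj := hX.moduleCat_surjective_g
  have hex := (ShortComplex.ShortExact.moduleCat_exact_iff_function_exact _).mp hX.exact
  refine { exact := ?_, mono_f := ?_, epi_g := ?_ }
  · refine (ShortComplex.ShortExact.moduleCat_exact_iff_function_exact _).mpr ?_
    intro (f : P →ₗ[S] X.X₂)
    constructor
    · intro hf
      have hf' : ∀ p, f p ∈ LinearMap.range X.f.hom := fun p =>
        (hex (f p)).mp (DFunLike.congr_fun (show X.g.hom.comp f = 0 from hf) p)
      refine ⟨(LinearEquiv.ofInjective X.f.hom hinj).symm.toLinearMap.comp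
        (f.codRestrict _ hf'), ?_⟩
      refine LinearMap.ext fun p => ?_
      exact congrArg Subtype.val ((LinearEquiv.ofInjective X.f.hom hinj).apply_symm_apply
        (f.codRestrict _ hf' p))
    · rintro ⟨g, rfl⟩
      refine LinearMap.ext fun p => ?_
      exact (hex _).mpr ⟨(show P →ₗ[S] X.X₁ from g) p, rfl⟩
  · refine (ModuleCat.mono_iff_injective _).mpr ?_
    intro f g h
    refine LinearMap.ext fun p => hinj ?_
    exact DFunLike.congr_fun (show X.f.hom.comp (show P →ₗ[S] X.X₁ from f) =
      X.f.hom.comp (show P →ₗ[S] X.X₁ from g) from h) p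
  · refine (ModuleCat.epi_iff_surjective _).mpr ?_
    intro f
    exact Module.projective_lifting_property X.g.hom (show P →ₗ[S] X.X₃ from f) hsurj

instance [Module.Projective S P] : PreservesFiniteLimits (homFunctor S T P) :=
  have h : PreservesFiniteLimits (homFunctor S T P) ∧ PreservesFiniteColimits (homFunctor S T P) :=
    ((Functor.exact_tfae (homFunctor S T P)).out 0 3 rfl rfl).mp (homFunctor_map_shortExact S T P)
  h.1

instance [Module.Projective S P] : PreservesFiniteColimits (homFunctor S T P) :=
  have h : PreservesFiniteLimits (homFunctor S T P) ∧ PreservesFiniteColimits (homFunctor S T P) :=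
    ((Functor.exact_tfae (homFunctor S T P)).out 0 3 rfl rfl).mp (homFunctor_map_shortExact S T P)
  h.2

end Functors

section Corner

variable {B T : Type u} [Ring B] [Ring T] (φ : T →ₙ+* B)

/-- For a non-unital ring map `φ : T → B` identifying `T` with a corner `e B e`, `e = φ 1`, this is
the left ideal `B e`, a `(B, T)`-bimodule. -/
def Column : Submodule B B where
  carrier := {x | x * φ 1 = x}
  add_mem' {x y} hx hy := by
    simp only [Set.mem_ofPred_eq] at *
    rw [add_mul, hx, hy]
  zero_mem' := zero_mul _
  smul_mem' b x hx := by
    simp only [Set.mem_ofPred_eq, smul_eq_mul] at *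
    rw [mul_assoc, hx]

/-- The right ideal `e B`, a `(T, B)`-bimodule. -/
def Row : Submodule Bᵐᵒᵖ B where
  carrier := {x | φ 1 * x = x}
  add_mem' {x y} hx hy := by
    simp only [Set.mem_ofPred_eq] at *
    rw [mul_add, hx, hy]
  zero_mem' := mul_zero _
  smul_mem' b x hx := by
    simp only [Set.mem_ofPred_eq, MulOpposite.smul_eq_mul_unop] at *
    rw [← mul_assoc, hx]

instance : Module Tᵐᵒᵖ (Column φ) where
  smul t x := ⟨x.1 * φ t.unop, by
    change _ * φ 1 = _
    rw [mul_assoc, ← map_mul, mul_one]⟩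
  one_smul x := Subtype.ext x.2
  mul_smul t t' x := Subtype.ext <| by
    change x.1 * φ (t'.unop * t.unop) = x.1 * φ t'.unop * φ t.unop
    rw [map_mul, mul_assoc]
  smul_zero t := Subtype.ext (zero_mul _)
  smul_add t x y := Subtype.ext (add_mul _ _ _)
  add_smul t t' x := Subtype.ext <| by
    change x.1 * φ (t.unop + t'.unop) = x.1 * φ t.unop + x.1 * φ t'.unop
    rw [map_add, mul_add]
  zero_smul x := Subtype.ext <| by
    change x.1 * φ 0 = 0
    rw [map_zero, mul_zero]

instance : SMulCommClass B Tᵐᵒᵖ (Column φ) where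
  smul_comm b t x := Subtype.ext (mul_assoc b x.1 (φ t.unop)).symm

instance : Module T (Row φ) where
  smul t x := ⟨φ t * x.1, by
    change φ 1 * _ = _
    rw [← mul_assoc, ← map_mul, one_mul]⟩
  one_smul x := Subtype.ext x.2
  mul_smul t t' x := Subtype.ext <| by
    change φ (t * t') * x.1 = φ t * (φ t' * x.1)
    rw [map_mul, mul_assoc]
  smul_zero t := Subtype.ext (mul_zero _)
  smul_add t x y := Subtype.ext (mul_add _ _ _)
  add_smul t t' x := Subtype.ext <| by
    change φ (t + t') * x.1 = φ t * x.1 + φ t' * x.1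
    rw [map_add, add_mul]
  zero_smul x := Subtype.ext <| by
    change φ 0 * x.1 = 0
    rw [map_zero, zero_mul]

instance : SMulCommClass T Bᵐᵒᵖ (Row φ) where
  smul_comm t b x := Subtype.ext (mul_assoc (φ t) x.1 b.unop).symm

instance : Module.Projective B (Column φ) := by
  have h1 : φ 1 * φ 1 = φ 1 := by rw [← map_mul, mul_one]
  refine Module.Projective.of_split (M := B) (Column φ).subtype
    (LinearMap.codRestrict (Column φ) (LinearMap.toSpanSingleton B B (φ 1)) ?_) ?_
  · intro b
    change b * φ 1 * φ 1 = b * φ 1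
    rw [mul_assoc, h1]
  · exact LinearMap.ext fun x => Subtype.ext x.2

/-- The functor `B e ⊗_T -` from `T`-modules to `B`-modules. -/
def functorF : ModuleCat.{u} T ⥤ ModuleCat.{u} B := tensorFunctor B T (Column φ)

/-- The functor `Hom_B(B e, -)` from `B`-modules to `T`-modules. -/
def functorG : ModuleCat.{u} B ⥤ ModuleCat.{u} T := homFunctor B T (Column φ)

/-- The functor `Hom_T(e B, -)` from `T`-modules to `B`-modules. -/
def functorH : ModuleCat.{u} T ⥤ ModuleCat.{u} B := homFunctor T B (Row φ)

instance : (functorF φ).Additive := inferInstanceAs (tensorFunctor B T (Column φ)).Additive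
instance : (functorG φ).Additive := inferInstanceAs (homFunctor B T (Column φ)).Additive
instance : (functorH φ).Additive := inferInstanceAs (homFunctor T B (Row φ)).Additive
instance : PreservesFiniteLimits (functorG φ) :=
  inferInstanceAs (PreservesFiniteLimits (homFunctor B T (Column φ)))
instance : PreservesFiniteColimits (functorG φ) :=
  inferInstanceAs (PreservesFiniteColimits (homFunctor B T (Column φ)))

end Corner
section Radical

theorem mem_jacobson_of_forall_mul_mul_mem {S : Type u} [Ring S] {x : S} (h : ∀ y, y * x * (y * x) ∈ Ring.jacobson S) :
    x ∈ Ring.jacobson S := by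
  rw [← Ideal.jacobson_bot, Ideal.mem_jacobson_iff]
  intro y
  have h1 := h y
  rw [← Ideal.jacobson_bot, Ideal.mem_jacobson_iff] at h1
  obtain ⟨z, hz⟩ := h1 (-1)
  -- z (1 - (yx)^2) = 1
  refine ⟨z * (1 - y * x), ?_⟩
  rw [Ideal.mem_bot] at hz ⊢
  rw [← hz]
  noncomm_ring

variable {S : Type u} [Ring S]

theorem isArtinianRing_quotient_jacobson [Finite (MaximalSpectrum (Subring.center S))] [Module.Finite (Subring.center S) S] :
    IsArtinianRing (S ⧸ Ring.jacobson S) := by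
  let R := Subring.center S
  have key : ∀ r ∈ Ring.jacobson R, (r : S) ∈ Ring.jacobson S := by
    intro r hr
    rw [← Ideal.jacobson_bot, Ideal.mem_jacobson_iff]
    intro y
    let N : Submodule R S := LinearMap.range (LinearMap.mulRight R (y * (r:S) + 1))
    have : (⊤ : Submodule R S) ≤ N := by
      refine Submodule.le_of_le_smul_of_le_jacobson_bot (I := Ring.jacobson R) Module.Finite.fg_top
        (by rw [Ideal.jacobson_bot]) ?_
      intro s _
      have : s = s * (y * r + 1) + r • (- (s * y)) := by
        rw [Subring.smul_def, smul_eq_mul]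
        have := Subring.mem_center_iff.mp r.2 (s * y)
        rw [mul_neg, ← this]
        noncomm_ring
      rw [this]
      exact Submodule.add_mem_sup ⟨s, rfl⟩ (Submodule.smul_mem_smul hr trivial)
    obtain ⟨z, hz⟩ := this (show (1 : S) ∈ _ from trivial)
    refine ⟨z, ?_⟩
    rw [Ideal.mem_bot]
    have hz : z * (y * r + 1) = 1 := hz
    rw [← hz]; noncomm_ring
  have ss : IsSemisimpleRing (R ⧸ Ring.jacobson R) := by
    let Spec := {I : Ideal R | I.IsMaximal}
    have : Finite Spec := Finite.of_injective (β := MaximalSpectrum R) (fun I => ⟨I.1, I.2⟩)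
      (fun I J h => Subtype.ext (congrArg MaximalSpectrum.asIdeal h))
    have (I : Spec) : I.1.IsMaximal := I.2
    have (I : Spec) : IsSemisimpleRing (R ⧸ I.1) := let _ := Ideal.Quotient.field I.1; inferInstance
    rw [Ring.jacobson_eq_sInf_isMaximal, sInf_eq_iInf']
    exact (Ideal.quotientInfRingEquivPiQuotient _ fun I J ne ↦
      Ideal.isCoprime_of_isMaximal <| Subtype.coe_ne_coe.mpr ne).symm.isSemisimpleRing
  have tors : Module.IsTorsionBySet R (S ⧸ Ring.jacobson S) (Ring.jacobson R : Set R) := by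
    intro x r
    obtain ⟨x, rfl⟩ := Ideal.Quotient.mk_surjective x
    refine (Ideal.Quotient.eq_zero_iff_mem (I := Ring.jacobson S) (a := (r.1 : S) * x)).mpr ?_
    exact Ideal.mul_mem_right _ _ (key r.1 r.2)
  let _ := tors.module
  have : IsScalarTower R (R ⧸ Ring.jacobson R) (S ⧸ Ring.jacobson S) := tors.isScalarTower
  have : Module.Finite R (S ⧸ Ring.jacobson S) :=
    Module.Finite.of_surjective (Submodule.mkQ ((Ring.jacobson S).restrictScalars R))
      (Submodule.mkQ_surjective _)
  have : Module.Finite (R ⧸ Ring.jacobson R) (S ⧸ Ring.jacobson S) :=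
    Module.Finite.of_restrictScalars_finite R _ _
  have a1 : IsArtinian (R ⧸ Ring.jacobson R) (S ⧸ Ring.jacobson S) := inferInstance
  have : IsScalarTower (R ⧸ Ring.jacobson R) (S ⧸ Ring.jacobson S) (S ⧸ Ring.jacobson S) := by
    constructor
    intro a b c
    obtain ⟨a, rfl⟩ := Ideal.Quotient.mk_surjective a
    exact smul_mul_assoc a b c
  exact isArtinian_of_tower (R ⧸ Ring.jacobson R) a1

/-- A two-sided ideal has an element that is a two-sided identity for it modulo the radical. -/
theorem exists_identity_mod_jacobson [IsArtinianRing (S ⧸ Ring.jacobson S)] (C : Ideal S) [C.IsTwoSided] :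
    ∃ c ∈ C, ∀ x ∈ C, x - c * x ∈ Ring.jacobson S ∧ x - x * c ∈ Ring.jacobson S := by
  have hs : IsSemisimpleRing (S ⧸ Ring.jacobson S) := by
    rw [IsArtinianRing.isSemisimpleRing_iff_jacobson]
    exact Ring.jacobson_quotient_jacobson S
  obtain ⟨e, he, hI⟩ := IsSemisimpleRing.ideal_eq_span_idempotent
    (C.map (Ideal.Quotient.mk (Ring.jacobson S)))
  have hemem : e ∈ C.map (Ideal.Quotient.mk (Ring.jacobson S)) := by
    rw [hI]; exact Ideal.subset_span rfl
  obtain ⟨c, hc, rfl⟩ := (Ideal.mem_map_iff_of_surjective _ Ideal.Quotient.mk_surjective).mp hemem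
  have right : ∀ x ∈ C, x - x * c ∈ Ring.jacobson S := by
    intro x hx
    rw [← Ideal.Quotient.eq_zero_iff_mem, map_sub, map_mul]
    have : Ideal.Quotient.mk (Ring.jacobson S) x ∈ Ideal.span {Ideal.Quotient.mk (Ring.jacobson S) c} := by
      rw [← hI]; exact Ideal.mem_map_of_mem _ hx
    obtain ⟨y, hy⟩ := Ideal.mem_span_singleton'.mp this
    rw [← hy, mul_assoc, he.eq, sub_self]
  refine ⟨c, hc, fun x hx => ⟨mem_jacobson_of_forall_mul_mul_mem fun y => ?_, right x hx⟩⟩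
  have h1 : x * y * x ∈ C := C.mul_mem_left _ hx
  have h2 := right (x * y) (C.mul_mem_right _ hx)
  have : y * (x - c * x) * (y * (x - c * x)) = (y * (1 - c)) * ((x * y - x * y * c) * x) := by
    noncomm_ring
  rw [this]
  exact Ideal.mul_mem_left _ _ (Ideal.mul_mem_right _ _ h2)
end Radical

section Orders

variable {Λ : Type u} [Ring Λ]

/-- The subring `A` of `Λ` is a one-dimensional order with rational envelope `Λ`: its center `R` is
a reduced noetherian ring of Krull dimension one, `A` is a finitely generated `R`-module, `Λ` is
obtained from `A` by inverting the non-zero-divisors of `R` (that is, `Λ = K ⊗_R A`, where `K` is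
the total ring of fractions of `R`; as `A ⊆ Λ`, the `R`-module `A` is torsion free), and `Λ` is
semisimple. -/
structure IsOrder (A : Subring Λ) : Prop where
  isNoetherianRing : IsNoetherianRing (Subring.center A)
  isReduced : IsReduced (Subring.center A)
  krullDim : ringKrullDim (Subring.center A) = 1
  finite : Module.Finite (Subring.center A) A
  isUnit : ∀ r ∈ nonZeroDivisors (Subring.center A), IsUnit ((r : A) : Λ)
  exists_mul_mem : ∀ x : Λ, ∃ r ∈ nonZeroDivisors (Subring.center A), ((r : A) : Λ) * x ∈ A
  isSemisimple : IsSemisimpleRing Λ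

/-- An overring `H` of `A`, regarded as an `(A, A)`-bimodule. -/
def OverBimodule {A H : Subring Λ} (_ : A ≤ H) : Type u := H

section

variable {A H : Subring Λ} (hAH : A ≤ H)

instance : AddCommGroup (OverBimodule hAH) := inferInstanceAs (AddCommGroup H)

instance : Module A (OverBimodule hAH) := Module.compHom H (Subring.inclusion hAH)

instance : Module (A)ᵐᵒᵖ (OverBimodule hAH) := Module.compHom H (Subring.inclusion hAH).op

instance : SMulCommClass A (A)ᵐᵒᵖ (OverBimodule hAH) where
  smul_comm a b x := (mul_assoc (Subring.inclusion hAH a) (show H from x)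
    (Subring.inclusion hAH b.unop)).symm

end

/-- `A` is a nodal order and `H` is its hereditary cover. -/
structure IsNodalOrder (A H : Subring Λ) : Prop extends IsOrder A where
  /-- The center of `A` is semilocal. -/
  semilocal : Finite (MaximalSpectrum (Subring.center A))
  /-- `H` is an overorder of `A` in the rational envelope. -/
  le : A ≤ H
  fg : Module.Finite A (OverBimodule le)
  hereditary : globalDimension H = 1
  /-- `A` and `H` have the same Jacobson radical. -/
  radical : ∀ x : Λ, (∃ hx : x ∈ A, (⟨x, hx⟩ : A) ∈ Ring.jacobson A) ↔
    ∃ hx : x ∈ H, (⟨x, hx⟩ : H) ∈ Ring.jacobson H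
  length_le : ∀ (U : Type u) [AddCommGroup U] [Module A U], IsSimpleModule A U →
    Module.length A (BalancedTensor A (OverBimodule le) U) ≤ 2

/-- The conductor `C = {a ∈ A | a H ⊆ A}`. -/
def conductor (A H : Subring Λ) : AddSubgroup Λ where
  carrier := {a | a ∈ A ∧ ∀ x ∈ H, a * x ∈ A}
  add_mem' {a b} ha hb := ⟨A.add_mem ha.1 hb.1, fun x hx => by
    rw [add_mul]; exact A.add_mem (ha.2 x hx) (hb.2 x hx)⟩
  zero_mem' := ⟨A.zero_mem, fun x _ => by rw [zero_mul]; exact A.zero_mem⟩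
  neg_mem' {a} ha := ⟨A.neg_mem ha.1, fun x hx => by
    rw [neg_mul]; exact A.neg_mem (ha.2 x hx)⟩

variable {A H : Subring Λ}

theorem mul_mem_conductor_left {a c : Λ} (ha : a ∈ A) (hc : c ∈ conductor A H) :
    a * c ∈ conductor A H :=
  ⟨A.mul_mem ha hc.1, fun x hx => by rw [mul_assoc]; exact A.mul_mem ha (hc.2 x hx)⟩

theorem mul_mem_conductor_right {c x : Λ} (hc : c ∈ conductor A H) (hx : x ∈ H) :
    c * x ∈ conductor A H :=
  ⟨hc.2 x hx, fun y hy => by rw [mul_assoc]; exact hc.2 _ (H.mul_mem hx hy)⟩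

namespace IsNodalOrder

/-- The conductor is stable under left multiplication by the hereditary cover. -/
theorem cover_mul_mem_conductor (h : IsNodalOrder A H) {x c : Λ} (hx : x ∈ H) (hc : c ∈ conductor A H) :
    x * c ∈ conductor A H := by
  have := h.semilocal
  have := h.finite
  have := isArtinianRing_quotient_jacobson (S := A)
  let I : Ideal A :=
    { carrier := {a | (a : Λ) ∈ conductor A H}
      add_mem' := fun ha hb => (conductor A H).add_mem ha hb
      zero_mem' := (conductor A H).zero_mem
      smul_mem' := fun a _ hb => mul_mem_conductor_left a.2 hb }
  have : I.IsTwoSided := ⟨fun {a} b ha => mul_mem_conductor_right ha (h.le b.2)⟩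
  obtain ⟨e, he, hid⟩ := exists_identity_mod_jacobson I
  have he' : (e : Λ) ∈ conductor A H := he
  -- elements of the common radical
  have radC : ∀ y : Λ, ∀ hy : y ∈ H, (⟨y, hy⟩ : H) ∈ Ring.jacobson H → y ∈ conductor A H := by
    intro y hy hyr
    refine ⟨((h.radical y).mpr ⟨hy, hyr⟩).1, fun z hz => ?_⟩
    exact ((h.radical (y * z)).mpr ⟨H.mul_mem hy hz,
      Ideal.mul_mem_right (⟨z, hz⟩ : H) _ hyr⟩).1
  have hid' : ∀ y (hy : y ∈ conductor A H),
      (∃ hx : y - e * y ∈ H, (⟨_, hx⟩ : H) ∈ Ring.jacobson H) ∧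
      (∃ hx : y - y * e ∈ H, (⟨_, hx⟩ : H) ∈ Ring.jacobson H) := by
    intro y hy
    have := hid ⟨y, hy.1⟩ hy
    exact ⟨(h.radical _).mp ⟨_, this.1⟩, (h.radical _).mp ⟨_, this.2⟩⟩
  -- the element `(1 - e) x e` lies in the radical
  let E : H := ⟨e, h.le e.2⟩
  let X : H := ⟨x, hx⟩
  have hrad : (1 - E) * X * E ∈ Ring.jacobson H := by
    refine mem_jacobson_of_forall_mul_mul_mem fun y => ?_
    obtain ⟨_, h4⟩ := (hid' _ (mul_mem_conductor_right he' y.2)).2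
    have h4' : E * y - E * y * E ∈ Ring.jacobson H := h4
    have : y * ((1 - E) * X * E) * (y * ((1 - E) * X * E)) =
        (y * ((1 - E) * X)) * ((E * y - E * y * E) * (X * E)) := by
      noncomm_ring
    rw [this]
    exact Ideal.mul_mem_left _ _ (Ideal.mul_mem_right _ _ h4')
  obtain ⟨_, hcl⟩ := (hid' c hc).1
  have t1 : x * (c - e * c) ∈ conductor A H :=
    radC _ _ (Ideal.mul_mem_left (Ring.jacobson H) X hcl)
  have t2 : (1 - e) * x * e * c ∈ conductor A H :=
    mul_mem_conductor_right (radC _ _ hrad) (h.le hc.1)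
  have t3 : e * (x * (e * c)) ∈ conductor A H :=
    mul_mem_conductor_right he' (H.mul_mem hx (H.mul_mem (h.le e.2) (h.le hc.1)))
  have : x * c = x * (c - e * c) + (1 - e) * x * e * c + e * (x * (e * c)) := by
    noncomm_ring
  rw [this]
  exact (conductor A H).add_mem ((conductor A H).add_mem t1 t2) t3

/-- The conductor as an ideal of `A`. -/
def conductorIdeal (_ : IsNodalOrder A H) : Ideal A where
  carrier := {a | (a : Λ) ∈ conductor A H}
  add_mem' ha hb := (conductor A H).add_mem ha hb
  zero_mem' := (conductor A H).zero_mem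
  smul_mem' a _ hb := mul_mem_conductor_left a.2 hb

variable (h : IsNodalOrder A H)

instance : h.conductorIdeal.IsTwoSided :=
  ⟨fun {_} b ha => mul_mem_conductor_right ha (h.le b.2)⟩


/-- The ring `Ā = A / C`. -/
abbrev QuotientRing : Type u := A ⧸ h.conductorIdeal

/-- The Auslander order `B`, the ring of matrices `(a, x; c, y)` with `a ∈ A`, `x, y ∈ H` and
`c ∈ C`. -/
def auslanderOrder : Subring (Matrix (Fin 2) (Fin 2) Λ) where
  carrier := {M | M 0 0 ∈ A ∧ M 0 1 ∈ H ∧ M 1 0 ∈ conductor A H ∧ M 1 1 ∈ H}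
  mul_mem' {M N} := by
    rintro ⟨h1, h2, h3, h4⟩ ⟨k1, k2, k3, k4⟩
    refine ⟨?_, ?_, ?_, ?_⟩ <;> rw [Matrix.mul_apply, Fin.sum_univ_two]
    · exact A.add_mem (A.mul_mem h1 k1) (h.cover_mul_mem_conductor h2 k3).1
    · exact H.add_mem (H.mul_mem (h.le h1) k2) (H.mul_mem h2 k4)
    · exact (conductor A H).add_mem (mul_mem_conductor_right h3 (h.le k1))
        (h.cover_mul_mem_conductor h4 k3)
    · exact H.add_mem (H.mul_mem (h.le h3.1) k2) (H.mul_mem h4 k4)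
  one_mem' := by
    refine ⟨?_, ?_, ?_, ?_⟩ <;> simp
  add_mem' := by
    rintro M N ⟨h1, h2, h3, h4⟩ ⟨k1, k2, k3, k4⟩
    exact ⟨A.add_mem h1 k1, H.add_mem h2 k2, (conductor A H).add_mem h3 k3, H.add_mem h4 k4⟩
  zero_mem' := ⟨A.zero_mem, H.zero_mem, (conductor A H).zero_mem, H.zero_mem⟩
  neg_mem' := by
    rintro M ⟨h1, h2, h3, h4⟩
    exact ⟨A.neg_mem h1, H.neg_mem h2, (conductor A H).neg_mem h3, H.neg_mem h4⟩

/-- The identification of `A` with the corner `e B e`, where `e = (1, 0; 0, 0)`. -/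
def embA : A →ₙ+* h.auslanderOrder where
  toFun a := ⟨!![(a : Λ), 0; 0, 0],
    ⟨a.2, H.zero_mem, (conductor A H).zero_mem, H.zero_mem⟩⟩
  map_mul' a b := Subtype.ext (by ext i j; fin_cases i <;> fin_cases j <;> simp [Matrix.mul_apply])
  map_zero' := Subtype.ext (by ext i j; fin_cases i <;> fin_cases j <;> simp)
  map_add' a b := Subtype.ext (by ext i j; fin_cases i <;> fin_cases j <;> simp)

/-- The identification of `H` with the corner `f B f`, where `f = (0, 0; 0, 1)`. -/
def embH : H →ₙ+* h.auslanderOrder where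
  toFun x := ⟨!![0, 0; 0, (x : Λ)],
    ⟨A.zero_mem, H.zero_mem, (conductor A H).zero_mem, x.2⟩⟩
  map_mul' a b := Subtype.ext (by ext i j; fin_cases i <;> fin_cases j <;> simp [Matrix.mul_apply])
  map_zero' := Subtype.ext (by ext i j; fin_cases i <;> fin_cases j <;> simp)
  map_add' a b := Subtype.ext (by ext i j; fin_cases i <;> fin_cases j <;> simp)

/-- The projective left `B`-module `P = B e`, with columns `(A; C)`. -/
abbrev P : Submodule h.auslanderOrder h.auslanderOrder := Column h.embA

/-- The projective left `B`-module `Q = B f`, with columns `(H; H)`. -/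
abbrev Q : Submodule h.auslanderOrder h.auslanderOrder := Column h.embH

/-- The surjection `B → A / C` sending `(a, x; c, y)` to the class of `a`. -/
def toQuotientRing : h.auslanderOrder →+* h.QuotientRing where
  toFun b := Ideal.Quotient.mk h.conductorIdeal ⟨b.1 0 0, b.2.1⟩
  map_one' := rfl
  map_zero' := rfl
  map_add' _ _ := rfl
  map_mul' b b' := by
    rw [← map_mul, Ideal.Quotient.eq]
    have : (b.1 * b'.1) 0 0 - b.1 0 0 * b'.1 0 0 ∈ conductor A H := by
      rw [Matrix.mul_apply, Fin.sum_univ_two, add_sub_cancel_left]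
      exact h.cover_mul_mem_conductor b.2.2.1 b'.2.2.2.1
    exact this

/-- The submodule `(C; C)` of `P = (A; C)`. -/
def submoduleP : Submodule h.auslanderOrder h.P where
  carrier := {x | x.1.1 0 0 ∈ conductor A H}
  add_mem' hx hy := (conductor A H).add_mem hx hy
  zero_mem' := (conductor A H).zero_mem
  smul_mem' b x hx := by
    change (b.1 * x.1.1) 0 0 ∈ conductor A H
    rw [Matrix.mul_apply, Fin.sum_univ_two]
    exact (conductor A H).add_mem (mul_mem_conductor_left b.2.1 hx)
      (h.cover_mul_mem_conductor b.2.2.1 x.1.2.2.2.1)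

/-- The submodule `(H; C)` of `Q = (H; H)`. -/
def submoduleQ : Submodule h.auslanderOrder h.Q where
  carrier := {x | x.1.1 1 1 ∈ conductor A H}
  add_mem' hx hy := (conductor A H).add_mem hx hy
  zero_mem' := (conductor A H).zero_mem
  smul_mem' b x hx := by
    change (b.1 * x.1.1) 1 1 ∈ conductor A H
    rw [Matrix.mul_apply, Fin.sum_univ_two]
    exact (conductor A H).add_mem (mul_mem_conductor_right b.2.2.2.1 x.1.2.2.1)
      (h.cover_mul_mem_conductor b.2.2.2.2 hx)

/-- The left `B`-module `S = (A; C) / (C; C)`. -/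
abbrev S : Type u := h.P ⧸ h.submoduleP

/-- The left `B`-module `T = (H; H) / (H; C)`, isomorphic to `B / B e B` and to `H / C` as a module
over `H = f B f`. -/
abbrev T : Type u := h.Q ⧸ h.submoduleQ

end IsNodalOrder
end Orders

section RestrictScalars

variable {R S : Type u} [Ring R] [Ring S] (π : R →+* S)

theorem restrictScalars_map_shortExact (X : ShortComplex (ModuleCat.{u} S)) (hX : X.ShortExact) :
    (X.map (ModuleCat.restrictScalars π)).ShortExact where
  exact := (ShortComplex.ShortExact.moduleCat_exact_iff_function_exact _).mpr
    ((ShortComplex.ShortExact.moduleCat_exact_iff_function_exact X).mp hX.exact)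
  mono_f := (ModuleCat.mono_iff_injective _).mpr hX.moduleCat_injective_f
  epi_g := (ModuleCat.epi_iff_surjective _).mpr hX.moduleCat_surjective_g

/-- Restriction of scalars, as an exact functor. -/
noncomputable abbrev inflation : ModuleCat.{u} S ⥤ ModuleCat.{u} R := ModuleCat.restrictScalars π

theorem inflation_exact :
    PreservesFiniteLimits (inflation π) ∧ PreservesFiniteColimits (inflation π) :=
  ((Functor.exact_tfae (inflation π)).out 0 3 rfl rfl).mp (restrictScalars_map_shortExact π)

instance : PreservesFiniteLimits (inflation π) := (inflation_exact π).1

instance : PreservesFiniteColimits (inflation π) := (inflation_exact π).2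

end RestrictScalars

section Derived

universe v₁ v₂ v₃ u₁ u₂ u₃

variable {𝒞 : Type u₁} [Category.{v₁} 𝒞] [Abelian 𝒞] [HasDerivedCategory.{w₁} 𝒞]
  {𝒞' : Type u₂} [Category.{v₂} 𝒞'] [Abelian 𝒞'] [HasDerivedCategory.{w₂} 𝒞']

/-- `LF` is the total left derived functor of `F` on unbounded derived categories. -/
def IsTotalLeftDerived (F : 𝒞 ⥤ 𝒞') [F.Additive]
    (LF : DerivedCategory 𝒞 ⥤ DerivedCategory 𝒞') : Prop :=
  ∃ α : DerivedCategory.Q ⋙ LF ⟶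
      F.mapHomologicalComplex (ComplexShape.up ℤ) ⋙ DerivedCategory.Q,
    LF.IsLeftDerivedFunctor α (HomologicalComplex.quasiIso 𝒞 (ComplexShape.up ℤ))

/-- `RF` is the total right derived functor of `F` on unbounded derived categories. -/
def IsTotalRightDerived (F : 𝒞 ⥤ 𝒞') [F.Additive]
    (RF : DerivedCategory 𝒞 ⥤ DerivedCategory 𝒞') : Prop :=
  ∃ α : F.mapHomologicalComplex (ComplexShape.up ℤ) ⋙ DerivedCategory.Q ⟶
      DerivedCategory.Q ⋙ RF,
    RF.IsRightDerivedFunctor α (HomologicalComplex.quasiIso 𝒞 (ComplexShape.up ℤ))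

/-- The left orthogonal `{X | Hom(X, E[n]) = 0 for all n}` of an object `E` of `𝒞`, regarded as a
complex concentrated in degree `0`. -/
def leftPerp (E : 𝒞) : ObjectProperty (DerivedCategory 𝒞) := fun X =>
  ∀ (n : ℤ) (f : X ⟶ ((DerivedCategory.singleFunctor 𝒞 0).obj E)⟦n⟧), f = 0

/-- The right orthogonal `{X | Hom(E[n], X) = 0 for all n}` of an object `E` of `𝒞`, regarded as a
complex concentrated in degree `0`. -/
def rightPerp (E : 𝒞) : ObjectProperty (DerivedCategory 𝒞) := fun X =>
  ∀ (n : ℤ) (f : ((DerivedCategory.singleFunctor 𝒞 0).obj E)⟦n⟧ ⟶ X), f = 0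

/-- A recollement of the triangulated category `𝒟` by triangulated categories `𝒰` and `𝒱`:
`iL ⊣ i ⊣ iR`, `jL ⊣ j ⊣ jR`, the functors `i`, `jL`, `jR` are fully faithful, `j i = 0`, and every
object of `𝒟` sits in the two gluing triangles. -/
structure IsRecollement {𝒰 : Type u₁} [Category.{v₁} 𝒰] [HasZeroObject 𝒰] [HasShift 𝒰 ℤ]
    [Preadditive 𝒰] [∀ n : ℤ, (shiftFunctor 𝒰 n).Additive] [Pretriangulated 𝒰]
    {𝒟 : Type u₂} [Category.{v₂} 𝒟] [HasZeroObject 𝒟] [HasShift 𝒟 ℤ]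
    [Preadditive 𝒟] [∀ n : ℤ, (shiftFunctor 𝒟 n).Additive] [Pretriangulated 𝒟]
    {𝒱 : Type u₃} [Category.{v₃} 𝒱] [HasZeroObject 𝒱] [HasShift 𝒱 ℤ]
    [Preadditive 𝒱] [∀ n : ℤ, (shiftFunctor 𝒱 n).Additive] [Pretriangulated 𝒱]
    (i : 𝒰 ⥤ 𝒟) [i.CommShift ℤ] [i.IsTriangulated] (iL iR : 𝒟 ⥤ 𝒰)
    (j : 𝒟 ⥤ 𝒱) [j.CommShift ℤ] [j.IsTriangulated] (jL jR : 𝒱 ⥤ 𝒟) : Prop where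
  i_fullyFaithful : i.Full ∧ i.Faithful
  jL_fullyFaithful : jL.Full ∧ jL.Faithful
  jR_fullyFaithful : jR.Full ∧ jR.Faithful
  comp_isZero : ∀ X : 𝒰, IsZero (j.obj (i.obj X))
  triangles : ∃ (adj₁ : iL ⊣ i) (adj₂ : i ⊣ iR) (adj₃ : jL ⊣ j) (adj₄ : j ⊣ jR), ∀ X : 𝒟,
    (∃ δ : i.obj (iL.obj X) ⟶ (jL.obj (j.obj X))⟦(1 : ℤ)⟧,
      Triangle.mk (adj₃.counit.app X : jL.obj (j.obj X) ⟶ X)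
        (adj₁.unit.app X : X ⟶ i.obj (iL.obj X)) δ ∈ distTriang 𝒟) ∧
    (∃ δ : jR.obj (j.obj X) ⟶ (i.obj (iR.obj X))⟦(1 : ℤ)⟧,
      Triangle.mk (adj₂.counit.app X : i.obj (iR.obj X) ⟶ X)
        (adj₄.unit.app X : X ⟶ jR.obj (j.obj X)) δ ∈ distTriang 𝒟)

end Derived

section AddClosure

variable (B : Type u) [Ring B] (E : Type u) [AddCommGroup E] [Module B E]

/-- The modules in `Add(E)`: direct summands of (arbitrary) direct sums of copies of `E`. -/
def AddClosure : ObjectProperty (ModuleCat.{u} B) := fun M =>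
  ∃ (ι : Type u) (s : M →ₗ[B] (ι →₀ E)) (r : (ι →₀ E) →ₗ[B] M), r ∘ₗ s = LinearMap.id

/-- The complexes of `B`-modules all of whose cohomologies belong to `Add(E)`. -/
def derivedSupport [HasDerivedCategory.{w} (ModuleCat.{u} B)] :
    ObjectProperty (DerivedCategory (ModuleCat.{u} B)) := fun X =>
  ∀ n : ℤ, AddClosure B E ((DerivedCategory.homologyFunctor (ModuleCat.{u} B) n).obj X)

end AddClosure

end NodalOrder

/-! Most of the theorem comes from one formal situation, applied to the two diagonal idempotents. A
corner ring `e B e` gives an adjoint triple F ⊣ G ⊣ H in which G is `M ↦ e M`, hence exact, and the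
unit `1 → G F` is invertible. Unbounded complexes of modules have K-projective and K-injective
resolutions (`CochainComplex.exists_isKProjective`, `CochainComplex.exists_isKInjective`). As G is
exact, F preserves K-projectives and H preserves K-injectives, so the triple passes to derived
categories and its outer functors stay fully faithful (`exists_derived_triple`). The rest is
triangulated: the cone of `LF G X ⟶ X` lies in the kernel of the derived G, so the image of LF is
the left orthogonal of that kernel, dually for RH, and the cones give the recollement
(`exists_isRecollement`). It remains to identify the kernels, which consist of the complexes whose
cohomology is killed by the idempotent.

The arithmetic input is that the common radical of A and H lies in C, so that A/C and H/C are
semisimple. Modules killed by f are the A/C-modules, those killed by e are the H/C-modules, and the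
latter form Add(T).

For f more is true. Q is free of rank two as a right H-module, so `Q ⊗_H -` is exact, and left
multiplication by the upper right matrix unit embeds fB into eB, so `Bf ⊗ fB → BfB` is bijective.
The triangle of `0 → Bf ⊗ fB → B → A/C → 0` then shows that maps from shifts of B to kernel objects
are maps from shifts of A/C; hence D(A/C) embeds fully and fills the kernel
(`inflation_mapDerivedCategory_full_faithful_essImage`). Inside D(A/C) the regular module detects
zero objects from both sides, so orthogonality to S needs no boundedness. For e the kernel is only
described through cohomology; T detects a kernel object through its extreme cohomology module, which
must exist.

For the global dimension, the counit `Bf ⊗ fN → N` has source of projective dimension at most one,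
and its kernel and cokernel are killed by f. Such modules are summands of sums of `B/BfB`, and they
have projective dimension at most one because fB embeds into a free module over the hereditary ring
H. Two short exact sequences give the bound 2. Conversely, gl.dim B ≤ 1 would descend to the corner
A, and gl.dim A < 1 would make the radicals vanish and H semisimple. -/

set_option linter.unusedSectionVars false

/-! ### Homotopy colimits and left approximations in triangulated categories -/

namespace CategoryTheory.Pretriangulated

variable {𝒯 : Type*} [Category* 𝒯] [HasZeroObject 𝒯] [HasShift 𝒯 ℤ] [Preadditive 𝒯]
  [∀ n : ℤ, (shiftFunctor 𝒯 n).Additive] [Pretriangulated 𝒯]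

/-- If every morphism from `X` to an object satisfying `N` extends along `s`, so does every
morphism from `X⟦1⟧` along `s⟦1⟧'`. -/
theorem exists_shift_comp_eq (N : ObjectProperty 𝒯) [N.IsStableUnderShift ℤ] {X X' : 𝒯}
    (s : X ⟶ X') (hs : ∀ ⦃Z : 𝒯⦄, N Z → ∀ h : X ⟶ Z, ∃ k : X' ⟶ Z, s ≫ k = h)
    {Z : 𝒯} (hZ : N Z) (h : X⟦(1 : ℤ)⟧ ⟶ Z) : ∃ k : X'⟦(1 : ℤ)⟧ ⟶ Z, s⟦(1 : ℤ)⟧' ≫ k = h := by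
  let adj := (shiftEquiv 𝒯 (1 : ℤ)).toAdjunction
  obtain ⟨k, hk⟩ := hs (N.le_shift (-1 : ℤ) _ hZ) (adj.homEquiv _ _ h)
  refine ⟨(adj.homEquiv _ _).symm k, ?_⟩
  apply (adj.homEquiv _ _).injective
  rw [← hk]
  have := adj.homEquiv_naturality_left s ((adj.homEquiv _ _).symm k)
  exact this.trans (congrArg (s ≫ ·) ((adj.homEquiv X' Z).apply_symm_apply k))

/-- A morphism `p : P ⟶ Y` with `P` in the left orthogonal of `N` that detects morphisms to test
objects has a cofiber through which the same morphisms to objects of `N` factor, and which kills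
all morphisms to test objects. -/
theorem exists_cofiber_step (N E : ObjectProperty 𝒯) [N.IsTriangulated] {P Y : 𝒯} (p : P ⟶ Y)
    (hP : N.leftOrthogonal P) (hp : ∀ ⦃Z : 𝒯⦄, E Z → ∀ f : Y ⟶ Z, p ≫ f = 0 → f = 0) :
    ∃ (Y' : 𝒯) (t : Y ⟶ Y'), (∀ ⦃Z : 𝒯⦄, E Z → ∀ f : Y' ⟶ Z, t ≫ f = 0) ∧
      ∀ ⦃Z : 𝒯⦄, N Z → Function.Bijective (fun g : Y' ⟶ Z => t ≫ g) := by
  obtain ⟨Y', t, d, hT⟩ := distinguished_cocone_triangle p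
  have hpt : p ≫ t = 0 := comp_distTriang_mor_zero₁₂ _ hT
  refine ⟨Y', t, fun Z hZ f => hp hZ _ (by rw [← Category.assoc, hpt, zero_comp]), fun Z hZ => ⟨?_, ?_⟩⟩
  · intro g g' h
    have h' : t ≫ (g - g') = 0 := by rw [Preadditive.comp_sub]; exact sub_eq_zero.mpr h
    obtain ⟨k, hk⟩ := Triangle.yoneda_exact₃ _ hT _ h'
    have hk0 : k = 0 := by
      have hP' := N.leftOrthogonal.le_shift (1 : ℤ) _ hP
      exact hP' k hZ
    rw [hk0, comp_zero] at hk
    exact sub_eq_zero.mp hk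
  · intro f
    obtain ⟨k, hk⟩ := Triangle.yoneda_exact₂ _ hT f (hP _ hZ)
    exact ⟨k, hk.symm⟩

section Tower

variable {X : ℕ → 𝒯} [HasCoproduct X] (t : ∀ n, X n ⟶ X (n + 1))

/-- The endomorphism `1 - shift` of the coproduct of a sequence. -/
noncomputable def oneSubShift : (∐ X) ⟶ ∐ X :=
  Limits.Sigma.desc fun n => Limits.Sigma.ι X n - t n ≫ Limits.Sigma.ι X (n + 1)

@[simp]
theorem ι_oneSubShift_comp (n : ℕ) {Z : 𝒯} (f : (∐ X) ⟶ Z) :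
    Limits.Sigma.ι X n ≫ oneSubShift t ≫ f =
      Limits.Sigma.ι X n ≫ f - t n ≫ Limits.Sigma.ι X (n + 1) ≫ f := by
  simp [oneSubShift, Preadditive.sub_comp]

/-- Maps killed by `1 - shift` are the compatible families: the lim term of the Milnor sequence for
maps out of the homotopy colimit. -/
theorem oneSubShift_comp_eq_zero_iff {Z : 𝒯} (f : (∐ X) ⟶ Z) :
    oneSubShift t ≫ f = 0 ↔
      ∀ n, Limits.Sigma.ι X n ≫ f = t n ≫ Limits.Sigma.ι X (n + 1) ≫ f := by
  constructor
  · intro h n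
    have := congrArg (Limits.Sigma.ι X n ≫ ·) h
    simpa [Preadditive.sub_comp, sub_eq_zero] using this
  · intro h
    ext n
    simp [← h n]

/-- The homotopy colimit of a sequence of ghost maps is acyclic, and morphisms from it to objects
satisfying `N` are determined by their restriction to the first term. -/
theorem exists_hocolim (N E : ObjectProperty 𝒯) [N.IsStableUnderShift ℤ] [E.IsStableUnderShift ℤ]
    (ht : ∀ n ⦃Z : 𝒯⦄, E Z → ∀ f : X (n + 1) ⟶ Z, t n ≫ f = 0)
    (ht' : ∀ n ⦃Z : 𝒯⦄, N Z → Function.Bijective (fun g : X (n + 1) ⟶ Z => t n ≫ g)) :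
    ∃ (C : 𝒯) (u : X 0 ⟶ C), (∀ ⦃Z : 𝒯⦄, E Z → ∀ f : C ⟶ Z, f = 0) ∧
      ∀ ⦃Z : 𝒯⦄, N Z → Function.Bijective (fun g : C ⟶ Z => u ≫ g) := by
  obtain ⟨C, q, d, hT⟩ := distinguished_cocone_triangle (oneSubShift t)
  have hsq : oneSubShift t ≫ q = 0 := comp_distTriang_mor_zero₁₂ _ hT
  have hsd : d ≫ (oneSubShift t)⟦(1 : ℤ)⟧' = 0 := comp_distTriang_mor_zero₃₁ _ hT
  -- This is the vanishing of lim¹: once maps from the coproduct extend along `1 - shift`, so do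
  -- maps from its shift, and the connecting morphism contributes nothing.
  have key : ∀ (M : ObjectProperty 𝒯) [M.IsStableUnderShift ℤ],
      (∀ ⦃Z : 𝒯⦄, M Z → ∀ h : (∐ X) ⟶ Z, ∃ k, oneSubShift t ≫ k = h) →
      ∀ ⦃Z : 𝒯⦄, M Z → ∀ g : C ⟶ Z, q ≫ g = 0 → g = 0 := by
    intro M _ hM Z hZ g hg
    obtain ⟨h, hh⟩ := Triangle.yoneda_exact₃ _ hT g hg
    obtain ⟨k, rfl⟩ := exists_shift_comp_eq M (oneSubShift t) hM hZ h
    rw [hh]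
    change d ≫ _ ≫ k = 0
    rw [← Category.assoc, hsd, zero_comp]
  refine ⟨C, Limits.Sigma.ι X 0 ≫ q, fun Z hZ f => ?_, fun Z hZ => ⟨fun g g' hgg => ?_, fun f => ?_⟩⟩
  -- On test objects the transition maps are ghosts, so precomposition with `1 - shift` is the
  -- identity: `h` extends itself, and a compatible family vanishes.
  · refine key E (fun Z hZ h => ⟨h, ?_⟩) hZ f ?_
    · ext n
      simp [ht n hZ]
    · ext n
      have := (oneSubShift_comp_eq_zero_iff t (q ≫ f)).mp (by rw [← Category.assoc, hsq, zero_comp]) n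
      rw [this, ht n hZ, comp_zero]
  · refine sub_eq_zero.mp (key N (fun Z hZ h => ?_) hZ (g - g') ?_)
    -- lim¹ vanishes since the transition maps induce surjections: solve `k n - t n ≫ k (n + 1) = ι
    -- n ≫ h` recursively from `k 0 = 0`.
    · choose b hb using fun n => (ht' n hZ).surjective
      let k : ∀ n, X n ⟶ Z := fun n =>
        Nat.rec 0 (fun n k => b n (k - Limits.Sigma.ι X n ≫ h)) n
      refine ⟨Limits.Sigma.desc k, ?_⟩
      ext n
      have : t n ≫ k (n + 1) = k n - Limits.Sigma.ι X n ≫ h := hb n _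
      simp [this]
    · have h0 := (oneSubShift_comp_eq_zero_iff t (q ≫ (g - g'))).mp
        (by rw [← Category.assoc, hsq, zero_comp])
      ext n
      rw [comp_zero]
      induction n with
      | zero =>
        rw [← Category.assoc, Preadditive.comp_sub]
        exact sub_eq_zero.mpr hgg
      | succ n ih =>
        refine (ht' n hZ).injective ?_
        rw [← h0 n, ih, comp_zero]
  · choose b hb using fun n => (ht' n hZ).surjective
    let k : ∀ n, X n ⟶ Z := fun n => Nat.rec f (fun n k => b n k) n
    have hk : ∀ n, t n ≫ k (n + 1) = k n := fun n => hb n _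
    obtain ⟨g, hg⟩ := Triangle.yoneda_exact₂ _ hT (Limits.Sigma.desc k)
      ((oneSubShift_comp_eq_zero_iff t _).mpr fun n => by simp [hk n])
    refine ⟨g, ?_⟩
    refine (Category.assoc _ _ _).trans ?_
    exact (congrArg (Limits.Sigma.ι X 0 ≫ ·) hg.symm).trans (Limits.Sigma.ι_desc _ _)

end Tower

/-- Left approximations with respect to a triangulated subcategory, from objects in its left
orthogonal which detect morphisms to test objects. -/
theorem exists_leftOrthogonal_approximation (N E : ObjectProperty 𝒯) [N.IsTriangulated]
    [E.IsStableUnderShift ℤ] [∀ X : ℕ → 𝒯, HasCoproduct X]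
    (hN : ∀ X : 𝒯, (∀ ⦃Z : 𝒯⦄, E Z → ∀ f : X ⟶ Z, f = 0) → N X)
    (hE : ∀ Y : 𝒯, ∃ (P : 𝒯) (p : P ⟶ Y), N.leftOrthogonal P ∧
      ∀ ⦃Z : 𝒯⦄, E Z → ∀ f : Y ⟶ Z, p ≫ f = 0 → f = 0) (Y : 𝒯) :
    ∃ (P : 𝒯) (p : P ⟶ Y), N.leftOrthogonal P ∧ N.trW p := by
  have step : ∀ Y : 𝒯, ∃ (Y' : 𝒯) (t : Y ⟶ Y'), (∀ ⦃Z : 𝒯⦄, E Z → ∀ f : Y' ⟶ Z, t ≫ f = 0) ∧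
      ∀ ⦃Z : 𝒯⦄, N Z → Function.Bijective (fun g : Y' ⟶ Z => t ≫ g) := fun Y => by
    obtain ⟨P, p, hP, hp⟩ := hE Y
    exact exists_cofiber_step N E p hP hp
  choose next t ht ht' using step
  -- Iterating the cofiber step makes all transition maps ghosts on test objects while maps to `N`
  -- do not change. So the colimit `C` lies in `N`, `Y ⟶ C` is a reflection into `N`, and `P` is its
  -- fiber.
  let X : ℕ → 𝒯 := fun n => Nat.rec Y (fun _ Z => next Z) n
  obtain ⟨C, u, hC, hu⟩ := exists_hocolim (X := X) (fun n => t (X n)) N E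
    (fun n => ht (X n)) (fun n => ht' (X n))
  change Y ⟶ C at u
  obtain ⟨P, p, w, hT⟩ := distinguished_cocone_triangle₁ u
  have huw : u ≫ w = 0 := comp_distTriang_mor_zero₂₃ _ hT
  have hpu : p ≫ u = 0 := comp_distTriang_mor_zero₁₂ _ hT
  refine ⟨P, p, fun Z φ hZ => ?_, (N.trW_iff p).mpr ⟨C, u, w, hT, hN C hC⟩⟩
  -- Bijectivity of `u` on maps into the shift of `Z` gives `h0`; bijectivity on maps into `Z`
  -- itself makes the shift of `φ` factor through `p ≫ u = 0`.
  have hZ' := N.le_shift (1 : ℤ) _ hZ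
  have h0 : w ≫ φ⟦(1 : ℤ)⟧' = 0 := (hu hZ').injective (by
    change u ≫ w ≫ _ = u ≫ (0 : C ⟶ _)
    rw [← Category.assoc, huw, zero_comp, comp_zero])
  obtain ⟨ψ, hψ⟩ := Triangle.yoneda_exact₃ _ (rot_of_distTriang _ hT) (φ⟦(1 : ℤ)⟧') h0
  obtain ⟨ψ, rfl⟩ := (shiftFunctor 𝒯 (1 : ℤ)).map_surjective ψ
  obtain ⟨g, rfl⟩ := (hu hZ).surjective ψ
  refine (shiftFunctor 𝒯 (1 : ℤ)).map_injective (hψ.trans ?_)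
  rw [Functor.map_zero]
  change (-(p⟦(1 : ℤ)⟧')) ≫ (u ≫ g)⟦(1 : ℤ)⟧' = 0
  rw [Preadditive.neg_comp, ← Functor.map_comp, ← Category.assoc, hpu, zero_comp, Functor.map_zero,
    neg_zero]
end CategoryTheory.Pretriangulated

/-! ### Coproducts in the homotopy category -/

namespace HomotopyCategory

section Coproducts

variable {𝒜 : Type*} [Category* 𝒜] [Preadditive 𝒜] {ι : Type*} {c : ComplexShape ι}

/-- A morphism from a coproduct of complexes is null-homotopic if its components are. -/
noncomputable def homotopyZeroOfCoproduct {J : Type*} [HasCoproductsOfShape J 𝒜]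
    {K : J → HomologicalComplex 𝒜 c} {L : HomologicalComplex 𝒜 c} (f : (∐ K) ⟶ L)
    (h : ∀ j, Homotopy (Limits.Sigma.ι K j ≫ f) 0) : Homotopy f 0 := by
  have hc (i : ι) := isColimitOfPreserves (HomologicalComplex.eval 𝒜 c i) (coproductIsCoproduct K)
  let g (i i' : ι) : (∐ K).X i ⟶ L.X i' :=
    (hc i).desc ⟨_, Discrete.natTrans fun j => (h j.as).hom i i'⟩
  have hg (j : J) (i i' : ι) : (Limits.Sigma.ι K j).f i ≫ g i i' = (h j).hom i i' :=
    (hc i).fac ⟨_, Discrete.natTrans fun j => (h j.as).hom i i'⟩ ⟨j⟩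
  refine ⟨g, fun i i' hi => (hc i).hom_ext fun ⟨j⟩ => ?_, fun i => (hc i).hom_ext fun ⟨j⟩ => ?_⟩
  · exact (hg j i i').trans (((h j).zero i i' hi).trans comp_zero.symm)
  · have h1 := (h j).comm i
    refine h1.trans ?_
    change _ = (Limits.Sigma.ι K j).f i ≫ _
    simp only [Preadditive.comp_add, dNext, prevD, AddMonoidHom.mk'_apply,
      HomologicalComplex.zero_f, comp_zero]
    congr 2
    · rw [HomologicalComplex.Hom.comm_assoc, hg]
    · rw [reassoc_of% hg]

/-- The coproduct of complexes stays a coproduct up to homotopy: components lift to chain maps, and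
uniqueness holds because null-homotopies of the components glue. -/
instance {J : Type*} [HasCoproductsOfShape J 𝒜] (K : J → HomologicalComplex 𝒜 c) :
    HasCoproduct fun j => (quotient 𝒜 c).obj (K j) := by
  refine ⟨⟨⟨Cofan.mk ((quotient 𝒜 c).obj (∐ K))
    (fun j => (quotient 𝒜 c).map (Limits.Sigma.ι K j)), ?_⟩⟩⟩
  choose r hr using fun (Z : HomotopyCategory 𝒜 c) (j : J)
    (f : (quotient 𝒜 c).obj (K j) ⟶ (quotient 𝒜 c).obj Z.as) => (quotient 𝒜 c).map_surjective f
  have fac {Z : HomotopyCategory 𝒜 c}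
      (f : ∀ j, (quotient 𝒜 c).obj (K j) ⟶ (quotient 𝒜 c).obj Z.as) (j : J) :
      (quotient 𝒜 c).map (Limits.Sigma.ι K j) ≫
        (quotient 𝒜 c).map (Limits.Sigma.desc fun j => r Z j (f j)) = f j := by
    rw [← Functor.map_comp, Sigma.ι_desc]
    exact hr Z j (f j)
  refine Cofan.IsColimit.mk _
    (fun s => (quotient 𝒜 c).map (Limits.Sigma.desc fun j => r s.pt j (s.inj j)))
    (fun s j => fac s.inj j) (fun s m hm => ?_)
  obtain ⟨m, rfl⟩ := (quotient 𝒜 c).map_surjective (Y := s.pt.as) m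
  refine sub_eq_zero.mp ((Functor.map_sub _).symm.trans
    ((eq_of_homotopy _ _ (homotopyZeroOfCoproduct _ fun j => homotopyOfEq _ _ ?_)).trans
    (Functor.map_zero _ _ _)))
  rw [Functor.map_zero, Functor.map_comp, Functor.map_sub, Preadditive.comp_sub]
  exact sub_eq_zero.mpr ((hm j).trans (fac s.inj j).symm)

instance {J : Type*} [HasCoproductsOfShape J 𝒜] (X : J → HomotopyCategory 𝒜 c) :
    HasCoproduct X :=
  inferInstanceAs (HasCoproduct fun j => (quotient 𝒜 c).obj (X j).as)

end Coproducts

end HomotopyCategory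

/-! ### K-projective resolutions of unbounded complexes -/

namespace CochainComplex

open HomComplex

variable {𝒜 : Type*} [Category* 𝒜] [Abelian 𝒜]

/-- A homotopy into a complex concentrated in degree `n` has a single relevant component, the one
leaving degree `n + 1`. -/
theorem quotient_map_toSingle_eq_zero_iff {K : CochainComplex 𝒜 ℤ} {E : 𝒜} {n : ℤ}
    (f : K ⟶ (HomologicalComplex.single 𝒜 (.up ℤ) n).obj E) :
    (HomotopyCategory.quotient 𝒜 (.up ℤ)).map f = 0 ↔
      ∃ g : K.X (n + 1) ⟶ _, K.d n (n + 1) ≫ g = f.f n := by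
  rw [HomotopyCategory.quotient_map_eq_zero_iff]
  constructor
  · rintro ⟨h⟩
    refine ⟨h.hom (n + 1) n, ?_⟩
    have := h.comm n
    rw [dNext_eq _ (show (ComplexShape.up ℤ).Rel n (n + 1) from rfl)] at this
    simpa [prevD] using this.symm
  · rintro ⟨g, hg⟩
    refine ⟨(Cochain.equivHomotopy _ _).symm
      ⟨Cochain.toSingleMk (g ≫ (HomologicalComplex.singleObjXSelf _ _ _).hom)
        (show n + 1 + -1 = n by lia), ?_⟩⟩
    apply (Cochain.toSingleEquiv (X := E) (add_zero n)).injective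
    have h1 := Cochain.δ_toSingleMk (g ≫ (HomologicalComplex.singleObjXSelf (.up ℤ) n E).hom)
      (show n + 1 + -1 = n by lia) 0 n (by lia)
    refine Eq.trans ?_ (congrArg (Cochain.toSingleEquiv (X := E) (add_zero n))
      (((congrArg (_ + ·) (Cochain.ofHom_zero _ _)).trans (add_zero _)).trans h1 |>.trans
        (one_smul _ _))).symm
    rw [Cochain.toSingleEquiv_toSingleMk, reassoc_of% hg]
    exact congrArg (· ≫ _) (Cochain.ofHom_v f n)

/-- The differential of the source vanishes, so between complexes concentrated in the same degree
null-homotopic means zero. -/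
theorem quotient_map_fromSingle_comp_toSingle_eq_zero {K : CochainComplex 𝒜 ℤ} {P E : 𝒜} {n : ℤ}
    (p : (HomologicalComplex.single 𝒜 (.up ℤ) n).obj P ⟶ K)
    (f : K ⟶ (HomologicalComplex.single 𝒜 (.up ℤ) n).obj E)
    (h : (HomotopyCategory.quotient 𝒜 (.up ℤ)).map (p ≫ f) = 0) : p.f n ≫ f.f n = 0 := by
  obtain ⟨g, hg⟩ := (quotient_map_toSingle_eq_zero_iff _).mp h
  rw [← HomologicalComplex.comp_f, ← hg, HomologicalComplex.single_obj_d, zero_comp]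

/-- A complex all of whose morphisms to shifts of injective objects are null-homotopic is
acyclic. -/
theorem acyclic_of_forall_toSingle [EnoughInjectives 𝒜] (K : CochainComplex 𝒜 ℤ)
    (h : ∀ (n : ℤ) (E : 𝒜) [Injective E] (f : K ⟶ (HomologicalComplex.single 𝒜 (.up ℤ) n).obj E),
      (HomotopyCategory.quotient 𝒜 (.up ℤ)).map f = 0) : K.Acyclic := by
  intro n
  -- The test object is an injective containing the opcycles. A map that factors through `d`
  -- vanishes on cycles, so homology maps to zero in the opcycles, where it embeds.
  obtain ⟨g, hg⟩ := (quotient_map_toSingle_eq_zero_iff _).mp (h n (Injective.under (K.opcycles n))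
    (HomologicalComplex.mkHomToSingle (K.pOpcycles n ≫ Injective.ι _) (by simp)))
  rw [HomologicalComplex.mkHomToSingle_f, Iso.eq_comp_inv] at hg
  have h1 : K.homologyπ n ≫ K.homologyι n ≫ Injective.ι (K.opcycles n) = 0 := by
    rw [HomologicalComplex.homology_π_ι_assoc, ← hg]
    simp
  have h1 : K.homologyι n = 0 := zero_of_comp_mono _ (zero_of_epi_comp _ h1)
  rw [HomologicalComplex.exactAt_iff_isZero_homology]
  exact (IsZero.iff_id_eq_zero _).mpr ((cancel_mono (K.homologyι n)).mp (by simp [h1]))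

/-- The projective covers of the cycles of a complex. -/
theorem exists_leftOrthogonal_detecting [EnoughProjectives 𝒜] [HasCoproductsOfShape ℤ 𝒜]
    (K : CochainComplex 𝒜 ℤ) :
    ∃ (P : HomotopyCategory 𝒜 (.up ℤ)) (p : P ⟶ (HomotopyCategory.quotient 𝒜 (.up ℤ)).obj K),
      (HomotopyCategory.subcategoryAcyclic 𝒜).leftOrthogonal P ∧
      ∀ (n : ℤ) (E : 𝒜) [Injective E] (f : K ⟶ (HomologicalComplex.single 𝒜 (.up ℤ) n).obj E),
        p ≫ (HomotopyCategory.quotient 𝒜 (.up ℤ)).map f = 0 →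
          (HomotopyCategory.quotient 𝒜 (.up ℤ)).map f = 0 := by
  let S (n : ℤ) : CochainComplex 𝒜 ℤ := (HomologicalComplex.single 𝒜 (.up ℤ) n).obj (Projective.over (K.cycles n))
  let s (n : ℤ) : S n ⟶ K :=
    HomologicalComplex.mkHomFromSingle (Projective.π (K.cycles n) ≫ K.iCycles n) (by simp)
  have hS (n : ℤ) : (S n).IsKProjective := by
    have : (S n).IsStrictlyLE n := inferInstanceAs (((singleFunctor 𝒜 n).obj _).IsStrictlyLE n)
    have (i : ℤ) : Projective ((S n).X i) := by
      by_cases hi : i = n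
      · subst hi
        exact Projective.of_iso (HomologicalComplex.singleObjXSelf (.up ℤ) i _).symm inferInstance
      · exact (HomologicalComplex.isZero_single_obj_X _ _ _ _ hi).projective
    exact isKProjective_of_projective _ n
  refine ⟨∐ fun n => (HomotopyCategory.quotient 𝒜 (.up ℤ)).obj (S n),
    Limits.Sigma.desc fun n => (HomotopyCategory.quotient 𝒜 (.up ℤ)).map (s n),
    fun Z φ hZ => ?_, fun n E _ f hf => ?_⟩
  · ext n
    rw [comp_zero]
    exact IsKProjective.leftOrthogonal (S n) _ hZ
  -- `f` vanishes on cycles because the chosen projectives surject onto them; it then extends from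
  -- the image of `d` to degree `n + 1` by injectivity, which is the null-homotopy.
  · have h1 : (s n).f n ≫ f.f n = 0 := by
      refine quotient_map_fromSingle_comp_toSingle_eq_zero _ _ ?_
      have := congrArg (Limits.Sigma.ι _ n ≫ ·) hf
      simpa using this
    rw [quotient_map_toSingle_eq_zero_iff]
    have h2 : K.iCycles n ≫ f.f n = 0 := by
      rw [HomologicalComplex.mkHomFromSingle_f] at h1
      refine (cancel_epi (Projective.π (K.cycles n))).mp ?_
      simpa using h1
    have hex : (ShortComplex.mk (K.iCycles n) (K.d n (n + 1)) (by simp)).Exact :=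
      ShortComplex.exact_of_f_is_kernel _ (K.cyclesIsKernel n (n + 1) (by simp))
    have : Injective (((HomologicalComplex.single 𝒜 (.up ℤ) n).obj E).X n) :=
      Injective.of_iso (HomologicalComplex.singleObjXSelf (.up ℤ) n E).symm inferInstance
    exact ⟨hex.descToInjective _ h2, hex.comp_descToInjective _ _⟩

/-- Every complex in an abelian category with enough projectives, enough injectives and countable
coproducts has a K-projective resolution. -/
theorem exists_isKProjective [EnoughProjectives 𝒜] [EnoughInjectives 𝒜]
    [HasCoproductsOfShape ℤ 𝒜] [HasCoproductsOfShape ℕ 𝒜] (K : CochainComplex 𝒜 ℤ) :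
    ∃ (P : CochainComplex 𝒜 ℤ) (p : P ⟶ K), P.IsKProjective ∧ QuasiIso p := by
  -- The test objects are the injectives in a single degree: they detect acyclicity, and maps to
  -- them are detected on cycles, so no bound on `K` enters.
  let E : ObjectProperty (HomotopyCategory 𝒜 (.up ℤ)) := fun X =>
    ∃ (n : ℤ) (I : 𝒜) (_ : Injective I),
      Nonempty (X ≅ (HomotopyCategory.quotient 𝒜 (.up ℤ)).obj
        ((HomologicalComplex.single 𝒜 (.up ℤ) n).obj I))
  have : E.IsStableUnderShift ℤ := ⟨fun a => ⟨fun X ⟨n, I, hI, ⟨e⟩⟩ => ⟨n - a, I, hI,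
    ⟨(CategoryTheory.shiftFunctor (HomotopyCategory 𝒜 (.up ℤ)) a).mapIso e ≪≫
      ((HomotopyCategory.singleFunctors 𝒜).shiftIso a (n - a) n (by lia)).app I⟩⟩⟩⟩
  suffices ∃ (P : HomotopyCategory 𝒜 (.up ℤ))
      (p : P ⟶ (HomotopyCategory.quotient 𝒜 (.up ℤ)).obj K),
      (HomotopyCategory.subcategoryAcyclic 𝒜).leftOrthogonal P ∧
        (HomotopyCategory.subcategoryAcyclic 𝒜).trW p by
    obtain ⟨P, p, hP, hp⟩ := this
    obtain ⟨P, rfl⟩ := HomotopyCategory.quotient_obj_surjective P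
    obtain ⟨p, rfl⟩ := (HomotopyCategory.quotient 𝒜 (.up ℤ)).map_surjective p
    refine ⟨P, p, (isKProjective_iff_leftOrthogonal P).mpr hP, ?_⟩
    rwa [← HomotopyCategory.quasiIso_eq_trW_subcategoryAcyclic,
      HomotopyCategory.quotient_map_mem_quasiIso_iff, HomologicalComplex.mem_quasiIso_iff] at hp
  refine Pretriangulated.exists_leftOrthogonal_approximation
    (HomotopyCategory.subcategoryAcyclic 𝒜) E ?_ ?_ _
  · intro X hX
    obtain ⟨X, rfl⟩ := HomotopyCategory.quotient_obj_surjective X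
    rw [HomotopyCategory.quotient_obj_mem_subcategoryAcyclic_iff_acyclic]
    exact acyclic_of_forall_toSingle X fun n I hI f => hX ⟨n, I, hI, ⟨Iso.refl _⟩⟩ _
  · intro Y
    obtain ⟨Y, rfl⟩ := HomotopyCategory.quotient_obj_surjective Y
    obtain ⟨P, p, hP, hp⟩ := exists_leftOrthogonal_detecting Y
    refine ⟨P, p, hP, ?_⟩
    rintro Z ⟨n, I, _, ⟨e⟩⟩ f hf
    obtain ⟨g, hg⟩ := (HomotopyCategory.quotient 𝒜 (.up ℤ)).map_surjective (f ≫ e.hom)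
    rw [← cancel_mono e.hom, zero_comp, ← hg]
    exact hp n I g (by rw [hg, reassoc_of% hf, zero_comp])

end CochainComplex

/-! ### K-injective resolutions, by passing to the opposite category -/

namespace CochainComplex

open Opposite

variable {𝒜 : Type*} [Category* 𝒜] [Abelian 𝒜]

theorem isKInjective_of_op {K : CochainComplex 𝒜 ℤ}
    (hK : IsKProjective ((opEquivalence 𝒜).functor.obj (op K))) : K.IsKInjective where
  nonempty_homotopy_zero {L} f hL :=
    ⟨homotopyUnop ((IsKProjective.homotopyZero
      ((opEquivalence 𝒜).functor.map f.op) (acyclic_op hL)).trans (.ofEq (by simp)))⟩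

theorem quasiIso_of_op {K L : CochainComplex 𝒜 ℤ} (f : K ⟶ L)
    (hf : QuasiIso ((opEquivalence 𝒜).functor.map f.op)) : QuasiIso f where
  quasiIsoAt n := by
    have := hf.quasiIsoAt (-n)
    rw [quasiIsoAt_iff' _ (-n - 1) (-n) (-n + 1) (by simp) (by simp)] at this
    rw [show n = - -n by simp,
      quasiIsoAt_iff' _ (-(-n + 1)) (- -n) (-(-n - 1)) (by grind [prev]) (by grind [next])]
    exact (ShortComplex.quasiIso_opMap_iff _).mp this

/-- Every complex in an abelian category with enough projectives, enough injectives and countable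
products has a K-injective resolution. -/
theorem exists_isKInjective [EnoughProjectives 𝒜] [EnoughInjectives 𝒜]
    [HasProductsOfShape ℤ 𝒜] [HasProductsOfShape ℕ 𝒜] (K : CochainComplex 𝒜 ℤ) :
    ∃ (I : CochainComplex 𝒜 ℤ) (i : K ⟶ I), I.IsKInjective ∧ QuasiIso i := by
  have := hasCoproductsOfShape_opposite (C := 𝒜) (X := ℤ)
  have := hasCoproductsOfShape_opposite (C := 𝒜) (X := ℕ)
  obtain ⟨P, p, hP, hp⟩ := exists_isKProjective ((opEquivalence 𝒜).functor.obj (op K))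
  let e := (opEquivalence 𝒜).functor.objObjPreimageIso P
  obtain ⟨f, hf⟩ := (opEquivalence 𝒜).functor.map_surjective (e.hom ≫ p)
  refine ⟨_, f.unop, isKInjective_of_op (isKProjective_of_iso e.symm), quasiIso_of_op _ ?_⟩
  change QuasiIso ((opEquivalence 𝒜).functor.map f)
  rw [hf]
  infer_instance

end CochainComplex

/-! ### Recognition of derived functors by resolutions -/

namespace CategoryTheory.Functor

variable {C D H : Type*} [Category* C] [Category* D] [Category* H] {L : C ⥤ D}
  (W : MorphismProperty C) [L.IsLocalization W] {F : C ⥤ H}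

/-- A functor on a localization is a left derived functor if every object admits a resolution, by
an object from which morphisms in the localization lift, where the comparison morphism is
invertible. -/
theorem isLeftDerivedFunctor_of_resolutions {LF : D ⥤ H} (α : L ⋙ LF ⟶ F)
    (h : ∀ Y : C, ∃ (P : C) (p : P ⟶ Y), IsIso (L.map p) ∧ IsIso (α.app P) ∧
      ∀ Z : C, Function.Surjective (fun f : P ⟶ Z => L.map f)) :
    LF.IsLeftDerivedFunctor α W := by
  choose P p hp hα hL using h
  have := Localization.full_whiskeringLeft L W H
  have := Localization.faithful_whiskeringLeft L W H
  -- Every object is isomorphic, in the localization, to its resolution, where `α` can be cancelled.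
  have ext {K : D ⥤ H} (γ γ' : K ⟶ LF) (hγ : whiskerLeft L γ ≫ α = whiskerLeft L γ' ≫ α) :
      γ = γ' := by
    apply ((whiskeringLeft C D H).obj L).map_injective
    ext Y
    change γ.app _ = γ'.app _
    have h1 := NatTrans.congr_app hγ (P Y)
    change γ.app _ ≫ α.app (P Y) = γ'.app _ ≫ α.app (P Y) at h1
    rw [cancel_mono] at h1
    rw [← cancel_epi (K.map (L.map (p Y))), γ.naturality, γ'.naturality, h1]
  have lift {K : D ⥤ H} (β : L ⋙ K ⟶ F) : ∃ γ : K ⟶ LF, whiskerLeft L γ ≫ α = β := by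
    -- The value forced by naturality: move to the resolution and invert `α` there. Naturality of
    -- `τ` uses the lifting of morphisms between resolutions.
    let τ : L ⋙ K ⟶ L ⋙ LF :=
      { app Y := CategoryTheory.inv (K.map (L.map (p Y))) ≫ β.app (P Y) ≫
          CategoryTheory.inv (α.app (P Y)) ≫ LF.map (L.map (p Y))
        naturality Y Y' f := by
          obtain ⟨f', hf'⟩ := hL Y (P Y') (L.map (p Y ≫ f) ≫ CategoryTheory.inv (L.map (p Y')))
          have hf : L.map f' ≫ L.map (p Y') = L.map (p Y) ≫ L.map f := by
            simpa using congrArg (· ≫ L.map (p Y')) hf'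
          have hβ := β.naturality f'
          have hα := α.naturality f'
          dsimp at hβ hα ⊢
          rw [← cancel_epi (K.map (L.map (p Y)))]
          simp only [Category.assoc, IsIso.hom_inv_id_assoc]
          rw [← K.map_comp_assoc, ← hf, K.map_comp_assoc, IsIso.hom_inv_id_assoc, reassoc_of% hβ,
            ← LF.map_comp, ← hf, LF.map_comp]
          congr 1
          rw [IsIso.eq_inv_comp, ← reassoc_of% hα, IsIso.hom_inv_id_assoc] }
    obtain ⟨γ, hγ⟩ : ∃ γ : K ⟶ LF, whiskerLeft L γ = τ :=
      ((whiskeringLeft C D H).obj L).map_surjective τ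
    refine ⟨γ, ?_⟩
    rw [hγ]
    ext Y
    change (CategoryTheory.inv (K.map (L.map (p Y))) ≫ β.app (P Y) ≫
      CategoryTheory.inv (α.app (P Y)) ≫ LF.map (L.map (p Y))) ≫ α.app Y = β.app Y
    have h1 := α.naturality (p Y)
    have h2 := β.naturality (p Y)
    dsimp at h1 h2
    simp only [Category.assoc]
    rw [IsIso.inv_comp_eq, h1, IsIso.inv_hom_id_assoc, h2]
  exact ⟨⟨⟨IsTerminal.ofUniqueHom
    (fun X => CostructuredArrow.homMk (lift X.hom).choose (lift X.hom).choose_spec)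
    (fun X m => CostructuredArrow.hom_ext _ _
      (ext _ _ ((CostructuredArrow.w m).trans (lift X.hom).choose_spec.symm)))⟩⟩⟩

/-- A functor on a localization is a right derived functor if every object admits a resolution, by
an object to which morphisms in the localization lift, where the comparison morphism is
invertible. -/
theorem isRightDerivedFunctor_of_resolutions {RF : D ⥤ H} (α : F ⟶ L ⋙ RF)
    (h : ∀ Y : C, ∃ (I : C) (i : Y ⟶ I), IsIso (L.map i) ∧ IsIso (α.app I) ∧
      ∀ Z : C, Function.Surjective (fun f : Z ⟶ I => L.map f)) :
    RF.IsRightDerivedFunctor α W := by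
  choose I i hi hα hL using h
  have := Localization.full_whiskeringLeft L W H
  have := Localization.faithful_whiskeringLeft L W H
  have ext {K : D ⥤ H} (γ γ' : RF ⟶ K) (hγ : α ≫ whiskerLeft L γ = α ≫ whiskerLeft L γ') :
      γ = γ' := by
    apply ((whiskeringLeft C D H).obj L).map_injective
    ext Y
    change γ.app _ = γ'.app _
    have h1 := NatTrans.congr_app hγ (I Y)
    change α.app (I Y) ≫ γ.app _ = α.app (I Y) ≫ γ'.app _ at h1
    rw [cancel_epi] at h1
    rw [← cancel_mono (K.map (L.map (i Y))), ← γ.naturality, ← γ'.naturality, h1]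
  have lift {K : D ⥤ H} (β : F ⟶ L ⋙ K) : ∃ γ : RF ⟶ K, α ≫ whiskerLeft L γ = β := by
    let τ : L ⋙ RF ⟶ L ⋙ K :=
      { app Y := RF.map (L.map (i Y)) ≫ CategoryTheory.inv (α.app (I Y)) ≫ β.app (I Y) ≫
          CategoryTheory.inv (K.map (L.map (i Y)))
        naturality Y Y' f := by
          obtain ⟨f', hf'⟩ := hL Y' (I Y) (CategoryTheory.inv (L.map (i Y)) ≫ L.map (f ≫ i Y'))
          have hf : L.map (i Y) ≫ L.map f' = L.map f ≫ L.map (i Y') := by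
            simpa using congrArg (L.map (i Y) ≫ ·) hf'
          have hβ := β.naturality f'
          have hα := α.naturality f'
          dsimp at hβ hα ⊢
          rw [← cancel_mono (K.map (L.map (i Y')))]
          simp only [Category.assoc, IsIso.inv_hom_id, Category.comp_id]
          rw [← K.map_comp, ← hf, K.map_comp, IsIso.inv_hom_id_assoc, ← hβ,
            ← RF.map_comp_assoc, ← hf, RF.map_comp_assoc]
          congr 1
          rw [← cancel_epi (α.app (I Y)), ← reassoc_of% hα, IsIso.hom_inv_id_assoc,
            IsIso.hom_inv_id_assoc] }
    obtain ⟨γ, hγ⟩ : ∃ γ : RF ⟶ K, whiskerLeft L γ = τ :=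
      ((whiskeringLeft C D H).obj L).map_surjective τ
    refine ⟨γ, ?_⟩
    rw [hγ]
    ext Y
    change α.app Y ≫ RF.map (L.map (i Y)) ≫ CategoryTheory.inv (α.app (I Y)) ≫ β.app (I Y) ≫
          CategoryTheory.inv (K.map (L.map (i Y))) = β.app Y
    have h1 := α.naturality (i Y)
    have h2 := β.naturality (i Y)
    dsimp at h1 h2
    rw [← reassoc_of% h1, IsIso.hom_inv_id_assoc, reassoc_of% h2, IsIso.hom_inv_id,
      Category.comp_id]
  exact ⟨⟨⟨IsInitial.ofUniqueHom
    (fun X => StructuredArrow.homMk (lift X.hom).choose (lift X.hom).choose_spec)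
    (fun X m => StructuredArrow.hom_ext _ _
      (ext _ _ ((StructuredArrow.w m).trans (lift X.hom).choose_spec.symm)))⟩⟩⟩

end CategoryTheory.Functor

/-! ### Adjoints from universal arrows -/

namespace CategoryTheory

variable {C D : Type*} [Category* C] [Category* D]

/-- A functor admitting universal arrows has a left adjoint. -/
theorem exists_leftAdjoint_of_universal (G : D ⥤ C) (Y : C → D) (η : ∀ X, X ⟶ G.obj (Y X))
    (hη : ∀ X Z, Function.Bijective (fun f : Y X ⟶ Z => η X ≫ G.map f)) :
    ∃ (F : C ⥤ D) (adj : F ⊣ G), ∀ X, ∃ e : F.obj X ≅ Y X, adj.unit.app X ≫ G.map e.hom = η X := by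
  let e (X : C) (Z : D) : (Y X ⟶ Z) ≃ (X ⟶ G.obj Z) := Equiv.ofBijective _ (hη X Z)
  have he : ∀ X Z Z' g h, e X Z' (h ≫ g) = e X Z h ≫ G.map g := by
    intro X Z Z' g h
    simp [e]
  refine ⟨_, Adjunction.adjunctionOfEquivLeft e he, fun X => ⟨Iso.refl _, ?_⟩⟩
  simp [e]

/-- A functor admitting couniversal arrows has a right adjoint. -/
theorem exists_rightAdjoint_of_universal (F : C ⥤ D) (Y : D → C) (ε : ∀ X, F.obj (Y X) ⟶ X)
    (hε : ∀ X Z, Function.Bijective (fun f : Z ⟶ Y X => F.map f ≫ ε X)) :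
    ∃ (G : D ⥤ C) (adj : F ⊣ G), ∀ X, ∃ e : G.obj X ≅ Y X,
      F.map e.inv ≫ adj.counit.app X = ε X := by
  let e (Z : C) (X : D) : (F.obj Z ⟶ X) ≃ (Z ⟶ Y X) := (Equiv.ofBijective _ (hε X Z)).symm
  have he : ∀ X' X Y f g, e X' Y (F.map f ≫ g) = f ≫ e X Y g := by
    intro X' X Y f g
    dsimp only [e]
    rw [Equiv.symm_apply_eq]
    obtain ⟨g, rfl⟩ := (e X Y).symm.surjective g
    simp [e]
  refine ⟨_, Adjunction.adjunctionOfEquivRight e he, fun X => ⟨Iso.refl _, ?_⟩⟩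
  simp [e]

end CategoryTheory

/-! ### Adjunctions on complexes -/

namespace CategoryTheory.Adjunction

variable {𝒜 ℬ : Type*} [Category* 𝒜] [Category* ℬ] [Preadditive 𝒜] [Preadditive ℬ]
  {F : 𝒜 ⥤ ℬ} {G : ℬ ⥤ 𝒜} [F.Additive] [G.Additive]

/-- The adjunction between categories of complexes induced by an adjunction of additive
functors. -/
@[simps]
def mapHomologicalComplex (adj : F ⊣ G) {ι : Type*} (c : ComplexShape ι) :
    F.mapHomologicalComplex c ⊣ G.mapHomologicalComplex c where
  unit :=
    { app K := { f i := adj.unit.app (K.X i), comm' i j _ := (adj.unit.naturality (K.d i j)).symm }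
      naturality K L f := by
        ext i
        exact adj.unit.naturality (f.f i) }
  counit :=
    { app K :=
        { f i := adj.counit.app (K.X i), comm' i j _ := (adj.counit.naturality (K.d i j)).symm }
      naturality K L f := by
        ext i
        exact adj.counit.naturality (f.f i) }
  left_triangle_components K := by
    ext i
    exact adj.left_triangle_components (K.X i)
  right_triangle_components K := by
    ext i
    exact adj.right_triangle_components (K.X i)

end CategoryTheory.Adjunction

/-! ### Morphisms from K-projective and to K-injective complexes, and their preservation -/

namespace CochainComplex

variable {𝒜 : Type*} [Category* 𝒜] [Abelian 𝒜]

open DerivedCategory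

section

variable [HasDerivedCategory.{w₁} 𝒜]

theorem IsKProjective.Q_map_surjective (P : CochainComplex 𝒜 ℤ) [P.IsKProjective]
    (K : CochainComplex 𝒜 ℤ) : Function.Surjective (fun f : P ⟶ K => Q.map f) := by
  intro g
  obtain ⟨g', hg'⟩ := (IsKProjective.Qh_map_bijective P
    ((HomotopyCategory.quotient _ _).obj K)).2
    ((quotientCompQhIso 𝒜).hom.app P ≫ g ≫ (quotientCompQhIso 𝒜).inv.app K)
  obtain ⟨f, rfl⟩ := (HomotopyCategory.quotient _ _).map_surjective g'
  refine ⟨f, ?_⟩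
  have h := quotientCompQhIso_hom_naturality f
  rw [hg'] at h
  rw [← cancel_epi ((quotientCompQhIso 𝒜).hom.app P)]
  simpa using h.symm

theorem IsKProjective.nonempty_homotopy_of_Q_map_eq_zero {P : CochainComplex 𝒜 ℤ}
    [P.IsKProjective] {K : CochainComplex 𝒜 ℤ} (f : P ⟶ K) (hf : Q.map f = 0) :
    Nonempty (Homotopy f 0) := by
  refine ⟨HomotopyCategory.homotopyOfEq _ _ ?_⟩
  apply (IsKProjective.Qh_map_bijective P ((HomotopyCategory.quotient _ _).obj K)).1
  rw [Functor.map_zero, Functor.map_zero]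
  have h := quotientCompQhIso_hom_naturality f
  rw [hf, comp_zero] at h
  exact (cancel_mono ((quotientCompQhIso 𝒜).hom.app K)).1 (h.trans zero_comp.symm)

theorem IsKInjective.Q_map_surjective (I : CochainComplex 𝒜 ℤ) [I.IsKInjective]
    (K : CochainComplex 𝒜 ℤ) : Function.Surjective (fun f : K ⟶ I => Q.map f) := by
  intro g
  obtain ⟨g', hg'⟩ := (IsKInjective.Qh_map_bijective
    ((HomotopyCategory.quotient _ _).obj K) I).2
    ((quotientCompQhIso 𝒜).hom.app K ≫ g ≫ (quotientCompQhIso 𝒜).inv.app I)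
  obtain ⟨f, rfl⟩ := (HomotopyCategory.quotient _ _).map_surjective g'
  refine ⟨f, ?_⟩
  have h := quotientCompQhIso_hom_naturality f
  rw [hg'] at h
  rw [← cancel_epi ((quotientCompQhIso 𝒜).hom.app K)]
  simpa using h.symm

theorem IsKInjective.nonempty_homotopy_of_Q_map_eq_zero {I : CochainComplex 𝒜 ℤ}
    [I.IsKInjective] {K : CochainComplex 𝒜 ℤ} (f : K ⟶ I) (hf : Q.map f = 0) :
    Nonempty (Homotopy f 0) := by
  refine ⟨HomotopyCategory.homotopyOfEq _ _ ?_⟩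
  apply (IsKInjective.Qh_map_bijective ((HomotopyCategory.quotient _ _).obj K) I).1
  rw [Functor.map_zero, Functor.map_zero]
  have h := quotientCompQhIso_hom_naturality f
  rw [hf, comp_zero] at h
  exact (cancel_mono ((quotientCompQhIso 𝒜).hom.app I)).1 (h.trans zero_comp.symm)

end

variable {ℬ : Type*} [Category* ℬ] [Abelian ℬ]

theorem acyclic_map {G : ℬ ⥤ 𝒜} [G.Additive] [PreservesFiniteLimits G]
    [PreservesFiniteColimits G] {K : CochainComplex ℬ ℤ} (hK : K.Acyclic) :
    HomologicalComplex.Acyclic ((G.mapHomologicalComplex _).obj K) := fun i => (hK i).map G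

/-- A map from `F P` to an acyclic `L` transposes to a map from `P` to `G L`, which is acyclic by
exactness of `G`; its null-homotopy transposes back. -/
theorem IsKProjective.map {F : 𝒜 ⥤ ℬ} {G : ℬ ⥤ 𝒜} [F.Additive] [G.Additive]
    [PreservesFiniteLimits G] [PreservesFiniteColimits G] (adj : F ⊣ G)
    (P : CochainComplex 𝒜 ℤ) [P.IsKProjective] :
    IsKProjective ((F.mapHomologicalComplex _).obj P) where
  nonempty_homotopy_zero {L} f hL := by
    let adj' := adj.mapHomologicalComplex (ComplexShape.up ℤ)
    have h := F.mapHomotopy (IsKProjective.homotopyZero (adj'.homEquiv _ _ f) (acyclic_map hL))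
    refine ⟨((Homotopy.ofEq ?_).trans (h.compRight (adj'.counit.app L))).trans
      (Homotopy.ofEq (by simp))⟩
    exact ((adj'.homEquiv _ _).symm_apply_apply f).symm.trans (adj'.homEquiv_counit _ _ _)

theorem IsKInjective.map {G : ℬ ⥤ 𝒜} {H : 𝒜 ⥤ ℬ} [G.Additive] [H.Additive]
    [PreservesFiniteLimits G] [PreservesFiniteColimits G] (adj : G ⊣ H)
    (I : CochainComplex 𝒜 ℤ) [I.IsKInjective] :
    IsKInjective ((H.mapHomologicalComplex _).obj I) where
  nonempty_homotopy_zero {L} f hL := by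
    let adj' := adj.mapHomologicalComplex (ComplexShape.up ℤ)
    have h := H.mapHomotopy
      (IsKInjective.homotopyZero ((adj'.homEquiv _ _).symm f) (acyclic_map hL))
    refine ⟨((Homotopy.ofEq ?_).trans (h.compLeft (adj'.unit.app L))).trans
      (Homotopy.ofEq (by simp))⟩
    exact ((adj'.homEquiv _ _).apply_symm_apply f).symm.trans (adj'.homEquiv_unit _ _ _)

end CochainComplex

/-! ### Derived adjunctions for an exact functor -/

namespace NodalOrder

open DerivedCategory

variable {𝒜 ℬ : Type*} [Category* 𝒜] [Abelian 𝒜] [HasDerivedCategory.{w₁} 𝒜]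
  [Category* ℬ] [Abelian ℬ] [HasDerivedCategory.{w₂} ℬ]

section LeftAdjoint

variable {F : 𝒜 ⥤ ℬ} {G : ℬ ⥤ 𝒜} [F.Additive] [G.Additive]
    [PreservesFiniteLimits G] [PreservesFiniteColimits G] (adj : F ⊣ G)

/-- The universal arrow `P ⟶ G (F P)` in the derived category, for a K-projective complex `P`. -/
noncomputable def derivedUnit (P : CochainComplex 𝒜 ℤ) :
    Q.obj P ⟶ G.mapDerivedCategory.obj (Q.obj ((F.mapHomologicalComplex _).obj P)) :=
  Q.map ((adj.mapHomologicalComplex _).unit.app P) ≫ G.mapDerivedCategoryFactors.inv.app _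

theorem derivedUnit_comp_map {P : CochainComplex 𝒜 ℤ} {K : CochainComplex ℬ ℤ}
    (f : (F.mapHomologicalComplex _).obj P ⟶ K) :
    derivedUnit adj P ≫ G.mapDerivedCategory.map (Q.map f) =
      Q.map ((adj.mapHomologicalComplex _).homEquiv _ _ f) ≫
        G.mapDerivedCategoryFactors.inv.app K := by
  have h := G.mapDerivedCategoryFactors.inv.naturality f
  dsimp at h
  rw [derivedUnit, Category.assoc, ← h, Adjunction.homEquiv_unit, Functor.map_comp, Category.assoc]

/-- Both sides are homotopy classes of chain maps: `F P` is again K-projective, `Z` may be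
represented by a complex, and transposition along the adjunction respects homotopies. -/
theorem derivedUnit_bijective (P : CochainComplex 𝒜 ℤ) [P.IsKProjective]
    (Z : DerivedCategory ℬ) : Function.Bijective
      (fun f : Q.obj ((F.mapHomologicalComplex _).obj P) ⟶ Z =>
        derivedUnit adj P ≫ G.mapDerivedCategory.map f) := by
  have := CochainComplex.IsKProjective.map adj P
  let adj' := adj.mapHomologicalComplex (ComplexShape.up ℤ)
  let K := Q.objPreimage Z
  let e : Q.obj K ≅ Z := Q.objObjPreimageIso Z
  constructor
  · let Φ : (Q.obj ((F.mapHomologicalComplex _).obj P) ⟶ Z) →+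
        (Q.obj P ⟶ G.mapDerivedCategory.obj Z) :=
      (Preadditive.leftComp _ (derivedUnit adj P)).comp G.mapDerivedCategory.mapAddHom
    refine (injective_iff_map_eq_zero Φ).2 fun φ hφ => ?_
    replace hφ : derivedUnit adj P ≫ G.mapDerivedCategory.map φ = 0 := hφ
    obtain ⟨f, hf⟩ := CochainComplex.IsKProjective.Q_map_surjective _ K (φ ≫ e.inv)
    dsimp only at hf
    have h1 : Q.map (adj'.homEquiv _ _ f) = 0 := by
      rw [← cancel_mono (G.mapDerivedCategoryFactors.inv.app K), zero_comp]
      refine (derivedUnit_comp_map adj f).symm.trans ?_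
      rw [hf, Functor.map_comp, reassoc_of% hφ, zero_comp]
    obtain ⟨h2⟩ := CochainComplex.IsKProjective.nonempty_homotopy_of_Q_map_eq_zero _ h1
    have h3 : Q.map f = 0 := by
      have h4 : f = (F.mapHomologicalComplex _).map (adj'.homEquiv _ _ f) ≫ adj'.counit.app K :=
        ((adj'.homEquiv _ _).symm_apply_apply f).symm.trans (adj'.homEquiv_counit _ _ _)
      rw [h4, Functor.map_comp, Q_map_eq_of_homotopy _ (F.mapHomotopy h2)]
      simp
    rw [← cancel_mono e.inv, ← hf, h3, zero_comp]
  · intro ψ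
    obtain ⟨g, hg⟩ := CochainComplex.IsKProjective.Q_map_surjective P
      ((G.mapHomologicalComplex _).obj K)
      (ψ ≫ G.mapDerivedCategory.map e.inv ≫ G.mapDerivedCategoryFactors.hom.app K)
    dsimp only at hg
    refine ⟨Q.map ((adj'.homEquiv _ _).symm g) ≫ e.hom, ?_⟩
    dsimp only
    rw [Functor.map_comp, ← Category.assoc, derivedUnit_comp_map, Equiv.apply_symm_apply, hg]
    simp [← Functor.map_comp]

theorem exists_isKProjective_iso
    (hP : ∀ K : CochainComplex 𝒜 ℤ, ∃ (P : CochainComplex 𝒜 ℤ) (p : P ⟶ K),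
      P.IsKProjective ∧ QuasiIso p) (X : DerivedCategory 𝒜) :
    ∃ P : CochainComplex 𝒜 ℤ, P.IsKProjective ∧ Nonempty (Q.obj P ≅ X) := by
  obtain ⟨P, p, h, _⟩ := hP (Q.objPreimage X)
  exact ⟨P, h, ⟨asIso (Q.map p) ≪≫ Q.objObjPreimageIso X⟩⟩

/-- No functorial choice of resolutions is needed: `derivedUnit_bijective` gives a universal arrow
at each object, and functoriality follows from universality. -/
theorem exists_derived_leftAdjoint (adj : F ⊣ G)
    (hP : ∀ K : CochainComplex 𝒜 ℤ, ∃ (P : CochainComplex 𝒜 ℤ) (p : P ⟶ K),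
      P.IsKProjective ∧ QuasiIso p) :
    ∃ LF : DerivedCategory 𝒜 ⥤ DerivedCategory ℬ, Nonempty (LF ⊣ G.mapDerivedCategory) := by
  choose P h e using exists_isKProjective_iso hP
  obtain ⟨LF, adjD, -⟩ := exists_leftAdjoint_of_universal G.mapDerivedCategory
    (fun X => Q.obj ((F.mapHomologicalComplex _).obj (P X)))
    (fun X => (e X).some.inv ≫ derivedUnit adj (P X)) (fun X Z => by
      simp only [Category.assoc]
      exact ((e X).some.symm.homFromEquiv.symm.bijective).comp (derivedUnit_bijective adj (P X) Z))
  exact ⟨LF, ⟨adjD⟩⟩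

variable {LF : DerivedCategory 𝒜 ⥤ DerivedCategory ℬ} (adjD : LF ⊣ G.mapDerivedCategory)

/-- The comparison morphism from the left adjoint of the derived functor of `G` to `F`. -/
noncomputable def derivedComparison :
    Q ⋙ LF ⟶ F.mapHomologicalComplex (ComplexShape.up ℤ) ⋙ Q where
  app K := (adjD.homEquiv _ _).symm (derivedUnit adj K)
  naturality K L f := by
    dsimp
    rw [← adjD.homEquiv_naturality_left_symm, ← adjD.homEquiv_naturality_right_symm,
      derivedUnit_comp_map]
    congr 1
    have h := (adj.mapHomologicalComplex (ComplexShape.up ℤ)).unit.naturality f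
    dsimp only [Functor.id_map, Functor.comp_map] at h
    rw [Adjunction.homEquiv_unit, ← h, Functor.map_comp, derivedUnit, Category.assoc]

theorem unit_comp_map_derivedComparison (K : CochainComplex 𝒜 ℤ) :
    adjD.unit.app _ ≫ G.mapDerivedCategory.map ((derivedComparison adj adjD).app K) =
      derivedUnit adj K := by
  exact (adjD.homEquiv_unit _ _ _).symm.trans ((adjD.homEquiv _ _).apply_symm_apply _)

theorem isIso_derivedComparison_app (P : CochainComplex 𝒜 ℤ) [P.IsKProjective] :
    IsIso ((derivedComparison adj adjD).app P) := by
  refine isIso_of_coyoneda_map_bijective _ fun Z => ?_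
  refine (Function.Bijective.of_comp_iff' (adjD.homEquiv _ _).bijective _).1 ?_
  refine Eq.mpr (congrArg Function.Bijective (funext fun f => ?_))
    (derivedUnit_bijective adj P Z)
  refine (adjD.homEquiv_naturality_right _ _).trans ?_
  exact congrArg (· ≫ _) ((adjD.homEquiv _ _).apply_symm_apply _)

/-- The adjoint already determines a comparison with `F`, which is invertible on K-projective
complexes; these resolve every complex and maps out of them lift. -/
theorem isTotalLeftDerived_of_adjunction (adj : F ⊣ G) (adjD : LF ⊣ G.mapDerivedCategory)
    (hP : ∀ K : CochainComplex 𝒜 ℤ, ∃ (P : CochainComplex 𝒜 ℤ) (p : P ⟶ K),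
      P.IsKProjective ∧ QuasiIso p) : IsTotalLeftDerived F LF := by
  refine ⟨derivedComparison adj adjD, ?_⟩
  refine Functor.isLeftDerivedFunctor_of_resolutions _ _ fun K => ?_
  obtain ⟨P, p, h, _⟩ := hP K
  exact ⟨P, p, inferInstance, isIso_derivedComparison_app adj adjD P,
    CochainComplex.IsKProjective.Q_map_surjective P⟩

/-- On a K-projective complex the derived unit followed by the comparison is, in each degree, the
unit of `adj`. -/
theorem isIso_derived_unit (adj : F ⊣ G) (adjD : LF ⊣ G.mapDerivedCategory) [IsIso adj.unit]
    (hP : ∀ K : CochainComplex 𝒜 ℤ, ∃ (P : CochainComplex 𝒜 ℤ) (p : P ⟶ K),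
      P.IsKProjective ∧ QuasiIso p) : IsIso adjD.unit := by
  have (X : DerivedCategory 𝒜) : IsIso (adjD.unit.app X) := by
    obtain ⟨P, h, ⟨e⟩⟩ := exists_isKProjective_iso hP X
    rw [← NatTrans.isIso_app_iff_of_iso adjD.unit e]
    have := isIso_derivedComparison_app adj adjD P
    have : IsIso ((adj.mapHomologicalComplex (ComplexShape.up ℤ)).unit.app P) := by
      have (i : ℤ) : IsIso (((adj.mapHomologicalComplex (ComplexShape.up ℤ)).unit.app P).f i) :=
        inferInstanceAs (IsIso (adj.unit.app _))
      exact HomologicalComplex.Hom.isIso_of_components _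
    have : IsIso (adjD.unit.app (Q.obj P) ≫
        G.mapDerivedCategory.map ((derivedComparison adj adjD).app P)) := by
      rw [unit_comp_map_derivedComparison, derivedUnit]
      infer_instance
    exact IsIso.of_isIso_comp_right _
      (G.mapDerivedCategory.map ((derivedComparison adj adjD).app P))
  exact NatIso.isIso_of_isIso_app _

end LeftAdjoint

section RightAdjoint

variable {G : ℬ ⥤ 𝒜} {H : 𝒜 ⥤ ℬ} [G.Additive] [H.Additive]
    [PreservesFiniteLimits G] [PreservesFiniteColimits G] (adj : G ⊣ H)

/-- The couniversal arrow `G (H I) ⟶ I` in the derived category, for a K-injective complex `I`. -/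
noncomputable def derivedCounit (I : CochainComplex 𝒜 ℤ) :
    G.mapDerivedCategory.obj (Q.obj ((H.mapHomologicalComplex _).obj I)) ⟶ Q.obj I :=
  G.mapDerivedCategoryFactors.hom.app _ ≫ Q.map ((adj.mapHomologicalComplex _).counit.app I)

theorem map_comp_derivedCounit {I : CochainComplex 𝒜 ℤ} {K : CochainComplex ℬ ℤ}
    (f : K ⟶ (H.mapHomologicalComplex _).obj I) :
    G.mapDerivedCategory.map (Q.map f) ≫ derivedCounit adj I =
      G.mapDerivedCategoryFactors.hom.app K ≫
        Q.map (((adj.mapHomologicalComplex _).homEquiv _ _).symm f) := by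
  have h := G.mapDerivedCategoryFactors.hom.naturality f
  dsimp at h
  rw [derivedCounit, reassoc_of% h, Adjunction.homEquiv_counit, Functor.map_comp]

theorem derivedCounit_bijective (I : CochainComplex 𝒜 ℤ) [I.IsKInjective]
    (Z : DerivedCategory ℬ) : Function.Bijective
      (fun f : Z ⟶ Q.obj ((H.mapHomologicalComplex _).obj I) =>
        G.mapDerivedCategory.map f ≫ derivedCounit adj I) := by
  have := CochainComplex.IsKInjective.map adj I
  let adj' := adj.mapHomologicalComplex (ComplexShape.up ℤ)
  let K := Q.objPreimage Z
  let e : Q.obj K ≅ Z := Q.objObjPreimageIso Z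
  constructor
  · let Φ : (Z ⟶ Q.obj ((H.mapHomologicalComplex _).obj I)) →+
        (G.mapDerivedCategory.obj Z ⟶ Q.obj I) :=
      (Preadditive.rightComp _ (derivedCounit adj I)).comp G.mapDerivedCategory.mapAddHom
    refine (injective_iff_map_eq_zero Φ).2 fun φ hφ => ?_
    replace hφ : G.mapDerivedCategory.map φ ≫ derivedCounit adj I = 0 := hφ
    obtain ⟨f, hf⟩ := CochainComplex.IsKInjective.Q_map_surjective _ K (e.hom ≫ φ)
    dsimp only at hf
    have h1 : Q.map ((adj'.homEquiv _ _).symm f) = 0 := by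
      rw [← cancel_epi (G.mapDerivedCategoryFactors.hom.app K), comp_zero]
      refine (map_comp_derivedCounit adj f).symm.trans ?_
      rw [hf, Functor.map_comp, Category.assoc, hφ, comp_zero]
    obtain ⟨h2⟩ := CochainComplex.IsKInjective.nonempty_homotopy_of_Q_map_eq_zero _ h1
    have h3 : Q.map f = 0 := by
      have h4 : f = adj'.unit.app K ≫ (H.mapHomologicalComplex _).map ((adj'.homEquiv _ _).symm f) :=
        ((adj'.homEquiv _ _).apply_symm_apply f).symm.trans (adj'.homEquiv_unit _ _ _)
      rw [h4, Functor.map_comp, Q_map_eq_of_homotopy _ (H.mapHomotopy h2)]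
      simp
    rw [← cancel_epi e.hom, ← hf, h3, comp_zero]
  · intro ψ
    obtain ⟨g, hg⟩ := CochainComplex.IsKInjective.Q_map_surjective I
      ((G.mapHomologicalComplex _).obj K)
      (G.mapDerivedCategoryFactors.inv.app K ≫ G.mapDerivedCategory.map e.hom ≫ ψ)
    dsimp only at hg
    refine ⟨e.inv ≫ Q.map (adj'.homEquiv _ _ g), ?_⟩
    dsimp only
    rw [Functor.map_comp, Category.assoc, map_comp_derivedCounit, Equiv.symm_apply_apply, hg]
    simp [← Functor.map_comp_assoc]

theorem exists_isKInjective_iso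
    (hI : ∀ K : CochainComplex 𝒜 ℤ, ∃ (I : CochainComplex 𝒜 ℤ) (i : K ⟶ I),
      I.IsKInjective ∧ QuasiIso i) (X : DerivedCategory 𝒜) :
    ∃ I : CochainComplex 𝒜 ℤ, I.IsKInjective ∧ Nonempty (Q.obj I ≅ X) := by
  obtain ⟨I, i, h, _⟩ := hI (Q.objPreimage X)
  exact ⟨I, h, ⟨(asIso (Q.map i)).symm ≪≫ Q.objObjPreimageIso X⟩⟩

theorem exists_derived_rightAdjoint (adj : G ⊣ H)
    (hI : ∀ K : CochainComplex 𝒜 ℤ, ∃ (I : CochainComplex 𝒜 ℤ) (i : K ⟶ I),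
      I.IsKInjective ∧ QuasiIso i) :
    ∃ RH : DerivedCategory 𝒜 ⥤ DerivedCategory ℬ, Nonempty (G.mapDerivedCategory ⊣ RH) := by
  choose I h e using exists_isKInjective_iso hI
  obtain ⟨RH, adjD, -⟩ := exists_rightAdjoint_of_universal G.mapDerivedCategory
    (fun X => Q.obj ((H.mapHomologicalComplex _).obj (I X)))
    (fun X => derivedCounit adj (I X) ≫ (e X).some.hom) (fun X Z => by
      simp only [← Category.assoc]
      exact ((e X).some.homToEquiv.bijective).comp (derivedCounit_bijective adj (I X) Z))
  exact ⟨RH, ⟨adjD⟩⟩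

variable {RH : DerivedCategory 𝒜 ⥤ DerivedCategory ℬ} (adjD : G.mapDerivedCategory ⊣ RH)

/-- The comparison morphism from `H` to the right adjoint of the derived functor of `G`. -/
noncomputable def derivedCocomparison :
    H.mapHomologicalComplex (ComplexShape.up ℤ) ⋙ Q ⟶ Q ⋙ RH where
  app K := adjD.homEquiv _ _ (derivedCounit adj K)
  naturality K L f := by
    dsimp
    rw [← adjD.homEquiv_naturality_left, ← adjD.homEquiv_naturality_right,
      map_comp_derivedCounit]
    congr 1
    have h := (adj.mapHomologicalComplex (ComplexShape.up ℤ)).counit.naturality f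
    dsimp only [Functor.id_map, Functor.comp_map] at h
    rw [Adjunction.homEquiv_counit, h, Functor.map_comp, derivedCounit, Category.assoc]

theorem isIso_derivedCocomparison_app (I : CochainComplex 𝒜 ℤ) [I.IsKInjective] :
    IsIso ((derivedCocomparison adj adjD).app I) := by
  refine isIso_of_yoneda_map_bijective _ fun Z => ?_
  refine (Function.Bijective.of_comp_iff' (adjD.homEquiv _ _).symm.bijective _).1 ?_
  refine Eq.mpr (congrArg Function.Bijective (funext fun f => ?_))
    (derivedCounit_bijective adj I Z)
  refine (adjD.homEquiv_naturality_left_symm _ _).trans ?_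
  exact congrArg (_ ≫ ·) ((adjD.homEquiv _ _).symm_apply_apply _)

theorem isTotalRightDerived_of_adjunction (adj : G ⊣ H) (adjD : G.mapDerivedCategory ⊣ RH)
    (hI : ∀ K : CochainComplex 𝒜 ℤ, ∃ (I : CochainComplex 𝒜 ℤ) (i : K ⟶ I),
      I.IsKInjective ∧ QuasiIso i) : IsTotalRightDerived H RH := by
  refine ⟨derivedCocomparison adj adjD, ?_⟩
  refine Functor.isRightDerivedFunctor_of_resolutions _ _ fun K => ?_
  obtain ⟨I, i, h, _⟩ := hI K
  exact ⟨I, i, inferInstance, isIso_derivedCocomparison_app adj adjD I,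
    CochainComplex.IsKInjective.Q_map_surjective I⟩

end RightAdjoint

section Triple

/-- An adjoint triple of additive functors, whose middle term is exact and whose outer terms are
fully faithful, between categories with resolutions, induces an adjoint triple of derived
functors, whose outer terms are fully faithful. -/
theorem exists_derived_triple {F : 𝒜 ⥤ ℬ} {G : ℬ ⥤ 𝒜} {H : 𝒜 ⥤ ℬ} [F.Additive] [G.Additive]
    [H.Additive] [PreservesFiniteLimits G] [PreservesFiniteColimits G] (adj₁ : F ⊣ G)
    (adj₂ : G ⊣ H) [IsIso adj₁.unit]
    (hP : ∀ K : CochainComplex 𝒜 ℤ, ∃ (P : CochainComplex 𝒜 ℤ) (p : P ⟶ K),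
      P.IsKProjective ∧ QuasiIso p)
    (hI : ∀ K : CochainComplex 𝒜 ℤ, ∃ (I : CochainComplex 𝒜 ℤ) (i : K ⟶ I),
      I.IsKInjective ∧ QuasiIso i) :
    ∃ (LF RH : DerivedCategory 𝒜 ⥤ DerivedCategory ℬ),
      IsTotalLeftDerived F LF ∧ IsTotalRightDerived H RH ∧
      Nonempty (LF ⊣ G.mapDerivedCategory) ∧ Nonempty (G.mapDerivedCategory ⊣ RH) ∧
      (LF.Full ∧ LF.Faithful) ∧ (RH.Full ∧ RH.Faithful) ∧ G.mapDerivedCategory.EssSurj := by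
  obtain ⟨LF, ⟨adjL⟩⟩ := exists_derived_leftAdjoint adj₁ hP
  obtain ⟨RH, ⟨adjR⟩⟩ := exists_derived_rightAdjoint adj₂ hI
  have := isIso_derived_unit adj₁ adjL hP
  have hF := adjL.fullyFaithfulLOfIsIsoUnit
  -- In an adjoint triple one outer functor is fully faithful exactly when the other is.
  have hR := (Adjunction.Triple.mk adjL adjR).fullyFaithfulEquiv hF
  exact ⟨LF, RH, isTotalLeftDerived_of_adjunction adj₁ adjL hP,
    isTotalRightDerived_of_adjunction adj₂ adjR hI, ⟨adjL⟩, ⟨adjR⟩, ⟨hF.full, hF.faithful⟩,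
    ⟨hR.full, hR.faithful⟩, ⟨fun X => ⟨LF.obj X, ⟨(asIso (adjL.unit.app X)).symm⟩⟩⟩⟩

end Triple

end NodalOrder

/-! ### Orthogonality and replacement of vertices in distinguished triangles -/

namespace CategoryTheory.Pretriangulated

variable {𝒟 : Type*} [Category* 𝒟] [HasZeroObject 𝒟] [HasShift 𝒟 ℤ]
    [Preadditive 𝒟] [∀ n : ℤ, (shiftFunctor 𝒟 n).Additive] [Pretriangulated 𝒟]

theorem bijective_mor₂_comp {T : Triangle 𝒟} (hT : T ∈ distTriang 𝒟) {W : 𝒟}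
    (h₁ : ∀ f : T.obj₁ ⟶ W, f = 0) (h₂ : ∀ f : T.obj₁⟦(1 : ℤ)⟧ ⟶ W, f = 0) :
    Function.Bijective (fun g : T.obj₃ ⟶ W => T.mor₂ ≫ g) := by
  constructor
  · refine (injective_iff_map_eq_zero (Preadditive.leftComp W T.mor₂)).2 fun g hg => ?_
    obtain ⟨k, rfl⟩ := Triangle.yoneda_exact₃ T hT g hg
    rw [h₂ k, comp_zero]
  · intro f
    obtain ⟨g, rfl⟩ := Triangle.yoneda_exact₂ T hT f (h₁ _)
    exact ⟨g, rfl⟩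

theorem bijective_comp_mor₁ {T : Triangle 𝒟} (hT : T ∈ distTriang 𝒟) {W : 𝒟}
    (h₁ : ∀ f : W ⟶ T.obj₃, f = 0) (h₂ : ∀ f : W⟦(1 : ℤ)⟧ ⟶ T.obj₃, f = 0) :
    Function.Bijective (fun g : W ⟶ T.obj₁ => g ≫ T.mor₁) := by
  constructor
  · refine (injective_iff_map_eq_zero (Preadditive.rightComp W T.mor₁)).2 fun g hg => ?_
    replace hg : g ≫ T.mor₁ = 0 := hg
    obtain ⟨k, hk⟩ := Triangle.coyoneda_exact₁ T hT (g⟦(1 : ℤ)⟧')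
      (by rw [← Functor.map_comp, hg, Functor.map_zero])
    apply (shiftFunctor 𝒟 (1 : ℤ)).map_injective
    rw [hk, h₂ k, zero_comp, Functor.map_zero]
  · intro f
    obtain ⟨g, rfl⟩ := Triangle.coyoneda_exact₂ T hT f (h₁ _)
    exact ⟨g, rfl⟩

theorem distinguished_of_iso₃ {X Y Z Z' : 𝒟} {f : X ⟶ Y} {g : Y ⟶ Z} {h : Z ⟶ X⟦(1 : ℤ)⟧}
    (hT : Triangle.mk f g h ∈ distTriang 𝒟) (e : Z' ≅ Z) (g' : Y ⟶ Z') (hg : g' ≫ e.hom = g) :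
    Triangle.mk f g' (e.hom ≫ h) ∈ distTriang 𝒟 := by
  refine isomorphic_distinguished _ hT _
    (Triangle.isoMk _ _ (Iso.refl X) (Iso.refl Y) e ?_ ?_ ?_)
  · exact (Category.comp_id _).trans (Category.id_comp _).symm
  · exact hg.trans (Category.id_comp _).symm
  · refine Eq.trans ?_ (Category.comp_id (e.hom ≫ h))
    exact congrArg ((e.hom ≫ h) ≫ ·) (Functor.map_id _ _)

theorem distinguished_of_iso₁ {X Y Z X' : 𝒟} {f : X ⟶ Y} {g : Y ⟶ Z} {h : Z ⟶ X⟦(1 : ℤ)⟧}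
    (hT : Triangle.mk f g h ∈ distTriang 𝒟) (e : X' ≅ X) (f' : X' ⟶ Y) (hf : e.hom ≫ f = f') :
    Triangle.mk f' g (h ≫ e.inv⟦(1 : ℤ)⟧') ∈ distTriang 𝒟 := by
  refine isomorphic_distinguished _ hT _
    (Triangle.isoMk _ _ e (Iso.refl Y) (Iso.refl Z) ?_ ?_ ?_)
  · exact (Category.comp_id _).trans hf.symm
  · exact (Category.comp_id _).trans (Category.id_comp _).symm
  · refine Eq.trans (?_ : (h ≫ e.inv⟦(1 : ℤ)⟧') ≫ e.hom⟦(1 : ℤ)⟧' = h) (Category.id_comp h).symm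
    rw [Category.assoc, ← Functor.map_comp, Iso.inv_hom_id, Functor.map_id, Category.comp_id]

end CategoryTheory.Pretriangulated

/-! ### Recollements from adjoint triples -/

namespace NodalOrder

universe v₁ v₂ v₃ u₁ u₂ u₃

variable {𝒰 : Type u₁} [Category.{v₁} 𝒰] [HasZeroObject 𝒰] [HasShift 𝒰 ℤ]
    [Preadditive 𝒰] [∀ n : ℤ, (shiftFunctor 𝒰 n).Additive] [Pretriangulated 𝒰]
    {𝒟 : Type u₂} [Category.{v₂} 𝒟] [HasZeroObject 𝒟] [HasShift 𝒟 ℤ]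
    [Preadditive 𝒟] [∀ n : ℤ, (shiftFunctor 𝒟 n).Additive] [Pretriangulated 𝒟]
    {𝒱 : Type u₃} [Category.{v₃} 𝒱] [HasZeroObject 𝒱] [HasShift 𝒱 ℤ]
    [Preadditive 𝒱] [∀ n : ℤ, (shiftFunctor 𝒱 n).Additive] [Pretriangulated 𝒱]

/-- The objects killed by a functor. -/
def functorKernel (j : 𝒟 ⥤ 𝒱) : ObjectProperty 𝒟 := fun X => IsZero (j.obj X)

section

variable (j : 𝒟 ⥤ 𝒱) [j.CommShift ℤ] [j.IsTriangulated]

instance : (functorKernel j).IsTriangulated where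
  exists_zero := ⟨_, isZero_zero 𝒟, j.map_isZero (isZero_zero 𝒟)⟩
  isStableUnderShiftBy n :=
    { le_shift X hX := ((shiftFunctor 𝒱 n).map_isZero hX).of_iso ((j.commShiftIso n).app X) }
  ext₂' T hT h₁ h₃ := ObjectProperty.le_isoClosure _ _
    (Triangle.isZero₂_of_isZero₁₃ _ (j.map_distinguished T hT) h₁ h₃)

variable {j} {jL jR : 𝒱 ⥤ 𝒟}

theorem eq_zero_of_leftAdjoint (adj : jL ⊣ j) {V : 𝒱} {Z : 𝒟} (hZ : functorKernel j Z)
    (f : jL.obj V ⟶ Z) : f = 0 :=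
  (adj.homEquiv _ _).injective (hZ.eq_of_tgt _ _)

theorem eq_zero_of_rightAdjoint (adj : j ⊣ jR) {V : 𝒱} {Z : 𝒟} (hZ : functorKernel j Z)
    (f : Z ⟶ jR.obj V) : f = 0 :=
  (adj.homEquiv _ _).symm.injective (hZ.eq_of_src _ _)

/-- The gluing triangle on the counit of `jL ⊣ j`. -/
theorem exists_counit_triangle (adj : jL ⊣ j) [jL.Full] [jL.Faithful] (X : 𝒟) :
    ∃ (Z : 𝒟) (p : X ⟶ Z) (δ : Z ⟶ (jL.obj (j.obj X))⟦(1 : ℤ)⟧),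
      Triangle.mk (adj.counit.app X : jL.obj (j.obj X) ⟶ X) p δ ∈ distTriang 𝒟 ∧
      functorKernel j Z ∧
      ∀ W, functorKernel j W → Function.Bijective (fun g : Z ⟶ W => p ≫ g) := by
  obtain ⟨Z, p, δ, hT⟩ := distinguished_cocone_triangle (adj.counit.app X)
  refine ⟨Z, p, δ, hT, ?_, fun W hW => ?_⟩
  -- `j` inverts the counit because `jL` is fully faithful, so it kills the cone.
  · exact Triangle.isZero₃_of_isIso₁ _ (j.map_distinguished _ hT)
      (inferInstanceAs (IsIso (j.map (adj.counit.app X))))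
  · refine bijective_mor₂_comp hT (eq_zero_of_leftAdjoint adj hW) fun f => ?_
    -- No compatibility of `jL` with shifts is assumed, so the shift is moved to the target, where
    -- the kernel is stable.
    apply ((shiftEquiv 𝒟 (1 : ℤ)).toAdjunction.homEquiv _ _).injective
    exact (eq_zero_of_leftAdjoint adj ((functorKernel j).le_shift (-1) _ hW) _).trans
      (eq_zero_of_leftAdjoint adj ((functorKernel j).le_shift (-1) _ hW) _).symm

/-- The gluing triangle on the unit of `j ⊣ jR`. -/
theorem exists_unit_triangle (adj : j ⊣ jR) [jR.Full] [jR.Faithful] (X : 𝒟) :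
    ∃ (Z : 𝒟) (p : Z ⟶ X) (δ : jR.obj (j.obj X) ⟶ Z⟦(1 : ℤ)⟧),
      Triangle.mk p (adj.unit.app X : X ⟶ jR.obj (j.obj X)) δ ∈ distTriang 𝒟 ∧
      functorKernel j Z ∧
      ∀ W, functorKernel j W → Function.Bijective (fun g : W ⟶ Z => g ≫ p) := by
  obtain ⟨Z, p, δ, hT⟩ := distinguished_cocone_triangle₁ (adj.unit.app X)
  refine ⟨Z, p, δ, hT, ?_, fun W hW => ?_⟩
  · exact Triangle.isZero₁_of_isIso₂ _ (j.map_distinguished _ hT)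
      (inferInstanceAs (IsIso (j.map (adj.unit.app X))))
  · exact bijective_comp_mor₁ hT (eq_zero_of_rightAdjoint adj hW)
      (eq_zero_of_rightAdjoint adj ((functorKernel j).le_shift 1 _ hW))

/-- If `X` is orthogonal to the kernel, the universal map from `X` to the cone of the counit is
zero, hence so is the identity of the cone, and the counit is invertible. -/
theorem essImage_eq_leftOrthogonal (adj : jL ⊣ j) [jL.Full] [jL.Faithful] :
    jL.essImage = (functorKernel j).leftOrthogonal := by
  ext X
  constructor
  · rintro ⟨V, ⟨e⟩⟩ Z f hZ
    rw [← cancel_epi e.hom, comp_zero]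
    exact eq_zero_of_leftAdjoint adj hZ _
  · intro hX
    obtain ⟨Z, p, δ, hT, hZ, hp⟩ := exists_counit_triangle adj X
    have : IsZero Z := by
      rw [IsZero.iff_id_eq_zero]
      exact (hp Z hZ).1 ((hX _ hZ).trans (hX _ hZ).symm)
    have := (Triangle.isZero₃_iff_isIso₁ _ hT).1 this
    exact ⟨_, ⟨@asIso _ _ _ _ _ this⟩⟩

theorem essImage_eq_rightOrthogonal (adj : j ⊣ jR) [jR.Full] [jR.Faithful] :
    jR.essImage = (functorKernel j).rightOrthogonal := by
  ext X
  constructor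
  · rintro ⟨V, ⟨e⟩⟩ Z f hZ
    rw [← cancel_mono e.inv, zero_comp]
    exact eq_zero_of_rightAdjoint adj hZ _
  · intro hX
    obtain ⟨Z, p, δ, hT, hZ, hp⟩ := exists_unit_triangle adj X
    have : IsZero Z := by
      rw [IsZero.iff_id_eq_zero]
      exact (hp Z hZ).1 ((hX _ hZ).trans (hX _ hZ).symm)
    have := (Triangle.isZero₁_iff_isIso₂ _ hT).1 this
    exact ⟨_, ⟨(@asIso _ _ _ _ _ this).symm⟩⟩

/-- A localizing and colocalizing adjoint triple, together with an embedding whose essential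
image is the kernel of the middle functor, forms a recollement. -/
theorem exists_isRecollement (i : 𝒰 ⥤ 𝒟) [i.CommShift ℤ] [i.IsTriangulated] [i.Full] [i.Faithful]
    (hi : i.essImage = functorKernel j) (adj₃ : jL ⊣ j) (adj₄ : j ⊣ jR) [jL.Full] [jL.Faithful]
    [jR.Full] [jR.Faithful] : ∃ iL iR : 𝒟 ⥤ 𝒰, IsRecollement i iL iR j jL jR := by
  have hi' (U : 𝒰) : functorKernel j (i.obj U) := by
    rw [← hi]
    exact i.obj_mem_essImage U
  choose Z p δ hT hZ hp using exists_counit_triangle adj₃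
  choose Z' p' δ' hT' hZ' hp' using exists_unit_triangle adj₄
  have hU (X : 𝒟) : ∃ U, Nonempty (i.obj U ≅ Z X) := by
    have := hZ X
    rwa [← hi] at this
  have hU' (X : 𝒟) : ∃ U, Nonempty (i.obj U ≅ Z' X) := by
    have := hZ' X
    rwa [← hi] at this
  choose U e using hU
  choose U' e' using hU'
  -- The remaining vertices of the gluing triangles are universal among kernel objects; read through
  -- the embedding, they are universal arrows for both adjoints of `i`.
  obtain ⟨iL, adj₁, h₁⟩ := exists_leftAdjoint_of_universal i U
    (fun X => p X ≫ (e X).some.inv) (fun X W => by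
      simp only [Category.assoc]
      exact (hp X _ (hi' W)).comp (((e X).some.symm.homFromEquiv.symm.bijective).comp
        (Functor.FullyFaithful.ofFullyFaithful i).homEquiv.bijective))
  obtain ⟨iR, adj₂, h₂⟩ := exists_rightAdjoint_of_universal i U'
    (fun X => (e' X).some.hom ≫ p' X) (fun X W => by
      simp only [← Category.assoc]
      exact (hp' X _ (hi' W)).comp (((e' X).some.homToEquiv.bijective).comp
        (Functor.FullyFaithful.ofFullyFaithful i).homEquiv.bijective))
  refine ⟨iL, iR, ⟨⟨‹_›, ‹_›⟩, ⟨‹_›, ‹_›⟩, ⟨‹_›, ‹_›⟩, hi', adj₁, adj₂, adj₃, adj₄, fun X => ⟨?_, ?_⟩⟩⟩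
  · obtain ⟨ε, hε⟩ := h₁ X
    let E : i.obj (iL.obj X) ≅ Z X := i.mapIso ε ≪≫ (e X).some
    refine ⟨E.hom ≫ δ X, distinguished_of_iso₃ (hT X) E _ ?_⟩
    dsimp [E]
    rw [reassoc_of% hε, Iso.inv_hom_id, Category.comp_id]
  · obtain ⟨ε, hε⟩ := h₂ X
    let E : i.obj (iR.obj X) ≅ Z' X := i.mapIso ε ≪≫ (e' X).some
    refine ⟨δ' X ≫ E.inv⟦(1 : ℤ)⟧', distinguished_of_iso₁ (hT' X) E _ ?_⟩
    dsimp [E]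
    rw [Category.assoc, ← hε, ← Functor.map_comp_assoc]
    simp

end

end NodalOrder

/-! ### The tensor-hom adjunction and the adjoint triple of a corner ring -/

namespace NodalOrder

section Tensor

variable {T : Type u} [Ring T] {P : Type u} [AddCommGroup P] [Module Tᵐᵒᵖ P]
  {M : Type u} [AddCommGroup M] [Module T M] {N : Type*} [AddCommGroup N]

theorem BalancedTensor.add_tmul (p q : P) (m : M) :
    tmul T (p + q) m = tmul T p m + tmul T q m :=
  congrArg QuotientAddGroup.mk (TensorProduct.add_tmul p q m)

theorem BalancedTensor.tmul_add (p : P) (m n : M) :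
    tmul T p (m + n) = tmul T p m + tmul T p n :=
  congrArg QuotientAddGroup.mk (TensorProduct.tmul_add p m n)

theorem BalancedTensor.op_smul_tmul (t : T) (p : P) (m : M) :
    tmul T (MulOpposite.op t • p) m = tmul T p (t • m) := by
  refine (QuotientAddGroup.eq_iff_sub_mem).2 ?_
  exact AddSubgroup.subset_closure ⟨p, t, m, rfl⟩

theorem BalancedTensor.induction_on {motive : BalancedTensor T P M → Prop}
    (z : BalancedTensor T P M) (zero : motive 0) (tmul : ∀ p m, motive (tmul T p m))
    (add : ∀ x y, motive x → motive y → motive (x + y)) : motive z := by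
  obtain ⟨z, rfl⟩ := QuotientAddGroup.mk_surjective z
  induction z using TensorProduct.induction_on with
  | zero => exact zero
  | tmul p m => exact tmul p m
  | add x y hx hy => exact add _ _ hx hy

/-- The additive map out of `P ⊗_T M` induced by a balanced biadditive map. -/
def BalancedTensor.lift (f : P →+ M →+ N)
    (hf : ∀ (t : T) (p : P) (m : M), f (MulOpposite.op t • p) m = f p (t • m)) :
    BalancedTensor T P M →+ N :=
  QuotientAddGroup.lift _
    (TensorProduct.liftAddHom f (fun r p m => by rw [map_zsmul, map_zsmul]; rfl)) (by
      rw [tensorRel, AddSubgroup.closure_le]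
      rintro _ ⟨p, t, m, rfl⟩
      change TensorProduct.liftAddHom _ _ _ = 0
      rw [map_sub, TensorProduct.liftAddHom_tmul, TensorProduct.liftAddHom_tmul, hf, sub_self])

end Tensor

section Adjunction

variable (S T : Type u) [Ring S] [Ring T] (P : Type u) [AddCommGroup P] [Module S P]
  [Module Tᵐᵒᵖ P] [SMulCommClass S Tᵐᵒᵖ P]

/-- The evaluation `P ⊗_T Hom_S(P, M) ⟶ M`. -/
def tensorHomCounit (M : Type u) [AddCommGroup M] [Module S M] :
    BalancedTensor T P (BimoduleHom S P M) →ₗ[S] M :=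
  { BalancedTensor.lift
      (AddMonoidHom.mk' (fun p => AddMonoidHom.mk' (fun f : BimoduleHom S P M => f p)
        (fun _ _ => rfl)) (fun p q => AddMonoidHom.ext fun f =>
          map_add (show P →ₗ[S] M from f) p q))
      (fun _ _ _ => rfl) with
    map_smul' s z := by
      induction z using BalancedTensor.induction_on with
      | zero => exact (map_zero _).trans (smul_zero _).symm
      | tmul p f => exact map_smul (show P →ₗ[S] M from f) s p
      | add x y hx hy =>
        dsimp at hx hy ⊢
        rw [smul_add, map_add, hx, hy, map_add, smul_add] }

@[simp]
theorem tensorHomCounit_tmul (M : Type u) [AddCommGroup M] [Module S M] (p : P)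
    (f : BimoduleHom S P M) : tensorHomCounit S T P M (BalancedTensor.tmul T p f) = f p := rfl

/-- The coevaluation `M ⟶ Hom_S(P, P ⊗_T M)`. -/
def tensorHomUnit (M : Type u) [AddCommGroup M] [Module T M] :
    M →ₗ[T] BimoduleHom S P (BalancedTensor T P M) where
  toFun m := LinearMap.mk ⟨fun p => BalancedTensor.tmul T p m,
    fun p q => BalancedTensor.add_tmul p q m⟩ (fun _ _ => rfl)
  map_add' m n := BimoduleHom.ext fun p => BalancedTensor.tmul_add p m n
  map_smul' t m := BimoduleHom.ext fun p => (BalancedTensor.op_smul_tmul t p m).symm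

/-- The tensor-hom adjunction for a bimodule. -/
def tensorHomAdjunction : tensorFunctor S T P ⊣ homFunctor S T P where
  unit := { app M := ModuleCat.ofHom (tensorHomUnit S T P M) }
  counit :=
    { app M := ModuleCat.ofHom (tensorHomCounit S T P M)
      naturality M N f := by
        ext1
        exact BalancedTensor.hom_ext fun p g => rfl }
  left_triangle_components M := by
    ext1
    exact BalancedTensor.hom_ext fun p m => rfl
  right_triangle_components M := rfl

end Adjunction

section Corner

variable {B T : Type u} [Ring B] [Ring T] (φ : T →ₙ+* B)

theorem map_one_mul_map_one : φ 1 * φ 1 = φ 1 := by rw [← map_mul, mul_one]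

/-- The generator of the left ideal `B e`. -/
def Column.gen : Column φ := ⟨φ 1, map_one_mul_map_one φ⟩

/-- The generator of the right ideal `e B`. -/
def Row.gen : Row φ := ⟨φ 1, map_one_mul_map_one φ⟩

theorem Column.smul_gen (p : Column φ) : p.1 • gen φ = p := Subtype.ext p.2

section

variable {M : Type u} [AddCommGroup M] [Module B M]

theorem BimoduleHom.column_apply (f : BimoduleHom B (Column φ) M) (p : Column φ) :
    f p = p.1 • f (Column.gen φ) := by
  conv_lhs => rw [← Column.smul_gen φ p]
  exact map_smul (show Column φ →ₗ[B] M from f) _ _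

theorem BimoduleHom.map_one_smul_gen (f : BimoduleHom B (Column φ) M) :
    φ 1 • f (Column.gen φ) = f (Column.gen φ) :=
  (BimoduleHom.column_apply φ f (Column.gen φ)).symm

variable (M) in
/-- The homomorphism `e B ⊗_B M ⟶ Hom_B(B e, M)`. -/
def rowTensorHom : BalancedTensor B (Row φ) M →ₗ[T] BimoduleHom B (Column φ) M :=
  { BalancedTensor.lift (N := BimoduleHom B (Column φ) M)
      (AddMonoidHom.mk' (fun x => AddMonoidHom.mk'
          (fun m => (LinearMap.toSpanSingleton B M (x.1 • m)).comp (Column φ).subtype)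
          (fun m n => BimoduleHom.ext fun p => by
            change p.1 • x.1 • (m + n) = p.1 • x.1 • m + p.1 • x.1 • n
            rw [smul_add, smul_add]))
        (fun x y => AddMonoidHom.ext fun m => BimoduleHom.ext fun p => by
          change p.1 • (x.1 + y.1) • m = p.1 • x.1 • m + p.1 • y.1 • m
          rw [add_smul, smul_add]))
      (fun b x m => BimoduleHom.ext fun p => by
        change p.1 • (x.1 * b) • m = p.1 • x.1 • b • m
        rw [mul_smul]) with
    map_smul' t z := by
      induction z using BalancedTensor.induction_on with
      | zero => exact (map_zero _).trans (smul_zero _).symm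
      | tmul x m =>
        refine BimoduleHom.ext fun p => ?_
        change p.1 • (φ t * x.1) • m = (p.1 * φ t) • x.1 • m
        simp only [mul_smul]
      | add x y hx hy =>
        dsimp at hx hy ⊢
        rw [smul_add, map_add, hx, hy, map_add, smul_add] }

theorem rowTensorHom_tmul (x : Row φ) (m : M) (p : Column φ) :
    rowTensorHom φ M (BalancedTensor.tmul B x m) p = p.1 • x.1 • m := rfl

/-- Both sides are `e M`: the inverse sends a homomorphism to `e` tensored with its value at `e`. -/
theorem rowTensorHom_bijective : Function.Bijective (rowTensorHom φ M) := by
  refine Function.bijective_iff_has_inverse.2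
    ⟨fun f => BalancedTensor.tmul B (Row.gen φ) (f (Column.gen φ)), fun z => ?_, fun f => ?_⟩
  · dsimp only
    induction z using BalancedTensor.induction_on with
    | zero =>
      rw [map_zero]
      exact congrArg QuotientAddGroup.mk (TensorProduct.tmul_zero _ _)
    | tmul x m =>
      rw [rowTensorHom_tmul, ← BalancedTensor.op_smul_tmul, ← BalancedTensor.op_smul_tmul]
      congr 1
      refine Subtype.ext ?_
      change φ 1 * φ 1 * x.1 = x.1
      rw [map_one_mul_map_one]
      exact x.2
    | add x y hx hy =>
      rw [map_add]
      exact (BalancedTensor.tmul_add _ _ _).trans (congrArg₂ _ hx hy)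
  · refine BimoduleHom.ext fun p => ?_
    rw [rowTensorHom_tmul, BimoduleHom.column_apply φ f p]
    exact congrArg (p.1 • ·) (BimoduleHom.map_one_smul_gen φ f)

end

/-- The functors `e B ⊗_B -` and `Hom_B(B e, -)` are isomorphic. -/
noncomputable def rowTensorIso : tensorFunctor T B (Row φ) ≅ functorG φ :=
  NatIso.ofComponents
    (fun M => (LinearEquiv.ofBijective (rowTensorHom φ M) (rowTensorHom_bijective φ)).toModuleIso)
    (fun {M N} f => by
      ext1
      refine BalancedTensor.hom_ext fun x m => BimoduleHom.ext fun p => ?_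
      change p.1 • x.1 • f.hom m = f.hom (p.1 • x.1 • m)
      rw [map_smul, map_smul])

/-- The adjunction between `B e ⊗_T -` and `Hom_B(B e, -)`. -/
def adjunctionFG : functorF φ ⊣ functorG φ := tensorHomAdjunction B T (Column φ)

/-- The adjunction between `Hom_B(B e, -)` and `Hom_T(e B, -)`. -/
noncomputable def adjunctionGH : functorG φ ⊣ functorH φ :=
  (tensorHomAdjunction T B (Row φ)).ofNatIsoLeft (rowTensorIso φ)

/-- Evaluation at `e` identifies `Hom_B(B e, M)` with `e M`. -/
theorem isZero_functorG_obj_iff (M : ModuleCat.{u} B) :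
    IsZero ((functorG φ).obj M) ↔ ∀ m : M, φ 1 • m = 0 := by
  rw [ModuleCat.isZero_iff_subsingleton]
  constructor
  · intro h m
    have := DFunLike.congr_fun (F := BimoduleHom B (Column φ) M) (h.elim (rowTensorHom φ M (BalancedTensor.tmul B (Row.gen φ) m))
      (0 : BimoduleHom B (Column φ) M)) (Column.gen φ)
    have h2 : φ 1 • φ 1 • m = 0 := this
    rwa [← mul_smul, map_one_mul_map_one] at h2
  · intro h
    refine ⟨fun f g => BimoduleHom.ext fun p => ?_⟩
    have (f : BimoduleHom B (Column φ) M) : f p = 0 := by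
      rw [BimoduleHom.column_apply, ← BimoduleHom.map_one_smul_gen, h, smul_zero]
    exact (this f).trans (this g).symm

variable {φ} in
/-- The unit of the adjunction between `B e ⊗_T -` and `Hom_B(B e, -)` is invertible if `T` is
the corner ring `e B e`. -/
theorem isIso_adjunctionFG_unit (hφ : Function.Injective φ)
    (hφ' : ∀ b, ∃ t, φ t = φ 1 * b * φ 1) : IsIso (adjunctionFG φ).unit := by
  -- `r` is the retraction `x ↦ e x` of `B e` onto `e B e`, read in `T`. Tensored with `M` it gives
  -- `ρ`, and evaluation at the generator followed by `ρ` inverts the unit.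
  have hex (x : Column φ) : ∃ t, φ t = φ 1 * x.1 := by
    obtain ⟨t, ht⟩ := hφ' x.1
    exact ⟨t, by rw [ht, mul_assoc, show x.1 * φ 1 = x.1 from x.2]⟩
  choose r hr using hex
  have hr_add (x y : Column φ) : r (x + y) = r x + r y := hφ (by
    rw [map_add, hr, hr, hr, ← mul_add]; rfl)
  have hr_smul (t : T) (x : Column φ) : r (MulOpposite.op t • x) = r x * t := hφ (by
    rw [map_mul, hr, hr, mul_assoc]; rfl)
  have hr_gen : r (Column.gen φ) = 1 := hφ (by
    rw [hr]; exact map_one_mul_map_one φ)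
  have (M : ModuleCat.{u} T) : IsIso ((adjunctionFG φ).unit.app M) := by
    let ρ : BalancedTensor T (Column φ) M →+ M := BalancedTensor.lift
      (AddMonoidHom.mk' (fun x => AddMonoidHom.mk' (fun m => r x • m) (smul_add _))
        (fun x y => AddMonoidHom.ext fun m => by
          change r (x + y) • m = r x • m + r y • m
          rw [hr_add, add_smul]))
      (fun t x m => by
        change r _ • m = r x • t • m
        rw [hr_smul, mul_smul])
    have hρ (z) : φ 1 • z = BalancedTensor.tmul T (Column.gen φ) (ρ z) := by
      induction z using BalancedTensor.induction_on with
      | zero =>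
        rw [map_zero, smul_zero]
        exact (congrArg QuotientAddGroup.mk (TensorProduct.tmul_zero _ _)).symm
      | tmul x m =>
        rw [show ρ (BalancedTensor.tmul T x m) = r x • m from rfl, ← BalancedTensor.op_smul_tmul,
          BalancedTensor.smul_tmul]
        congr 1
        refine Subtype.ext ?_
        change φ 1 * x.1 = φ 1 * φ (r x)
        rw [hr, ← mul_assoc, map_one_mul_map_one]
      | add x y hx hy => rw [smul_add, hx, hy, map_add, BalancedTensor.tmul_add]
    refine (ConcreteCategory.isIso_iff_bijective _).2 ⟨fun m n hmn => ?_, fun f => ?_⟩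
    · have h1 : BalancedTensor.tmul T (Column.gen φ) m = BalancedTensor.tmul T (Column.gen φ) n :=
        DFunLike.congr_fun (F := BimoduleHom B (Column φ) (BalancedTensor T (Column φ) M)) hmn
          (Column.gen φ)
      have h2 : r (Column.gen φ) • m = r (Column.gen φ) • n := congrArg ρ h1
      rwa [hr_gen, one_smul, one_smul] at h2
    · change BimoduleHom B (Column φ) (BalancedTensor T (Column φ) M) at f
      refine ⟨ρ (f (Column.gen φ)), BimoduleHom.ext fun p => ?_⟩
      change BalancedTensor.tmul T p (ρ (f (Column.gen φ))) = f p
      have h1 := hρ (f (Column.gen φ))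
      rw [BimoduleHom.map_one_smul_gen] at h1
      rw [BimoduleHom.column_apply φ f p]
      conv_rhs => rw [h1, BalancedTensor.smul_tmul, Column.smul_gen]
  exact NatIso.isIso_of_isIso_app _

end Corner

end NodalOrder

/-! ### Restriction along a surjection, and modules over a semisimple quotient -/

namespace NodalOrder

theorem exists_mkQ_comp_eq {R : Type u} [Ring R] {M : ModuleCat.{u} R} (N : Submodule R M)
    {Z : ModuleCat.{u} R} (f : M ⟶ Z) (hf : N ≤ LinearMap.ker f.hom) :
    ∃ g : ModuleCat.of R (M ⧸ N) ⟶ Z, ModuleCat.ofHom N.mkQ ≫ g = f := by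
  refine ⟨ModuleCat.ofHom (N.liftQ f.hom hf), ?_⟩
  ext1
  exact N.liftQ_mkQ _ _

section Inflation

variable {R S : Type u} [Ring R] [Ring S] {π : R →+* S} (hπ : Function.Surjective π)

include hπ in
theorem exists_inflation_iso (M : ModuleCat.{u} R) (hM : ∀ r, π r = 0 → ∀ m : M, r • m = 0) :
    ∃ N : ModuleCat.{u} S, Nonempty ((inflation π).obj N ≅ M) := by
  choose σ hσ using hπ
  let _ : SMul S M := ⟨fun s m => σ s • m⟩
  have hs : ∀ (r : R) (m : M), π r • m = r • m := fun r m => by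
    change σ (π r) • m = r • m
    rw [← sub_eq_zero, ← sub_smul]
    exact hM _ (by rw [map_sub, hσ, sub_self]) m
  let _ : Module S M := Function.Surjective.moduleLeft π (fun s => ⟨σ s, hσ s⟩) hs
  let X : ModuleCat.{u} R := (inflation π).obj (ModuleCat.of S M)
  let e : X ≃ₗ[R] M := { AddEquiv.refl M with map_smul' := fun r m => hs r m }
  exact ⟨ModuleCat.of S M, ⟨e.toModuleIso⟩⟩

include hπ in
theorem inflation_full : (inflation π).Full where
  map_surjective {M N} f := by
    let g : (inflation π).obj M →ₗ[R] (inflation π).obj N := f.hom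
    refine ⟨ModuleCat.ofHom ⟨⟨fun m => g m, fun x y => map_add g x y⟩, fun s m => ?_⟩, rfl⟩
    obtain ⟨r, rfl⟩ := hπ s
    have h := g.map_smul r m
    exact h

include hπ in
/-- The left adjoint of restriction along a surjective ring homomorphism `π` takes the quotient by
`(ker π) M`. -/
theorem exists_inflation_leftAdjoint :
    ∃ (F : ModuleCat.{u} R ⥤ ModuleCat.{u} S) (adj : F ⊣ inflation π), F.Additive ∧
      ∀ M : ModuleCat.{u} R, Function.Surjective (adj.unit.app M) ∧
        ∀ m : M, adj.unit.app M m = 0 ↔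
          m ∈ Submodule.span R {x : M | ∃ r, π r = 0 ∧ ∃ y : M, x = r • y} := by
  let N (M : ModuleCat.{u} R) : Submodule R M :=
    Submodule.span R {x : M | ∃ r, π r = 0 ∧ ∃ y : M, x = r • y}
  have hN (M : ModuleCat.{u} R) : ∃ Y : ModuleCat.{u} S,
      Nonempty ((inflation π).obj Y ≅ ModuleCat.of R (M ⧸ N M)) := by
    refine exists_inflation_iso hπ _ fun r hr m => ?_
    obtain ⟨m, rfl⟩ := Submodule.mkQ_surjective _ m
    rw [← map_smul]
    exact (Submodule.Quotient.mk_eq_zero _).2 (Submodule.subset_span ⟨r, hr, m, rfl⟩)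
  choose Y e using hN
  let η (M : ModuleCat.{u} R) : M ⟶ (inflation π).obj (Y M) :=
    ModuleCat.ofHom (N M).mkQ ≫ (e M).some.inv
  have := inflation_full hπ
  obtain ⟨F, adj, h⟩ := exists_leftAdjoint_of_universal (inflation π) Y η (fun M Z => by
    have h1 := (Functor.FullyFaithful.ofFullyFaithful (inflation π)).homEquiv
      (X := Y M) (Y := Z) |>.bijective
    have h2 := ((e M).some.symm.homFromEquiv (Z := (inflation π).obj Z)).symm.bijective
    have h3 : Function.Bijective (fun f : ModuleCat.of R (M ⧸ N M) ⟶ (inflation π).obj Z =>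
        ModuleCat.ofHom (N M).mkQ ≫ f) := by
      constructor
      · intro f g hfg
        ext1
        exact Submodule.linearMap_qext _ (congrArg ModuleCat.Hom.hom hfg)
      · intro f
        let Z' : ModuleCat.{u} R := (inflation π).obj Z
        let g : M →ₗ[R] Z' := f.hom
        have hg : N M ≤ LinearMap.ker g := by
          rw [Submodule.span_le]
          rintro _ ⟨r, hr, y, rfl⟩
          change g (r • y) = 0
          rw [map_smul]
          refine (?_ : π r • (show Z from g y) = 0)
          rw [hr, zero_smul]
        exact exists_mkQ_comp_eq (N M) f hg
    simp only [η, Category.assoc]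
    exact h3.comp (h2.comp h1))
  refine ⟨F, adj, adj.left_adjoint_additive, fun M => ?_⟩
  obtain ⟨ε, hε⟩ := h M
  have h1 : Function.Bijective (((inflation π).map ε.hom ≫ (e M).some.hom)) :=
    (ConcreteCategory.isIso_iff_bijective _).1 inferInstance
  have h2 (m : M) : ((inflation π).map ε.hom ≫ (e M).some.hom) (adj.unit.app M m) =
      (N M).mkQ m := by
    have h3 : adj.unit.app M ≫ ((inflation π).map ε.hom ≫ (e M).some.hom) =
        ModuleCat.ofHom (N M).mkQ := by
      rw [reassoc_of% hε]
      simp [η]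
    exact ConcreteCategory.congr_hom h3 m
  constructor
  · intro y
    obtain ⟨m, hm⟩ := (N M).mkQ_surjective (((inflation π).map ε.hom ≫ (e M).some.hom) y)
    exact ⟨m, h1.1 ((h2 m).trans hm)⟩
  · intro m
    rw [← Submodule.Quotient.mk_eq_zero (N M), ← Submodule.mkQ_apply, ← h2]
    refine ⟨fun h => by rw [h, map_zero], fun h => h1.1 (h.trans (map_zero _).symm)⟩

end Inflation

section Semisimple

variable {S : Type u} [Ring S] [IsSemisimpleRing S]

theorem exists_retract_finsupp (M : Type u) [AddCommGroup M] [Module S M] :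
    ∃ (s : M →ₗ[S] (M →₀ S)) (r : (M →₀ S) →ₗ[S] M), r ∘ₗ s = LinearMap.id := by
  have := Module.projective_of_isSemisimpleRing S M
  obtain ⟨s, hs⟩ := Module.projective_def'.1 this
  exact ⟨s, _, hs⟩

/-- Every module is a retract of a free one, whose coordinates detect elements. -/
theorem exists_linearMap_apply_ne_zero {M : Type u} [AddCommGroup M] [Module S M] {m : M}
    (hm : m ≠ 0) : ∃ f : M →ₗ[S] S, f m ≠ 0 := by
  obtain ⟨s, r, h⟩ := exists_retract_finsupp (S := S) M
  have : s m ≠ 0 := fun h0 => hm (by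
    have := DFunLike.congr_fun h m
    rw [LinearMap.comp_apply, h0, map_zero] at this
    exact this.symm)
  obtain ⟨i, hi⟩ := Finsupp.ne_iff.1 this
  exact ⟨(Finsupp.lapply i).comp s, hi⟩

variable {R : Type u} [Ring R] {π : R →+* S} (hπ : Function.Surjective π)
  {E : ModuleCat.{u} R} (e : (inflation π).obj (ModuleCat.of S S) ≅ E)
  (M : ModuleCat.{u} R) (hM : ∀ r, π r = 0 → ∀ m : M, r • m = 0)

include hπ e hM in
-- Such an `M` is an inflated `S`-module; that module is a retract of a free one by semisimplicity,
-- and the retraction survives inflation.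
theorem addClosure_of_forall_smul_eq_zero : AddClosure R E M := by
  obtain ⟨N, ⟨ε⟩⟩ := exists_inflation_iso hπ M hM
  obtain ⟨s, r, h⟩ := exists_retract_finsupp (S := S) N
  let S' := (inflation π).obj (ModuleCat.of S S)
  let s' : (inflation π).obj N →ₗ[R] (N →₀ S') :=
    { toFun := s, map_add' := map_add s, map_smul' := fun b m => map_smul s (π b) m }
  let r' : (N →₀ S') →ₗ[R] (inflation π).obj N :=
    { toFun := r, map_add' := map_add r, map_smul' := fun b m => map_smul r (π b) m }
  have h' : r' ∘ₗ s' = LinearMap.id := LinearMap.ext fun m => DFunLike.congr_fun h m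
  refine ⟨N, (Finsupp.mapRange.linearMap e.hom.hom) ∘ₗ s' ∘ₗ ε.inv.hom,
    ε.hom.hom ∘ₗ r' ∘ₗ (Finsupp.mapRange.linearMap e.inv.hom), LinearMap.ext fun m => ?_⟩
  simp only [LinearMap.comp_apply]
  have h1 (x : N →₀ S') : (Finsupp.mapRange.linearMap e.inv.hom) ((Finsupp.mapRange.linearMap e.hom.hom) x)
      = x := by
    rw [← LinearMap.comp_apply, ← Finsupp.mapRange.linearMap_comp, ← ModuleCat.hom_comp,
      Iso.hom_inv_id]
    exact DFunLike.congr_fun Finsupp.mapRange.linearMap_id x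
  rw [h1, ← LinearMap.comp_apply r' s', h']
  exact ConcreteCategory.congr_hom ε.inv_hom_id m

include hπ e hM in
theorem exists_hom_from_ne_zero (h0 : ¬ IsZero M) : ∃ f : M ⟶ E, f ≠ 0 := by
  obtain ⟨N, ⟨ε⟩⟩ := exists_inflation_iso hπ M hM
  have : Nontrivial N := by
    by_contra h
    rw [not_nontrivial_iff_subsingleton] at h
    exact h0 (((inflation π).map_isZero (ModuleCat.isZero_iff_subsingleton.2 h)).of_iso ε.symm)
  obtain ⟨n, hn⟩ := exists_ne (0 : N)
  obtain ⟨f, hf⟩ := exists_linearMap_apply_ne_zero (S := S) hn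
  refine ⟨ε.inv ≫ (inflation π).map (ModuleCat.ofHom f) ≫ e.hom, fun h => hf ?_⟩
  have h1 : (inflation π).map (ModuleCat.ofHom f) = 0 := by
    rw [← cancel_epi ε.inv, ← cancel_mono e.hom, Category.assoc, h]
    simp
  exact ConcreteCategory.congr_hom h1 n

omit [IsSemisimpleRing S] in
include hπ e hM in
theorem exists_hom_to_ne_zero (h0 : ¬ IsZero M) : ∃ f : E ⟶ M, f ≠ 0 := by
  obtain ⟨N, ⟨ε⟩⟩ := exists_inflation_iso hπ M hM
  have : Nontrivial N := by
    by_contra h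
    rw [not_nontrivial_iff_subsingleton] at h
    exact h0 (((inflation π).map_isZero (ModuleCat.isZero_iff_subsingleton.2 h)).of_iso ε.symm)
  obtain ⟨n, hn⟩ := exists_ne (0 : N)
  refine ⟨e.inv ≫ (inflation π).map (ModuleCat.ofHom (LinearMap.toSpanSingleton S N n)) ≫ ε.hom,
    fun h => hn ?_⟩
  have h1 : (inflation π).map (ModuleCat.ofHom (LinearMap.toSpanSingleton S N n)) = 0 := by
    rw [← cancel_epi e.inv, ← cancel_mono ε.hom, Category.assoc, h]
    simp
  have h2 : (1 : S) • n = 0 := ConcreteCategory.congr_hom h1 (1 : S)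
  rwa [one_smul] at h2

end Semisimple

theorem AddClosure.smul_eq_zero {B : Type u} [Ring B] {E : Type u} [AddCommGroup E] [Module B E]
    {M : ModuleCat.{u} B} (hM : AddClosure B E M) {b : B} (hb : ∀ x : E, b • x = 0) (m : M) :
    b • m = 0 := by
  obtain ⟨ι, s, r, h⟩ := hM
  rw [← LinearMap.id_apply (R := B) m, ← h, LinearMap.comp_apply, ← map_smul]
  have : b • s m = 0 := Finsupp.ext fun i => hb _
  rw [this, map_zero]

end NodalOrder

/-! ### Matrix calculus in the Auslander order and its two semisimple quotients -/

namespace NodalOrder.IsNodalOrder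

variable {Λ : Type u} [Ring Λ] {A H : Subring Λ} (h : IsNodalOrder A H)

section Matrices

/-- The element of the Auslander order with given entries. -/
def mat (a : A) (x : H) (c : conductor A H) (y : H) : h.auslanderOrder :=
  ⟨!![(a : Λ), x; c, y], a.2, x.2, c.2, y.2⟩

theorem exists_eq_mat (b : h.auslanderOrder) : ∃ a x c y, b = h.mat a x c y :=
  ⟨⟨_, b.2.1⟩, ⟨_, b.2.2.1⟩, ⟨_, b.2.2.2.1⟩, ⟨_, b.2.2.2.2⟩,
    Subtype.ext (by ext i j; fin_cases i <;> fin_cases j <;> rfl)⟩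

theorem mat_add (a a' : A) (x x' : H) (c c' : conductor A H) (y y' : H) :
    h.mat a x c y + h.mat a' x' c' y' = h.mat (a + a') (x + x') (c + c') (y + y') :=
  Subtype.ext (by ext i j; fin_cases i <;> fin_cases j <;> rfl)

theorem embA_eq_mat (a : A) : h.embA a = h.mat a 0 0 0 := rfl

theorem embH_eq_mat (y : H) : h.embH y = h.mat 0 0 0 y := rfl

/-- The matrix unit `(0, 1; 0, 0)`. -/
def matE : h.auslanderOrder := h.mat 0 1 0 0

theorem mat_mul_matE (a : A) (x : H) (c : conductor A H) (y : H) :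
    h.mat a x c y * h.matE = h.mat 0 ⟨a, h.le a.2⟩ 0 ⟨c, h.le c.2.1⟩ := by
  refine Subtype.ext ?_
  ext i j
  fin_cases i <;> fin_cases j <;> simp [mat, matE, Matrix.mul_apply]

theorem matE_mul_mat (a : A) (x : H) (c : conductor A H) (y : H) :
    h.matE * h.mat a x c y = h.mat ⟨c, c.2.1⟩ y 0 0 := by
  refine Subtype.ext ?_
  ext i j
  fin_cases i <;> fin_cases j <;> simp [mat, matE, Matrix.mul_apply]

theorem embA_injective : Function.Injective h.embA := fun _ _ haa =>
  Subtype.ext (congrFun (congrFun (congrArg Subtype.val haa) 0) 0)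

theorem embH_injective : Function.Injective h.embH := fun _ _ haa =>
  Subtype.ext (congrFun (congrFun (congrArg Subtype.val haa) 1) 1)

theorem embA_one_mul_mat (a : A) (x : H) (c : conductor A H) (y : H) :
    h.embA 1 * h.mat a x c y = h.mat a x 0 0 := by
  refine Subtype.ext ?_
  ext i j
  fin_cases i <;> fin_cases j <;> simp [mat, embA_eq_mat, Matrix.mul_apply]

theorem embH_one_mul_mat (a : A) (x : H) (c : conductor A H) (y : H) :
    h.embH 1 * h.mat a x c y = h.mat 0 0 c y := by
  refine Subtype.ext ?_
  ext i j
  fin_cases i <;> fin_cases j <;> simp [mat, embH_eq_mat, Matrix.mul_apply]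

theorem mat_mul_embA_one (a : A) (x : H) (c : conductor A H) (y : H) :
    h.mat a x c y * h.embA 1 = h.mat a 0 c 0 := by
  refine Subtype.ext ?_
  ext i j
  fin_cases i <;> fin_cases j <;> simp [mat, embA_eq_mat, Matrix.mul_apply]

theorem mat_mul_embH_one (a : A) (x : H) (c : conductor A H) (y : H) :
    h.mat a x c y * h.embH 1 = h.mat 0 x 0 y := by
  refine Subtype.ext ?_
  ext i j
  fin_cases i <;> fin_cases j <;> simp [mat, embH_eq_mat, Matrix.mul_apply]

theorem embA_corner (b : h.auslanderOrder) : ∃ t, h.embA t = h.embA 1 * b * h.embA 1 := by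
  obtain ⟨a, x, c, y, rfl⟩ := h.exists_eq_mat b
  exact ⟨a, by rw [embA_one_mul_mat, mat_mul_embA_one, embA_eq_mat]⟩

theorem embH_corner (b : h.auslanderOrder) : ∃ t, h.embH t = h.embH 1 * b * h.embH 1 := by
  obtain ⟨a, x, c, y, rfl⟩ := h.exists_eq_mat b
  exact ⟨y, by rw [embH_one_mul_mat, mat_mul_embH_one, embH_eq_mat]⟩

instance : IsIso (adjunctionFG h.embA).unit :=
  isIso_adjunctionFG_unit h.embA_injective h.embA_corner

instance : IsIso (adjunctionFG h.embH).unit :=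
  isIso_adjunctionFG_unit h.embH_injective h.embH_corner

end Matrices

section Quotients

/-- The conductor as an ideal of `H`. -/
def coverIdeal : Ideal H where
  carrier := {x | (x : Λ) ∈ conductor A H}
  add_mem' ha hb := (conductor A H).add_mem ha hb
  zero_mem' := (conductor A H).zero_mem
  smul_mem' x _ hc := h.cover_mul_mem_conductor x.2 hc

instance : h.coverIdeal.IsTwoSided :=
  ⟨fun {_} b ha => mul_mem_conductor_right ha b.2⟩

/-- The ring `H / C`. -/
abbrev CoverQuotient : Type u := H ⧸ h.coverIdeal

/-- The surjection `B → H / C` sending `(a, x; c, y)` to the class of `y`. -/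
def toCoverQuotient : h.auslanderOrder →+* h.CoverQuotient where
  toFun b := Ideal.Quotient.mk h.coverIdeal ⟨b.1 1 1, b.2.2.2.2⟩
  map_one' := rfl
  map_zero' := rfl
  map_add' _ _ := rfl
  map_mul' b b' := by
    rw [← map_mul, Ideal.Quotient.eq]
    have : (b.1 * b'.1) 1 1 - b.1 1 1 * b'.1 1 1 ∈ conductor A H := by
      rw [Matrix.mul_apply, Fin.sum_univ_two, add_sub_cancel_right]
      exact mul_mem_conductor_right b.2.2.2.1 b'.2.2.1
    exact this

theorem toQuotientRing_surjective : Function.Surjective h.toQuotientRing := fun a => by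
  obtain ⟨a, rfl⟩ := Ideal.Quotient.mk_surjective a
  exact ⟨h.embA a, rfl⟩

theorem toCoverQuotient_surjective : Function.Surjective h.toCoverQuotient := fun a => by
  obtain ⟨a, rfl⟩ := Ideal.Quotient.mk_surjective a
  exact ⟨h.embH a, rfl⟩

theorem toQuotientRing_mat_eq_zero_iff (a : A) (x : H) (c : conductor A H) (y : H) :
    h.toQuotientRing (h.mat a x c y) = 0 ↔ (a : Λ) ∈ conductor A H :=
  Ideal.Quotient.eq_zero_iff_mem

theorem toCoverQuotient_mat_eq_zero_iff (a : A) (x : H) (c : conductor A H) (y : H) :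
    h.toCoverQuotient (h.mat a x c y) = 0 ↔ (y : Λ) ∈ conductor A H :=
  Ideal.Quotient.eq_zero_iff_mem

theorem toQuotientRing_embH (y : H) : h.toQuotientRing (h.embH y) = 0 :=
  (h.toQuotientRing_mat_eq_zero_iff 0 0 0 y).2 (conductor A H).zero_mem

theorem toCoverQuotient_embA (a : A) : h.toCoverQuotient (h.embA a) = 0 :=
  (h.toCoverQuotient_mat_eq_zero_iff a 0 0 0).2 (conductor A H).zero_mem

variable {M : Type u} [AddCommGroup M] [Module h.auslanderOrder M]

/-- The kernel of `B → A / C` is `B f B`: in the decomposition below every summand has a factor `f`,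
the entry `a ∈ C` being carried up from the second row by `matE`. -/
theorem smul_eq_zero_of_toQuotientRing (hM : ∀ m : M, h.embH 1 • m = 0) (b : h.auslanderOrder)
    (hb : h.toQuotientRing b = 0) (m : M) : b • m = 0 := by
  obtain ⟨a, x, c, y, rfl⟩ := h.exists_eq_mat b
  rw [toQuotientRing_mat_eq_zero_iff] at hb
  have : h.mat a x c y = h.matE * (h.embH 1 * h.mat 0 0 ⟨a, hb⟩ 0) +
      h.mat a x c y * h.embH 1 + h.embH 1 * h.mat 0 0 c 0 := by
    rw [embH_one_mul_mat, matE_mul_mat, mat_mul_embH_one, embH_one_mul_mat, mat_add, mat_add]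
    simp
  rw [this, add_smul, add_smul, mul_smul, mul_smul, mul_smul, mul_smul, hM, hM, hM, smul_zero,
    smul_zero, add_zero, add_zero]

/-- The kernel of `B → H / C` is `B e B`: the entry `y ∈ C` is the product of a lower left entry
with `e matE`. -/
theorem smul_eq_zero_of_toCoverQuotient (hM : ∀ m : M, h.embA 1 • m = 0) (b : h.auslanderOrder)
    (hb : h.toCoverQuotient b = 0) (m : M) : b • m = 0 := by
  obtain ⟨a, x, c, y, rfl⟩ := h.exists_eq_mat b
  rw [toCoverQuotient_mat_eq_zero_iff] at hb
  have : h.mat a x c y = h.mat 0 0 ⟨y, hb⟩ 0 * (h.embA 1 * h.matE) +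
      h.mat a x c y * h.embA 1 + h.embA 1 * h.mat 0 x 0 0 := by
    rw [matE, embA_one_mul_mat, embA_one_mul_mat, ← matE, mat_mul_matE, mat_mul_embA_one, mat_add,
      mat_add]
    simp only [add_zero, zero_add]
    exact Subtype.ext (by ext i j; fin_cases i <;> fin_cases j <;> simp [mat])
  rw [this, add_smul, add_smul, mul_smul, mul_smul, mul_smul, mul_smul, hM, hM, hM, smul_zero,
    smul_zero, add_zero, add_zero]

end Quotients

section Simple

/-- A quotient of a left ideal, as the inflation of a quotient ring. -/
theorem exists_inflation_iso_quotient {R S : Type u} [Ring R] [Ring S] (π : R →+* S)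
    (I : Submodule R R) (N : Submodule R I) (hI : ∀ s, ∃ r ∈ I, π r = s)
    (hN : ∀ x : I, x ∈ N ↔ π x.1 = 0) :
    Nonempty ((inflation π).obj (ModuleCat.of S S) ≅ ModuleCat.of R (I ⧸ N)) := by
  let S' : ModuleCat.{u} R := (inflation π).obj (ModuleCat.of S S)
  let f : I →ₗ[R] S' :=
    { toFun := fun x => π x.1
      map_add' := fun x y => map_add π x.1 y.1
      map_smul' := fun r x => map_mul π r x.1 }
  have hf : Function.Surjective f := fun s => by
    obtain ⟨r, hr, h⟩ := hI s
    exact ⟨⟨r, hr⟩, h⟩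
  have hN' : N = LinearMap.ker f := Submodule.ext hN
  exact ⟨((Submodule.quotEquivOfEq _ _ hN').trans
    (f.quotKerEquivOfSurjective hf)).symm.toModuleIso⟩

theorem nonempty_inflation_iso_S : Nonempty ((inflation h.toQuotientRing).obj
    (ModuleCat.of h.QuotientRing h.QuotientRing) ≅ ModuleCat.of h.auslanderOrder h.S) := by
  refine exists_inflation_iso_quotient _ _ _ (fun s => ?_) fun x => ?_
  · obtain ⟨a, rfl⟩ := Ideal.Quotient.mk_surjective (I := h.conductorIdeal) s
    refine ⟨h.embA a, ?_, rfl⟩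
    change h.embA a * h.embA 1 = h.embA a
    rw [← map_mul, mul_one]
  · exact (Ideal.Quotient.eq_zero_iff_mem (I := h.conductorIdeal)
      (a := ⟨x.1.1 0 0, x.1.2.1⟩)).symm

theorem nonempty_inflation_iso_T : Nonempty ((inflation h.toCoverQuotient).obj
    (ModuleCat.of h.CoverQuotient h.CoverQuotient) ≅ ModuleCat.of h.auslanderOrder h.T) := by
  refine exists_inflation_iso_quotient _ _ _ (fun s => ?_) fun x => ?_
  · obtain ⟨a, rfl⟩ := Ideal.Quotient.mk_surjective (I := h.coverIdeal) s
    refine ⟨h.embH a, ?_, rfl⟩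
    change h.embH a * h.embH 1 = h.embH a
    rw [← map_mul, mul_one]
  · exact (Ideal.Quotient.eq_zero_iff_mem (I := h.coverIdeal)
      (a := ⟨x.1.1 1 1, x.1.2.2.2.2⟩)).symm

/-- The common radical is an ideal of `H` contained in `A`. -/
theorem jacobson_le_conductorIdeal : Ring.jacobson A ≤ h.conductorIdeal := by
  intro x hx
  refine ⟨x.2, fun y hy => ?_⟩
  obtain ⟨hx', hxr⟩ := (h.radical x).1 ⟨x.2, hx⟩
  exact ((h.radical _).2 ⟨H.mul_mem hx' hy, Ideal.mul_mem_right (⟨y, hy⟩ : H) _ hxr⟩).1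

theorem jacobson_le_coverIdeal : Ring.jacobson H ≤ h.coverIdeal := by
  intro x hx
  obtain ⟨hx', hxr⟩ := (h.radical x).2 ⟨x.2, hx⟩
  exact h.jacobson_le_conductorIdeal hxr

include h in
theorem isSemisimpleRing_quotient_jacobson : IsSemisimpleRing (A ⧸ Ring.jacobson A) := by
  have := h.semilocal
  have := h.finite
  have := isArtinianRing_quotient_jacobson (S := A)
  rw [IsArtinianRing.isSemisimpleRing_iff_jacobson]
  exact Ring.jacobson_quotient_jacobson A

include h in
-- `H / rad H` is finitely generated over the semisimple ring `A / rad A`, hence artinian, and its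
-- radical is zero.
theorem isSemisimpleRing_cover_quotient_jacobson : IsSemisimpleRing (H ⧸ Ring.jacobson H) := by
  have := h.isSemisimpleRing_quotient_jacobson
  have hJ : Ring.jacobson A ≤ (Ring.jacobson H).comap (Subring.inclusion h.le) := by
    intro x hx
    obtain ⟨hx', hxr⟩ := (h.radical x).1 ⟨x.2, hx⟩
    exact hxr
  let f : A ⧸ Ring.jacobson A →+* H ⧸ Ring.jacobson H := Ideal.quotientMap _ _ hJ
  let _ : Module (A ⧸ Ring.jacobson A) (H ⧸ Ring.jacobson H) := Module.compHom _ f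
  have : IsScalarTower (A ⧸ Ring.jacobson A) (H ⧸ Ring.jacobson H) (H ⧸ Ring.jacobson H) :=
    ⟨fun a x y => mul_assoc (f a) x y⟩
  have := h.fg
  have hs : RingHomSurjective (Ideal.Quotient.mk (Ring.jacobson A)) :=
    ⟨Ideal.Quotient.mk_surjective⟩
  let q : H →+* H ⧸ Ring.jacobson H := Ideal.Quotient.mk _
  let g : OverBimodule h.le →ₛₗ[Ideal.Quotient.mk (Ring.jacobson A)] H ⧸ Ring.jacobson H :=
    { toFun := q
      map_add' := map_add q
      map_smul' := fun a x => map_mul q (Subring.inclusion h.le a) x }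
  have : Module.Finite (A ⧸ Ring.jacobson A) (H ⧸ Ring.jacobson H) :=
    Module.Finite.of_surjective g (Ideal.Quotient.mk_surjective (I := Ring.jacobson H))
  have : IsArtinianRing (H ⧸ Ring.jacobson H) :=
    isArtinian_of_tower (A ⧸ Ring.jacobson A) inferInstance
  rw [IsArtinianRing.isSemisimpleRing_iff_jacobson]
  exact Ring.jacobson_quotient_jacobson H

instance : IsSemisimpleRing h.QuotientRing :=
  have := h.isSemisimpleRing_quotient_jacobson
  RingHom.isSemisimpleRing_of_surjective
    (Ideal.Quotient.factor h.jacobson_le_conductorIdeal) (Ideal.Quotient.factor_surjective _)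

instance : IsSemisimpleRing h.CoverQuotient :=
  have := h.isSemisimpleRing_cover_quotient_jacobson
  RingHom.isSemisimpleRing_of_surjective
    (Ideal.Quotient.factor h.jacobson_le_coverIdeal) (Ideal.Quotient.factor_surjective _)

end Simple

end NodalOrder.IsNodalOrder

/-! ### Exactness of `Q ⊗_H -` and the counit for the idempotent `f` -/

namespace NodalOrder.IsNodalOrder

variable {Λ : Type u} [Ring Λ] {A H : Subring Λ} (h : IsNodalOrder A H)

section Tensor

/-- The element `(1; 0)` of `Q = (H; H)`. -/
def genQ : h.Q := ⟨h.matE, h.mat_mul_embH_one 0 1 0 0⟩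

variable (M : Type u) [AddCommGroup M] [Module H M]

/-- The coordinates of an element of `Q ⊗_H M = M ⊕ M`. -/
def tensorCoord : BalancedTensor H h.Q M →+ M × M :=
  BalancedTensor.lift
    (AddMonoidHom.mk' (fun p => AddMonoidHom.mk' (fun m =>
        ((⟨p.1.1 0 1, p.1.2.2.1⟩ : H) • m, (⟨p.1.1 1 1, p.1.2.2.2.2⟩ : H) • m))
        (fun m n => Prod.ext (smul_add _ m n) (smul_add _ m n)))
      (fun p q => AddMonoidHom.ext fun m => Prod.ext
        (add_smul (⟨p.1.1 0 1, p.1.2.2.1⟩ : H) ⟨q.1.1 0 1, q.1.2.2.1⟩ m)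
        (add_smul (⟨p.1.1 1 1, p.1.2.2.2.2⟩ : H) ⟨q.1.1 1 1, q.1.2.2.2.2⟩ m)))
    (fun t p m => by
      refine Prod.ext ?_ ?_
      · change (⟨(p.1.1 * (h.embH t).1) 0 1, _⟩ : H) • m = (⟨p.1.1 0 1, p.1.2.2.1⟩ : H) • t • m
        rw [← mul_smul]
        congr 1
        refine Subtype.ext ?_
        change (p.1.1 * (h.embH t).1) 0 1 = p.1.1 0 1 * t
        simp [embH_eq_mat, mat, Matrix.mul_apply]
      · change (⟨(p.1.1 * (h.embH t).1) 1 1, _⟩ : H) • m = (⟨p.1.1 1 1, p.1.2.2.2.2⟩ : H) • t • m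
        rw [← mul_smul]
        congr 1
        refine Subtype.ext ?_
        change (p.1.1 * (h.embH t).1) 1 1 = p.1.1 1 1 * t
        simp [embH_eq_mat, mat, Matrix.mul_apply])

variable {M}

theorem tensorCoord_genQ (m : M) :
    h.tensorCoord M (BalancedTensor.tmul H h.genQ m) = (m, 0) :=
  Prod.ext (one_smul H m) (zero_smul H m)

theorem tensorCoord_gen (m : M) :
    h.tensorCoord M (BalancedTensor.tmul H (Column.gen h.embH) m) = (0, m) :=
  Prod.ext (zero_smul H m) (one_smul H m)

/-- `Q` is free as a right `H`-module on the columns `(1; 0)` and `(0; 1)`. -/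
theorem eq_tmul_add_tmul (z : BalancedTensor H h.Q M) :
    z = BalancedTensor.tmul H h.genQ (h.tensorCoord M z).1 +
      BalancedTensor.tmul H (Column.gen h.embH) (h.tensorCoord M z).2 := by
  induction z using BalancedTensor.induction_on with
  | zero =>
    rw [map_zero]
    refine ((congrArg₂ (· + ·) ?_ ?_).trans (add_zero 0)).symm <;>
    exact congrArg QuotientAddGroup.mk (TensorProduct.tmul_zero _ _)
  | tmul p m =>
    change _ = BalancedTensor.tmul H h.genQ ((⟨p.1.1 0 1, p.1.2.2.1⟩ : H) • m) +
      BalancedTensor.tmul H (Column.gen h.embH) ((⟨p.1.1 1 1, p.1.2.2.2.2⟩ : H) • m)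
    rw [← BalancedTensor.op_smul_tmul, ← BalancedTensor.op_smul_tmul, ← BalancedTensor.add_tmul]
    congr 1
    refine Subtype.ext ?_
    change p.1 = h.matE * h.embH _ + h.embH 1 * h.embH _
    rw [← map_mul, one_mul, embH_eq_mat, embH_eq_mat, matE_mul_mat, mat_add, zero_add, zero_add,
      add_zero, add_zero]
    conv_lhs => rw [← show p.1 * h.embH 1 = p.1 from p.2]
    have hp : p.1 = h.mat ⟨_, p.1.2.1⟩ ⟨_, p.1.2.2.1⟩ ⟨_, p.1.2.2.2.1⟩ ⟨_, p.1.2.2.2.2⟩ := by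
      refine Subtype.ext ?_
      ext i j
      fin_cases i <;> fin_cases j <;> rfl
    exact (congrArg (· * h.embH 1) hp).trans (h.mat_mul_embH_one _ _ _ _)
  | add x y hx hy =>
    conv_lhs => rw [hx, hy]
    rw [map_add, Prod.fst_add, Prod.snd_add, BalancedTensor.tmul_add, BalancedTensor.tmul_add]
    abel

theorem tensorCoord_bijective : Function.Bijective (h.tensorCoord M) := by
  refine Function.bijective_iff_has_inverse.2 ⟨fun m => BalancedTensor.tmul H h.genQ m.1 +
    BalancedTensor.tmul H (Column.gen h.embH) m.2, fun z => (h.eq_tmul_add_tmul z).symm,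
    fun m => ?_⟩
  dsimp only
  rw [map_add, tensorCoord_genQ, tensorCoord_gen]
  exact Prod.ext (add_zero _) (zero_add _)

theorem tensorCoord_map {M N : ModuleCat.{u} H} (f : M ⟶ N) (z : BalancedTensor H h.Q M) :
    h.tensorCoord N ((functorF h.embH).map f z) =
      (f (h.tensorCoord M z).1, f (h.tensorCoord M z).2) := by
  refine DFunLike.congr_fun (f := (h.tensorCoord N).comp
      (BalancedTensor.lTensor H h.auslanderOrder (P := h.Q) f.hom).toAddMonoidHom)
    (g := (f.hom.toAddMonoidHom.prodMap f.hom.toAddMonoidHom).comp (h.tensorCoord M))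
    (BalancedTensor.addHom_ext fun p m => ?_) z
  exact (Prod.ext (map_smul f.hom _ _) (map_smul f.hom _ _)).symm

/-- On underlying groups `Q ⊗_H -` is `M ↦ M ⊕ M`, by the coordinates above. -/
theorem functorF_embH_map_shortExact (X : ShortComplex (ModuleCat.{u} H)) (hX : X.ShortExact) :
    (X.map (functorF h.embH)).ShortExact := by
  have hinj := hX.moduleCat_injective_f
  have hsurj := hX.moduleCat_surjective_g
  have hex := (ShortComplex.ShortExact.moduleCat_exact_iff_function_exact _).mp hX.exact
  refine { exact := ?_, mono_f := ?_, epi_g := ?_ }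
  · refine (ShortComplex.ShortExact.moduleCat_exact_iff_function_exact _).mpr ?_
    intro z
    change BalancedTensor H h.Q X.X₂ at z
    constructor
    · intro hz
      have h1 := (h.tensorCoord_map X.g z).symm.trans
        ((congrArg (h.tensorCoord X.X₃) hz).trans (map_zero _))
      obtain ⟨m₁, hm₁⟩ := (hex _).1 (congrArg Prod.fst h1)
      obtain ⟨m₂, hm₂⟩ := (hex _).1 (congrArg Prod.snd h1)
      obtain ⟨y, hy⟩ := (h.tensorCoord_bijective (M := X.X₁)).2 (m₁, m₂)
      refine ⟨y, h.tensorCoord_bijective.1 ((h.tensorCoord_map X.f y).trans ?_)⟩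
      rw [hy]
      exact Prod.ext hm₁ hm₂
    · rintro ⟨y, rfl⟩
      change BalancedTensor H h.Q X.X₁ at y
      exact ConcreteCategory.congr_hom (((X.map (functorF h.embH)).zero)) y
  · refine (ModuleCat.mono_iff_injective _).mpr ?_
    intro y z hyz
    change BalancedTensor H h.Q X.X₁ at y z
    refine h.tensorCoord_bijective.1 ?_
    have h1 := (h.tensorCoord_map X.f y).symm.trans
      ((congrArg (h.tensorCoord X.X₂) hyz).trans (h.tensorCoord_map X.f z))
    exact Prod.ext (hinj (congrArg Prod.fst h1)) (hinj (congrArg Prod.snd h1))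
  · refine (ModuleCat.epi_iff_surjective _).mpr ?_
    intro z
    change BalancedTensor H h.Q X.X₃ at z
    obtain ⟨m₁, hm₁⟩ := hsurj (h.tensorCoord X.X₃ z).1
    obtain ⟨m₂, hm₂⟩ := hsurj (h.tensorCoord X.X₃ z).2
    obtain ⟨y, hy⟩ := (h.tensorCoord_bijective (M := X.X₂)).2 (m₁, m₂)
    refine ⟨y, h.tensorCoord_bijective.1 ((h.tensorCoord_map X.g y).trans ?_)⟩
    rw [hy]
    exact Prod.ext hm₁ hm₂

theorem functorF_embH_exact :
    PreservesFiniteLimits (functorF h.embH) ∧ PreservesFiniteColimits (functorF h.embH) :=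
  ((Functor.exact_tfae (functorF h.embH)).out 0 3 rfl rfl).mp h.functorF_embH_map_shortExact

instance : PreservesFiniteLimits (functorF h.embH) := h.functorF_embH_exact.1

instance : PreservesFiniteColimits (functorF h.embH) := h.functorF_embH_exact.2

end Tensor

section Counit

variable (M : ModuleCat.{u} h.auslanderOrder)

theorem mul_embH_one_matE : h.embH 1 * h.matE = 0 := by
  rw [matE, embH_one_mul_mat]
  exact Subtype.ext (by ext i j; fin_cases i <;> fin_cases j <;> simp [mat])

/-- On `Q ⊗_H f M = f M ⊕ f M` the counit is `(y₁, y₂) ↦ matE y₁ + y₂`; the last clause records that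
`y₁` and `y₂` determine whether `z` vanishes. -/
theorem exists_counit_apply_eq (z : (functorF h.embH).obj ((functorG h.embH).obj M)) :
    ∃ y₁ y₂ : M, h.embH 1 • y₁ = y₁ ∧ h.embH 1 • y₂ = y₂ ∧
      (adjunctionFG h.embH).counit.app M z = h.matE • y₁ + y₂ ∧ (y₁ = 0 → y₂ = 0 → z = 0) := by
  change BalancedTensor H h.Q (BimoduleHom h.auslanderOrder h.Q M) at z
  let c := h.tensorCoord _ z
  refine ⟨c.1 (Column.gen h.embH), c.2 (Column.gen h.embH),
    BimoduleHom.map_one_smul_gen _ _, BimoduleHom.map_one_smul_gen _ _, ?_, fun h₁ h₂ => ?_⟩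
  · have h1 : (adjunctionFG h.embH).counit.app M z = c.1 h.genQ + c.2 (Column.gen h.embH) := by
      conv_lhs => rw [h.eq_tmul_add_tmul z]
      exact map_add (tensorHomCounit h.auslanderOrder H h.Q M) _ _
    rw [h1, BimoduleHom.column_apply h.embH c.1 h.genQ]
    rfl
  · refine (h.tensorCoord_bijective (M := BimoduleHom h.auslanderOrder h.Q M)).1
      (Eq.trans ?_ (map_zero _).symm)
    refine Prod.ext (BimoduleHom.ext fun p => ?_) (BimoduleHom.ext fun p => ?_)
    · exact (BimoduleHom.column_apply h.embH c.1 p).trans (by rw [h₁, smul_zero]; rfl)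
    · exact (BimoduleHom.column_apply h.embH c.2 p).trans (by rw [h₂, smul_zero]; rfl)

theorem exists_counit_apply_of (y₁ y₂ : M) (h₂ : h.embH 1 • y₂ = y₂) (h₁ : h.embH 1 • y₁ = y₁) :
    ∃ z, (adjunctionFG h.embH).counit.app M z = h.matE • y₁ + y₂ := by
  have hy (y : M) (hy : h.embH 1 • y = y) : ∃ f : BimoduleHom h.auslanderOrder h.Q M,
      ∀ p, f p = p.1 • y :=
    ⟨(LinearMap.toSpanSingleton _ M y).comp h.Q.subtype, fun p => rfl⟩
  obtain ⟨f₁, hf₁⟩ := hy y₁ h₁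
  obtain ⟨f₂, hf₂⟩ := hy y₂ h₂
  refine ⟨(BalancedTensor.tmul H h.genQ f₁ + BalancedTensor.tmul H (Column.gen h.embH) f₂ :
    BalancedTensor H h.Q (BimoduleHom h.auslanderOrder h.Q M)), ?_⟩
  refine (map_add (tensorHomCounit h.auslanderOrder H h.Q M) _ _).trans ?_
  rw [tensorHomCounit_tmul, tensorHomCounit_tmul, hf₁, hf₂]
  exact congrArg (_ + ·) h₂

/-- Multiplication by `f` isolates the second coordinate, because `f matE = 0`; the hypothesis then
kills the first. -/
theorem counit_injective (hM : ∀ y : M, h.embH 1 • y = y → h.matE • y = 0 → y = 0) :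
    Function.Injective ((adjunctionFG h.embH).counit.app M) := by
  refine (injective_iff_map_eq_zero ((adjunctionFG h.embH).counit.app M).hom).2 fun z hz => ?_
  obtain ⟨y₁, y₂, h₁, h₂, he, h0⟩ := h.exists_counit_apply_eq M z
  have h3 : h.matE • y₁ + y₂ = 0 := he.symm.trans hz
  have h4 : y₂ = 0 := by
    have : h.embH 1 • (h.matE • y₁ + y₂) = h.embH 1 • (0 : M) := by rw [h3]
    rwa [smul_add, ← mul_smul, mul_embH_one_matE, zero_smul, zero_add, h₂, smul_zero] at this
  rw [h4, add_zero] at h3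
  exact h0 (hM _ h₁ h3) h4

/-- The sequence `0 → B f M → M → M / B f M → 0`, when `B f M = B f ⊗ f M`. -/
theorem exists_counit_unit_shortExact
    {F : ModuleCat.{u} h.auslanderOrder ⥤ ModuleCat.{u} h.QuotientRing}
    (adj : F ⊣ inflation h.toQuotientRing)
    (hadj : ∀ M : ModuleCat.{u} h.auslanderOrder, Function.Surjective (adj.unit.app M) ∧
        ∀ m : M, adj.unit.app M m = 0 ↔ m ∈ Submodule.span h.auslanderOrder
          {x : M | ∃ r, h.toQuotientRing r = 0 ∧ ∃ y : M, x = r • y})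
    (hM : ∀ y : M, h.embH 1 • y = y → h.matE • y = 0 → y = 0) :
    ∃ zero, (ShortComplex.mk ((adjunctionFG h.embH).counit.app M)
      (adj.unit.app M) zero).ShortExact := by
  have hrange (m : M) : adj.unit.app M m = 0 ↔
      ∃ z, (adjunctionFG h.embH).counit.app M z = m := by
    rw [(hadj M).2]
    constructor
    · intro hm
      have : Submodule.span h.auslanderOrder
          {x : M | ∃ r, h.toQuotientRing r = 0 ∧ ∃ y : M, x = r • y} ≤
          LinearMap.range ((adjunctionFG h.embH).counit.app M).hom := by
        rw [Submodule.span_le]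
        rintro _ ⟨r, hr, y, rfl⟩
        obtain ⟨a, x, c, t, rfl⟩ := h.exists_eq_mat r
        rw [toQuotientRing_mat_eq_zero_iff] at hr
        have hmat (c t) : h.embH 1 • h.mat 0 0 c t • y = h.mat 0 0 c t • y := by
          rw [← mul_smul, embH_one_mul_mat]
        -- An element of the kernel of `B → A / C` is `matE` times an element of `f B`, plus an
        -- element of `f B`.
        obtain ⟨z, hz⟩ := h.exists_counit_apply_of M (h.mat 0 0 ⟨a, hr⟩ x • y) (h.mat 0 0 c t • y)
          (hmat _ _) (hmat _ _)
        refine ⟨z, hz.trans ?_⟩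
        rw [← mul_smul, ← add_smul, matE_mul_mat, mat_add]
        simp
      exact this hm
    · rintro ⟨z, rfl⟩
      obtain ⟨y₁, y₂, h₁, h₂, he, -⟩ := h.exists_counit_apply_eq M z
      rw [he, ← h₁, ← h₂, ← mul_smul]
      refine Submodule.add_mem _ (Submodule.subset_span ⟨_, ?_, y₁, rfl⟩)
        (Submodule.subset_span ⟨_, h.toQuotientRing_embH 1, y₂, rfl⟩)
      rw [map_mul, toQuotientRing_embH, mul_zero]
  have zero : (adjunctionFG h.embH).counit.app M ≫ adj.unit.app M = 0 := by
    ext z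
    exact (hrange _).2 ⟨z, rfl⟩
  refine ⟨zero, { exact := ?_, mono_f := ?_, epi_g := ?_ }⟩
  · exact (ShortComplex.ShortExact.moduleCat_exact_iff_function_exact _).mpr hrange
  · exact (ModuleCat.mono_iff_injective _).mpr (h.counit_injective M hM)
  · exact (ModuleCat.epi_iff_surjective _).mpr (hadj M).1

/-- Left multiplication by `matE` is the inclusion of the second row `(C, H)` into the first row
`(A, H)`. This makes `B` and its free modules satisfy the hypothesis of
`exists_counit_unit_shortExact`. -/
theorem eq_zero_of_matE_mul_eq_zero (y : h.auslanderOrder) (hy : h.embH 1 * y = y)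
    (hy' : h.matE * y = 0) : y = 0 := by
  obtain ⟨a, x, c, y, rfl⟩ := h.exists_eq_mat y
  have h1 : h.mat 0 0 c y = h.mat a x c y := (h.embH_one_mul_mat a x c y).symm.trans hy
  have h2 : h.mat ⟨c, c.2.1⟩ y 0 0 = 0 := (h.matE_mul_mat a x c y).symm.trans hy'
  have h3 : (c : Λ) = 0 := congrFun (congrFun (congrArg Subtype.val h2) 0) 0
  have h4 : (y : Λ) = 0 := congrFun (congrFun (congrArg Subtype.val h2) 0) 1
  rw [← h1]
  refine Subtype.ext ?_
  ext i j
  fin_cases i <;> fin_cases j <;> simp [mat, h3, h4]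

end Counit

end NodalOrder.IsNodalOrder

/-! ### Single modules as test objects, and cohomology under exact functors -/

namespace NodalOrder

open DerivedCategory

section Single

variable {𝒜 : Type*} [Category* 𝒜] [Abelian 𝒜] [HasDerivedCategory.{w₁} 𝒜]

theorem isZero_iff_homology (X : DerivedCategory 𝒜) :
    IsZero X ↔ ∀ n, IsZero ((homologyFunctor 𝒜 n).obj X) := by
  refine ⟨fun h n => Functor.map_isZero _ h, fun h => ?_⟩
  obtain ⟨Z, hZ⟩ := HasZeroObject.zero (C := DerivedCategory 𝒜)
  have : IsIso (0 : X ⟶ Z) := (isIso_iff 𝒜 _).2 fun n =>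
    ⟨0, (h n).eq_of_src _ _, (Functor.map_isZero _ hZ).eq_of_src _ _⟩
  exact hZ.of_iso (asIso (0 : X ⟶ Z))

theorem homologyMap_eq_zero {K L : CochainComplex 𝒜 ℤ} (f : K ⟶ L) (h : Q.map f = 0) (n : ℤ) :
    HomologicalComplex.homologyMap f n = 0 := by
  have h1 := homologyFunctorFactors_hom_naturality f n
  rw [h, Functor.map_zero, zero_comp] at h1
  exact (cancel_epi ((homologyFunctorFactors 𝒜 n).hom.app K)).1 (h1.symm.trans comp_zero.symm)

/-- A map into the cycles is a chain map from a complex concentrated in degree `n`; if that becomes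
zero in the derived category, it is zero on cohomology. -/
theorem comp_homologyπ_eq_zero {P : 𝒜} {K : CochainComplex 𝒜 ℤ} {n : ℤ} (g : P ⟶ K.cycles n)
    (h : ∀ f : (singleFunctor 𝒜 n).obj P ⟶ Q.obj K, f = 0) : g ≫ K.homologyπ n = 0 := by
  let φ : (HomologicalComplex.single 𝒜 (ComplexShape.up ℤ) n).obj P ⟶ K :=
    HomologicalComplex.mkHomFromSingle (g ≫ K.iCycles n) (fun k _ => by simp)
  have h1 := homologyMap_eq_zero φ (h _) n
  have h2 : HomologicalComplex.cyclesMap φ n =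
      (HomologicalComplex.singleObjCyclesSelfIso _ n P).hom ≫ g := by
    rw [← cancel_mono (K.iCycles n), HomologicalComplex.cyclesMap_i,
      HomologicalComplex.mkHomFromSingle_f, HomologicalComplex.singleObjCyclesSelfIso_hom]
    simp only [Category.assoc]
  have h3 := HomologicalComplex.homologyπ_naturality φ n
  rw [h1, comp_zero, h2, Category.assoc] at h3
  rw [← cancel_epi (HomologicalComplex.singleObjCyclesSelfIso _ n P).hom, comp_zero]
  exact h3.symm

theorem homologyι_comp_eq_zero {E : 𝒜} {K : CochainComplex 𝒜 ℤ} {n : ℤ} (g : K.opcycles n ⟶ E)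
    (h : ∀ f : Q.obj K ⟶ (singleFunctor 𝒜 n).obj E, f = 0) : K.homologyι n ≫ g = 0 := by
  let φ : K ⟶ (HomologicalComplex.single 𝒜 (ComplexShape.up ℤ) n).obj E :=
    HomologicalComplex.mkHomToSingle (K.pOpcycles n ≫ g) (fun k _ => by simp)
  have h1 := homologyMap_eq_zero φ (h _) n
  have h2 : HomologicalComplex.opcyclesMap φ n =
      g ≫ (HomologicalComplex.singleObjOpcyclesSelfIso _ n E).hom := by
    rw [← cancel_epi (K.pOpcycles n), HomologicalComplex.p_opcyclesMap,
      HomologicalComplex.mkHomToSingle_f, HomologicalComplex.singleObjOpcyclesSelfIso_hom]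
    simp only [Category.assoc]
  have h3 := HomologicalComplex.homologyι_naturality φ n
  rw [h1, zero_comp, h2, ← Category.assoc] at h3
  rw [← cancel_mono (HomologicalComplex.singleObjOpcyclesSelfIso _ n E).hom, zero_comp]
  exact h3.symm

/-- `E` in degree `n`, as a shift of `E` in degree `0`. -/
noncomputable def shiftSingleIso (E : 𝒜) (n : ℤ) :
    ((singleFunctor 𝒜 0).obj E)⟦n⟧ ≅ (singleFunctor 𝒜 (-n)).obj E :=
  ((singleFunctors 𝒜).shiftIso n (-n) 0 (add_neg_cancel n)).app E

theorem leftPerp_iff {E : 𝒜} {X : DerivedCategory 𝒜} :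
    leftPerp E X ↔ ∀ (n : ℤ) (f : X ⟶ (singleFunctor 𝒜 n).obj E), f = 0 := by
  constructor
  · intro h n f
    obtain ⟨n, rfl⟩ := neg_surjective n
    rw [← cancel_mono (shiftSingleIso E n).inv, zero_comp]
    exact h n _
  · intro h n f
    rw [← cancel_mono (shiftSingleIso E n).hom, zero_comp]
    exact h _ _

theorem rightPerp_iff {E : 𝒜} {X : DerivedCategory 𝒜} :
    rightPerp E X ↔ ∀ (n : ℤ) (f : (singleFunctor 𝒜 n).obj E ⟶ X), f = 0 := by
  constructor
  · intro h n f
    obtain ⟨n, rfl⟩ := neg_surjective n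
    rw [← cancel_epi (shiftSingleIso E n).hom, comp_zero]
    exact h n _
  · intro h n f
    rw [← cancel_epi (shiftSingleIso E n).inv, comp_zero]
    exact h _ _

end Single

section ExactFunctor

variable {𝒜 ℬ : Type*} [Category* 𝒜] [Abelian 𝒜] [HasDerivedCategory.{w₁} 𝒜]
  [Category* ℬ] [Abelian ℬ] [HasDerivedCategory.{w₂} ℬ]
  (F : 𝒜 ⥤ ℬ) [F.Additive] [PreservesFiniteLimits F] [PreservesFiniteColimits F]

theorem nonempty_homology_mapDerivedCategory_iso (X : DerivedCategory 𝒜) (n : ℤ) :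
    Nonempty ((homologyFunctor ℬ n).obj (F.mapDerivedCategory.obj X) ≅
      F.obj ((homologyFunctor 𝒜 n).obj X)) := by
  let K := Q.objPreimage X
  let e : Q.obj K ≅ X := Q.objObjPreimageIso X
  exact ⟨(homologyFunctor ℬ n).mapIso (F.mapDerivedCategory.mapIso e.symm ≪≫
      F.mapDerivedCategoryFactors.app K) ≪≫
    (homologyFunctorFactors ℬ n).app _ ≪≫ (K.sc n).mapHomologyIso F ≪≫
    F.mapIso ((homologyFunctorFactors 𝒜 n).symm.app K ≪≫ (homologyFunctor 𝒜 n).mapIso e)⟩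

theorem isZero_mapDerivedCategory_obj_iff (X : DerivedCategory 𝒜) :
    IsZero (F.mapDerivedCategory.obj X) ↔
      ∀ n, IsZero (F.obj ((homologyFunctor 𝒜 n).obj X)) := by
  rw [isZero_iff_homology]
  exact forall_congr' fun n =>
    (nonempty_homology_mapDerivedCategory_iso F X n).some.isZero_iff

end ExactFunctor

section Ring

variable {R : Type u} [Ring R] [HasDerivedCategory.{w₁} (ModuleCat.{u} R)]

omit [HasDerivedCategory.{w₁} (ModuleCat.{u} R)] in
theorem exists_iCycles_comp (K : CochainComplex (ModuleCat.{u} R) ℤ) (n : ℤ)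
    (x : K.homology n) : ∃ g : ModuleCat.of R R ⟶ K.cycles n, (g ≫ K.homologyπ n) (1 : R) = x := by
  obtain ⟨y, rfl⟩ := (ModuleCat.epi_iff_surjective (K.homologyπ n)).1 inferInstance x
  exact ⟨ModuleCat.ofHom (LinearMap.toSpanSingleton R _ y),
    congrArg (K.homologyπ n) (one_smul R y)⟩

/-- Every cohomology class is the image of `1` under a map from the regular module placed in its
degree. -/
theorem isZero_of_forall_single_regular (X : DerivedCategory (ModuleCat.{u} R))
    (h : ∀ (n : ℤ) (f : (singleFunctor _ n).obj (ModuleCat.of R R) ⟶ X), f = 0) : IsZero X := by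
  let K := Q.objPreimage X
  let e : Q.obj K ≅ X := Q.objObjPreimageIso X
  refine (isZero_iff_homology X).2 fun n => ?_
  refine IsZero.of_iso (?_ : IsZero (K.homology n))
    ((homologyFunctor _ n).mapIso e.symm ≪≫ (homologyFunctorFactors _ n).app K)
  have : Subsingleton (K.homology n) := by
    refine subsingleton_of_forall_eq 0 fun x => ?_
    obtain ⟨g, rfl⟩ := exists_iCycles_comp K n x
    rw [comp_homologyπ_eq_zero g fun f => ?_]
    · rfl
    · rw [← cancel_mono e.hom, zero_comp]
      exact h n _
  exact ModuleCat.isZero_of_subsingleton _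

end Ring

end NodalOrder

/-! ### Full faithfulness and essential image tested on generators -/

namespace CategoryTheory.Pretriangulated

section

variable {𝒯 : Type*} [Category* 𝒯] [HasZeroObject 𝒯] [HasShift 𝒯 ℤ] [Preadditive 𝒯]
  [∀ n : ℤ, (shiftFunctor 𝒯 n).Additive] [Pretriangulated 𝒯]

/-- In the long exact sequence, injectivity at `W` and surjectivity at its shift leave no room for
maps to the first vertex. -/
theorem eq_zero_of_comp_mor₂_bijective {T : Triangle 𝒯} (hT : T ∈ distTriang 𝒯) {W : 𝒯}
    (h₁ : ∀ f : W ⟶ T.obj₂, f ≫ T.mor₂ = 0 → f = 0)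
    (h₂ : ∀ g : W⟦(1 : ℤ)⟧ ⟶ T.obj₃, ∃ f, f ≫ T.mor₂ = g) (k : W ⟶ T.obj₁) : k = 0 := by
  have h3 : k ≫ T.mor₁ = 0 := h₁ _ (by
    rw [Category.assoc, comp_distTriang_mor_zero₁₂ T hT, comp_zero])
  obtain ⟨g, hg⟩ := Triangle.coyoneda_exact₁ T hT (k⟦(1 : ℤ)⟧')
    (by rw [← Functor.map_comp, h3, Functor.map_zero])
  obtain ⟨f, rfl⟩ := h₂ g
  rw [Category.assoc, comp_distTriang_mor_zero₂₃ T hT, comp_zero] at hg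
  exact (shiftFunctor 𝒯 (1 : ℤ)).map_injective (hg.trans (Functor.map_zero _ _ _).symm)

end

variable {𝒰 𝒟 : Type*} [Category* 𝒰] [HasZeroObject 𝒰] [HasShift 𝒰 ℤ] [Preadditive 𝒰]
  [∀ n : ℤ, (shiftFunctor 𝒰 n).Additive] [Pretriangulated 𝒰]
  [Category* 𝒟] [HasZeroObject 𝒟] [HasShift 𝒟 ℤ] [Preadditive 𝒟]
  [∀ n : ℤ, (shiftFunctor 𝒟 n).Additive] [Pretriangulated 𝒟]
  {I : 𝒰 ⥤ 𝒟} {R : 𝒟 ⥤ 𝒰} (adj : I ⊣ R) {ι : Type*} {W : ι → 𝒰}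

omit [HasZeroObject 𝒟] [HasShift 𝒟 ℤ] [Preadditive 𝒟] [∀ n : ℤ, (shiftFunctor 𝒟 n).Additive]
  [Pretriangulated 𝒟] in
include adj in
/-- A left adjoint is fully faithful if it is so on morphisms from a generating family. -/
theorem full_and_faithful_of_bijective_map (hs : ∀ a, ∃ b, Nonempty ((W a)⟦(1 : ℤ)⟧ ≅ W b))
    (hW : ∀ a Z, Function.Bijective (fun f : W a ⟶ Z => I.map f))
    (hgen : ∀ X, (∀ a (f : W a ⟶ X), f = 0) → IsZero X) : I.Full ∧ I.Faithful := by
  have hb (a : ι) (Z : 𝒰) : Function.Bijective (fun f : W a ⟶ Z => f ≫ adj.unit.app Z) := by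
    have : (fun f : W a ⟶ Z => f ≫ adj.unit.app Z) = (adj.homEquiv _ _) ∘ fun f => I.map f := by
      ext f
      simp [Adjunction.homEquiv_unit]
    rw [this]
    exact (adj.homEquiv _ _).bijective.comp (hW a Z)
  have h (Z : 𝒰) : IsIso (adj.unit.app Z) := by
    -- The unit is bijective on maps from generators, so its fiber is orthogonal to them; the
    -- shifted generator needed here is again a generator by `hs`.
    obtain ⟨V, p, δ, hT⟩ := distinguished_cocone_triangle₁ (adj.unit.app Z)
    have hV : IsZero V := hgen V fun a => eq_zero_of_comp_mor₂_bijective hT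
      (fun f hf => (hb a Z).1 (hf.trans zero_comp.symm)) (fun g => by
        obtain ⟨b, ⟨e⟩⟩ := hs a
        obtain ⟨f, hf⟩ := (hb b _).2 (e.inv ≫ g)
        refine ⟨e.hom ≫ f, (Category.assoc _ _ _).trans ?_⟩
        rw [← cancel_epi e.inv, Iso.inv_hom_id_assoc]
        exact hf)
    exact (Triangle.isZero₁_iff_isIso₂ _ hT).1 hV
  have : IsIso adj.unit := NatIso.isIso_of_isIso_app _
  have hI := adj.fullyFaithfulLOfIsIsoUnit
  exact ⟨hI.full, hI.faithful⟩

include adj in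
/-- The essential image of a fully faithful left adjoint functor. -/
theorem mem_essImage_of_generators [I.CommShift ℤ] [I.IsTriangulated] [I.Full] [I.Faithful]
    (N : ObjectProperty 𝒟) [N.IsTriangulated] [N.IsClosedUnderIsomorphisms] (hN : ∀ U, N (I.obj U))
    (hgen : ∀ Y, N Y → (∀ a (f : I.obj (W a) ⟶ Y), f = 0) → IsZero Y) {Y : 𝒟} (hY : N Y) :
    I.essImage Y := by
  -- By full faithfulness the counit is bijective on maps from the image of `I`; its fiber lies in
  -- `N` and is orthogonal to the images of the generators.
  obtain ⟨V, p, δ, hT⟩ := distinguished_cocone_triangle₁ (adj.counit.app Y)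
  have hb (U : 𝒰) : Function.Bijective
      (fun f : I.obj U ⟶ I.obj (R.obj Y) => f ≫ adj.counit.app Y) := by
    refine (Function.Bijective.of_comp_iff _
      (Functor.FullyFaithful.ofFullyFaithful I).homEquiv.bijective).1 ?_
    have : (fun f : I.obj U ⟶ I.obj (R.obj Y) => f ≫ adj.counit.app Y) ∘
        (Functor.FullyFaithful.ofFullyFaithful I).homEquiv = (adj.homEquiv U Y).symm := by
      ext f
      simp [Adjunction.homEquiv_counit, Functor.FullyFaithful.homEquiv]
    rw [this]
    exact (adj.homEquiv _ _).symm.bijective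
  have hV : IsZero V := hgen V (N.ext_of_isTriangulatedClosed₁ _ hT (hN _) hY) fun a =>
    eq_zero_of_comp_mor₂_bijective hT
      (fun f hf => (hb _).1 (hf.trans zero_comp.symm)) (fun g => by
        let e := (I.commShiftIso (1 : ℤ)).app (W a)
        obtain ⟨f, hf⟩ := (hb _).2 (e.hom ≫ g)
        refine ⟨e.inv ≫ f, (Category.assoc _ _ _).trans ?_⟩
        rw [← cancel_epi e.hom, Iso.hom_inv_id_assoc]
        exact hf)
  have : IsIso (adj.counit.app Y) := (Triangle.isZero₁_iff_isIso₂ _ hT).1 hV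
  exact ⟨_, ⟨asIso (adj.counit.app Y)⟩⟩

end CategoryTheory.Pretriangulated

namespace NodalOrder

instance {𝒟 𝒱 : Type*} [Category* 𝒟] [Category* 𝒱] (j : 𝒟 ⥤ 𝒱) :
    (functorKernel j).IsClosedUnderIsomorphisms where
  of_iso e hX := hX.of_iso (j.mapIso e.symm)

end NodalOrder

/-! ### Maps from complexes to the kernel of the corner functor at `f` -/

namespace NodalOrder.IsNodalOrder

open DerivedCategory

variable {Λ : Type u} [Ring Λ] {A H : Subring Λ} (h : IsNodalOrder A H)
  [HasDerivedCategory.{w₂} (ModuleCat.{u} H)]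
  [HasDerivedCategory.{w₃} (ModuleCat.{u} h.auslanderOrder)]

/-- Exactness of `Q ⊗_H -` allows any `K` to be replaced by a K-projective resolution; there maps to
`Y` transpose to maps into a zero object. -/
theorem Q_functorF_embH_leftOrthogonal (K : CochainComplex (ModuleCat.{u} H) ℤ) :
    (functorKernel (functorG h.embH).mapDerivedCategory).leftOrthogonal
      (DerivedCategory.Q.obj (((functorF h.embH).mapHomologicalComplex _).obj K)) := by
  intro Y f hY
  obtain ⟨P, p, _, hp⟩ := CochainComplex.exists_isKProjective K
  have : IsIso (DerivedCategory.Q.map (((functorF h.embH).mapHomologicalComplex _).map p)) := by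
    rw [isIso_Q_map_iff_quasiIso]
    infer_instance
  rw [← cancel_epi (DerivedCategory.Q.map (((functorF h.embH).mapHomologicalComplex _).map p)),
    comp_zero]
  exact (derivedUnit_bijective (adjunctionFG h.embH) P Y).1 (hY.eq_of_tgt _ _)

section Unit

variable [HasDerivedCategory.{w₄} (ModuleCat.{u} h.QuotientRing)]
  {F : ModuleCat.{u} h.auslanderOrder ⥤ ModuleCat.{u} h.QuotientRing} [F.Additive]
  (adj : F ⊣ inflation h.toQuotientRing)
  (hadj : ∀ M : ModuleCat.{u} h.auslanderOrder, Function.Surjective (adj.unit.app M) ∧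
        ∀ m : M, adj.unit.app M m = 0 ↔ m ∈ Submodule.span h.auslanderOrder
          {x : M | ∃ r, h.toQuotientRing r = 0 ∧ ∃ y : M, x = r • y})

include hadj in
-- The sequences `0 → B f ⊗ f K → K → K / B f K → 0` form a triangle whose first vertex is
-- orthogonal to the kernel, so maps from `K` to `Y` factor uniquely through `K / B f K`.
theorem derivedUnit_comp_bijective (K : CochainComplex (ModuleCat.{u} h.auslanderOrder) ℤ)
    (hK : ∀ (i : ℤ) (y : K.X i), h.embH 1 • y = y → h.matE • y = 0 → y = 0)
    {Y : DerivedCategory (ModuleCat.{u} h.auslanderOrder)}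
    (hY : functorKernel (functorG h.embH).mapDerivedCategory Y) :
    Function.Bijective (fun g : _ ⟶ Y => derivedUnit adj K ≫ g) := by
  let G' := (functorG h.embH).mapHomologicalComplex (ComplexShape.up ℤ)
  let adj' := adj.mapHomologicalComplex (ComplexShape.up ℤ)
  let adj'' := (adjunctionFG h.embH).mapHomologicalComplex (ComplexShape.up ℤ)
  have hS (i : ℤ) := h.exists_counit_unit_shortExact (K.X i) adj hadj (hK i)
  let S : ShortComplex (CochainComplex (ModuleCat.{u} h.auslanderOrder) ℤ) :=
    ShortComplex.mk (adj''.counit.app K) (adj'.unit.app K) (by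
      ext1 i
      exact (hS i).1)
  have hS' : S.ShortExact := HomologicalComplex.shortExact_of_degreewise_shortExact _ fun i =>
    (hS i).2
  have hX := h.Q_functorF_embH_leftOrthogonal (G'.obj K)
  have hb := bijective_mor₂_comp (triangleOfSES_distinguished hS') (W := Y)
    (fun f => hX f hY) (fun f => (ObjectProperty.le_shift _ (1 : ℤ) _ hX) f hY)
  let e := (inflation h.toQuotientRing).mapDerivedCategoryFactors.app
    ((F.mapHomologicalComplex _).obj K)
  have : (fun g : _ ⟶ Y => derivedUnit adj K ≫ g) =
      (fun g => DerivedCategory.Q.map S.g ≫ g) ∘ (e.homFromEquiv (Z := Y)) := by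
    ext g
    exact Category.assoc _ _ _
  rw [this]
  exact hb.comp (Equiv.bijective _)

end Unit

end NodalOrder.IsNodalOrder

/-! ### The embedding of the derived category of `A / C` -/

namespace NodalOrder.IsNodalOrder

open DerivedCategory

variable {Λ : Type u} [Ring Λ] {A H : Subring Λ} (h : IsNodalOrder A H)

theorem single_regular_X (n i : ℤ) (y : ((HomologicalComplex.single (ModuleCat.{u} h.auslanderOrder)
    (ComplexShape.up ℤ) n).obj (ModuleCat.of h.auslanderOrder h.auslanderOrder)).X i)
    (hy : h.embH 1 • y = y) (hy' : h.matE • y = 0) : y = 0 := by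
  by_cases hi : i = n
  · subst hi
    let e := HomologicalComplex.singleObjXSelf (ComplexShape.up ℤ) i
      (ModuleCat.of h.auslanderOrder h.auslanderOrder)
    have h1 : e.hom y = 0 := h.eq_zero_of_matE_mul_eq_zero (e.hom y)
      ((map_smul e.hom.hom (h.embH 1) y).symm.trans (congrArg e.hom hy))
      ((map_smul e.hom.hom h.matE y).symm.trans ((congrArg e.hom hy').trans (map_zero e.hom.hom)))
    exact (ModuleCat.mono_iff_injective e.hom).1 inferInstance (h1.trans (map_zero e.hom.hom).symm)
  · have := ModuleCat.subsingleton_of_isZero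
      (HomologicalComplex.isZero_single_obj_X (ComplexShape.up ℤ) n
        (ModuleCat.of h.auslanderOrder h.auslanderOrder) i hi)
    exact Subsingleton.elim _ _

instance (n : ℤ) : CochainComplex.IsKProjective
    ((HomologicalComplex.single (ModuleCat.{u} h.auslanderOrder) (ComplexShape.up ℤ) n).obj
      (ModuleCat.of h.auslanderOrder h.auslanderOrder)) := by
  have (i : ℤ) : Projective (((HomologicalComplex.single (ModuleCat.{u} h.auslanderOrder)
      (ComplexShape.up ℤ) n).obj (ModuleCat.of h.auslanderOrder h.auslanderOrder)).X i) := by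
    by_cases hi : i = n
    · subst hi
      have : Projective (ModuleCat.of h.auslanderOrder h.auslanderOrder) :=
        (IsProjective.iff_projective _).1 inferInstance
      exact Projective.of_iso (HomologicalComplex.singleObjXSelf (ComplexShape.up ℤ) i
        (ModuleCat.of h.auslanderOrder h.auslanderOrder)).symm this
    · exact (HomologicalComplex.isZero_single_obj_X (ComplexShape.up ℤ) n
        (ModuleCat.of h.auslanderOrder h.auslanderOrder) i hi).projective
  exact CochainComplex.isKProjective_of_projective _ n

theorem isZero_functorG_embH_obj_inflation (M : ModuleCat.{u} h.QuotientRing) :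
    IsZero ((functorG h.embH).obj ((inflation h.toQuotientRing).obj M)) := by
  rw [isZero_functorG_obj_iff]
  intro m
  change h.toQuotientRing (h.embH 1) • (show M from m) = 0
  rw [toQuotientRing_embH, zero_smul]

variable [HasDerivedCategory.{w₂} (ModuleCat.{u} H)]
  [HasDerivedCategory.{w₃} (ModuleCat.{u} h.auslanderOrder)]
  [HasDerivedCategory.{w₄} (ModuleCat.{u} h.QuotientRing)]

theorem functorKernel_inflation (X : DerivedCategory (ModuleCat.{u} h.QuotientRing)) :
    functorKernel (functorG h.embH).mapDerivedCategory
      ((inflation h.toQuotientRing).mapDerivedCategory.obj X) := by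
  refine (isZero_mapDerivedCategory_obj_iff _ _).2 fun n => ?_
  obtain ⟨e⟩ := nonempty_homology_mapDerivedCategory_iso (inflation h.toQuotientRing) X n
  exact (h.isZero_functorG_embH_obj_inflation _).of_iso ((functorG h.embH).mapIso e)

omit [HasDerivedCategory.{w₂} (ModuleCat.{u} H)] in
theorem isZero_of_isZero_inflation (X : DerivedCategory (ModuleCat.{u} h.QuotientRing))
    (hX : IsZero ((inflation h.toQuotientRing).mapDerivedCategory.obj X)) : IsZero X := by
  rw [isZero_mapDerivedCategory_obj_iff] at hX
  refine (isZero_iff_homology X).2 fun n => ?_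
  have := ModuleCat.subsingleton_of_isZero (hX n)
  exact @ModuleCat.isZero_of_subsingleton _ _ ((homologyFunctor _ n).obj X) this

/-- `D(A / C) → D(B)` is fully faithful, and its image consists of the complexes killed by
`Hom_B(Q, -)`. -/
theorem inflation_mapDerivedCategory_full_faithful_essImage :
    (inflation h.toQuotientRing).mapDerivedCategory.Full ∧
    (inflation h.toQuotientRing).mapDerivedCategory.Faithful ∧
    (inflation h.toQuotientRing).mapDerivedCategory.essImage =
      functorKernel (functorG h.embH).mapDerivedCategory := by
  obtain ⟨F, adj, _, hadj⟩ := exists_inflation_leftAdjoint h.toQuotientRing_surjective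
  have := (ModuleCat.restrictCoextendScalarsAdj.{u} h.toQuotientRing).right_adjoint_additive
  obtain ⟨R, ⟨adjR⟩⟩ := exists_derived_rightAdjoint
    (ModuleCat.restrictCoextendScalarsAdj.{u} h.toQuotientRing) CochainComplex.exists_isKInjective
  let B := ModuleCat.of h.auslanderOrder h.auslanderOrder
  let K (n : ℤ) := (HomologicalComplex.single (ModuleCat.{u} h.auslanderOrder)
    (ComplexShape.up ℤ) n).obj B
  -- `F B` is `B / B f B`, that is `A / C`; its shifts are the generators on which everything is
  -- checked.
  let W (n : ℤ) : DerivedCategory (ModuleCat.{u} h.QuotientRing) :=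
    DerivedCategory.Q.obj ((F.mapHomologicalComplex _).obj (K n))
  let e (n : ℤ) : W n ≅ (singleFunctor _ n).obj (F.obj B) :=
    DerivedCategory.Q.mapIso
      ((HomologicalComplex.singleMapHomologicalComplex F (ComplexShape.up ℤ) n).app B)
  have b1 (n : ℤ) (Z) := derivedUnit_bijective adj (K n) Z
  have b2 (n : ℤ) {Y} (hY) := h.derivedUnit_comp_bijective adj hadj (K n)
    (h.single_regular_X n) (Y := Y) hY
  have hs (n : ℤ) : ∃ m, Nonempty ((W n)⟦(1 : ℤ)⟧ ≅ W m) :=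
    ⟨n - 1, ⟨(shiftFunctor _ (1 : ℤ)).mapIso (e n) ≪≫
      ((singleFunctors _).shiftIso 1 (n - 1) n (by lia)).app _ ≪≫ (e (n - 1)).symm⟩⟩
  -- Maps from `K n` into an inflated `Z` are computed by `b1` through `W n` and by `b2` through its
  -- inflation; the comparison of the two is inflation on maps.
  have hff := full_and_faithful_of_bijective_map adjR (W := W) hs (fun n Z => by
      have h1 := b1 n Z
      have h2 := b2 n (h.functorKernel_inflation Z)
      exact (Function.Bijective.of_comp_iff' h2 _).1 h1) (fun X hX => by
      refine h.isZero_of_isZero_inflation X (isZero_of_forall_single_regular _ fun n f => ?_)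
      obtain ⟨g, rfl⟩ := (b1 n X).2 f
      dsimp only
      rw [hX n g, Functor.map_zero, comp_zero]
      rfl)
  have := hff.1
  have := hff.2
  refine ⟨hff.1, hff.2, ?_⟩
  ext Y
  constructor
  · rintro ⟨X, ⟨e⟩⟩
    exact ObjectProperty.prop_of_iso _ e (h.functorKernel_inflation X)
  · intro hY
    -- For kernel objects, `b2` turns orthogonality to the inflated generators into orthogonality to
    -- all shifts of `B`.
    refine mem_essImage_of_generators adjR (W := W) _ h.functorKernel_inflation
      (fun Y hY hf => isZero_of_forall_single_regular _ fun n f => ?_) hY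
    obtain ⟨g, rfl⟩ := (b2 n hY).2 f
    dsimp only
    rw [hf n g, comp_zero]
    rfl

end NodalOrder.IsNodalOrder

/-! ### Bounded complexes and semisimple rings: detection by a single module -/

namespace NodalOrder

open DerivedCategory

section Bounded

variable {𝒜 : Type*} [Category* 𝒜] [Abelian 𝒜] [HasDerivedCategory.{w₁} 𝒜]

/-- In the top degree cohomology is all of the opcycles, so a map from it to `E` comes from a map of
the whole complex. -/
theorem homology_to_eq_zero_of_leftPerp {E : 𝒜} {X : DerivedCategory 𝒜} (hX : leftPerp E X)
    (n : ℤ) [X.IsLE n] (f : (homologyFunctor 𝒜 n).obj X ⟶ E) : f = 0 := by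
  obtain ⟨K, _, ⟨e⟩⟩ := X.exists_iso_Q_obj_of_isLE n
  let e' : (homologyFunctor 𝒜 n).obj X ≅ K.homology n :=
    (homologyFunctor 𝒜 n).mapIso e ≪≫ (homologyFunctorFactors 𝒜 n).app K
  have := K.isIso_homologyι n (n + 1) (by simp)
    ((K.isZero_of_isStrictlyLE n (n + 1) (by lia)).eq_of_tgt _ _)
  have h := homologyι_comp_eq_zero (CategoryTheory.inv (K.homologyι n) ≫ e'.inv ≫ f) (fun g => by
    rw [← cancel_epi e.hom, comp_zero]
    exact leftPerp_iff.1 hX n _)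
  rw [IsIso.hom_inv_id_assoc] at h
  exact (cancel_epi e'.inv).1 (h.trans comp_zero.symm)

theorem to_homology_eq_zero_of_rightPerp {E : 𝒜} {X : DerivedCategory 𝒜} (hX : rightPerp E X)
    (n : ℤ) [X.IsGE n] (f : E ⟶ (homologyFunctor 𝒜 n).obj X) : f = 0 := by
  obtain ⟨K, _, ⟨e⟩⟩ := X.exists_iso_Q_obj_of_isGE n
  let e' : (homologyFunctor 𝒜 n).obj X ≅ K.homology n :=
    (homologyFunctor 𝒜 n).mapIso e ≪≫ (homologyFunctorFactors 𝒜 n).app K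
  have := K.isIso_homologyπ (n - 1) n (by simp)
    ((K.isZero_of_isStrictlyGE n (n - 1) (by lia)).eq_of_src _ _)
  have h := comp_homologyπ_eq_zero ((f ≫ e'.hom) ≫ CategoryTheory.inv (K.homologyπ n)) (fun g => by
    rw [← cancel_mono e.inv, zero_comp]
    exact rightPerp_iff.1 hX n _)
  rw [Category.assoc, IsIso.inv_hom_id, Category.comp_id] at h
  exact (cancel_mono e'.hom).1 (h.trans zero_comp.symm)

/-- A nonzero top cohomology would map nontrivially to `E`; hence the upper bound can be lowered by
one indefinitely. -/
theorem isZero_of_leftPerp_of_isLE {E : 𝒜} {X : DerivedCategory 𝒜} (hX : leftPerp E X)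
    (hE : ∀ n, ¬ IsZero ((homologyFunctor 𝒜 n).obj X) →
      ∃ f : (homologyFunctor 𝒜 n).obj X ⟶ E, f ≠ 0) (n : ℤ) [hn : X.IsLE n] : IsZero X := by
  have hle (d : ℕ) : X.IsLE (n - d) := by
    induction d with
    | zero => simpa using hn
    | succ d ih =>
      rw [isLE_iff]
      intro i hi
      by_cases h : n - d < i
      · exact X.isZero_of_isLE _ i h
      · obtain rfl : i = n - d := by push_cast at hi; lia
        by_contra h0
        obtain ⟨f, hf⟩ := hE _ h0
        exact hf (homology_to_eq_zero_of_leftPerp hX _ f)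
  refine (isZero_iff_homology X).2 fun i => ?_
  have := hle (n - i + 1).toNat
  exact X.isZero_of_isLE (n - (n - i + 1).toNat) i (by lia)

theorem isZero_of_rightPerp_of_isGE {E : 𝒜} {X : DerivedCategory 𝒜} (hX : rightPerp E X)
    (hE : ∀ n, ¬ IsZero ((homologyFunctor 𝒜 n).obj X) →
      ∃ f : E ⟶ (homologyFunctor 𝒜 n).obj X, f ≠ 0) (n : ℤ) [hn : X.IsGE n] : IsZero X := by
  have hge (d : ℕ) : X.IsGE (n + d) := by
    induction d with
    | zero => simpa using hn
    | succ d ih =>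
      rw [isGE_iff]
      intro i hi
      by_cases h : i < n + d
      · exact X.isZero_of_isGE _ i h
      · obtain rfl : i = n + d := by push_cast at hi; lia
        by_contra h0
        obtain ⟨f, hf⟩ := hE _ h0
        exact hf (to_homology_eq_zero_of_rightPerp hX _ f)
  refine (isZero_iff_homology X).2 fun i => ?_
  have := hge (i - n + 1).toNat
  exact X.isZero_of_isGE (n + (i - n + 1).toNat) i (by lia)

variable {ℬ : Type*} [Category* ℬ] [Abelian ℬ] [HasDerivedCategory.{w₂} ℬ]
  {G : ℬ ⥤ 𝒜} [G.Additive] [PreservesFiniteLimits G] [PreservesFiniteColimits G]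

theorem isLE_mapDerivedCategory_obj (X : DerivedCategory ℬ) (n : ℤ) [X.IsLE n] :
    (G.mapDerivedCategory.obj X).IsLE n := by
  rw [isLE_iff]
  exact fun i hi => (G.map_isZero (X.isZero_of_isLE n i hi)).of_iso
    (nonempty_homology_mapDerivedCategory_iso G X i).some

theorem isGE_mapDerivedCategory_obj (X : DerivedCategory ℬ) (n : ℤ) [X.IsGE n] :
    (G.mapDerivedCategory.obj X).IsGE n := by
  rw [isGE_iff]
  exact fun i hi => (G.map_isZero (X.isZero_of_isGE n i hi)).of_iso
    (nonempty_homology_mapDerivedCategory_iso G X i).some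

/-- A left adjoint of a t-exact functor is right t-exact, since the upper bound is an orthogonality
condition. -/
theorem isLE_leftAdjoint_obj {LF : DerivedCategory 𝒜 ⥤ DerivedCategory ℬ}
    (adj : LF ⊣ G.mapDerivedCategory) (X : DerivedCategory 𝒜) (n : ℤ) [X.IsLE n] :
    (LF.obj X).IsLE n := by
  refine (TStructure.t.isLE_iff_orthogonal n (n + 1) rfl _).2 ?_
  intro Y f hY
  have := isGE_mapDerivedCategory_obj (G := G) Y (n + 1)
  exact (adj.homEquiv _ _).injective
    ((TStructure.t.zero _ n (n + 1)).trans (TStructure.t.zero _ n (n + 1)).symm)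

theorem isGE_rightAdjoint_obj {RH : DerivedCategory 𝒜 ⥤ DerivedCategory ℬ}
    (adj : G.mapDerivedCategory ⊣ RH) (X : DerivedCategory 𝒜) (n : ℤ) [X.IsGE n] :
    (RH.obj X).IsGE n := by
  refine (TStructure.t.isGE_iff_orthogonal (n - 1) n (by lia) _).2 ?_
  intro Y f hY
  have := isLE_mapDerivedCategory_obj (G := G) Y (n - 1)
  exact (adj.homEquiv _ _).symm.injective
    ((TStructure.t.zero _ (n - 1) n).trans (TStructure.t.zero _ (n - 1) n).symm)

/-- The bounded above part of the image of a localization functor with kernel detected by `E`. -/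
theorem mem_essImage_of_leftPerp {LF : DerivedCategory 𝒜 ⥤ DerivedCategory ℬ}
    (adj : LF ⊣ G.mapDerivedCategory) [LF.Full] [LF.Faithful] {E : ℬ}
    (hE : ∀ n, functorKernel G.mapDerivedCategory ((singleFunctor ℬ n).obj E))
    (hG : ∀ M : ℬ, IsZero (G.obj M) → ¬ IsZero M → ∃ f : M ⟶ E, f ≠ 0)
    {X : DerivedCategory ℬ} (n : ℤ) [hn : X.IsLE n] (hX : leftPerp E X) : LF.essImage X := by
  obtain ⟨Z, p, δ, hT, hZ, hp⟩ := exists_counit_triangle adj X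
  have h1 : leftPerp E Z := leftPerp_iff.2 fun n f =>
    (hp _ (hE n)).1 ((leftPerp_iff.1 hX n _).trans comp_zero.symm)
  have := isLE_mapDerivedCategory_obj (G := G) X n
  have := isLE_leftAdjoint_obj adj (G.mapDerivedCategory.obj X) n
  -- In the rotated triangle `Z` lies between `X` and the shift of `LF G X`, which lives in degrees
  -- at most `n - 1`.
  have h2 : Z.IsLE n := by
    refine TStructure.t.isLE₂ _ (rot_of_distTriang _ hT) n hn ?_
    have : ((LF.obj (G.mapDerivedCategory.obj X))⟦(1 : ℤ)⟧).IsLE (n - 1) :=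
      TStructure.t.isLE_shift _ n 1 (n - 1)
    exact TStructure.t.isLE_of_le ((LF.obj (G.mapDerivedCategory.obj X))⟦(1 : ℤ)⟧) (n - 1) n
  have h3 : IsZero Z := isZero_of_leftPerp_of_isLE h1
    (fun i => hG _ ((isZero_mapDerivedCategory_obj_iff _ _).1 hZ i)) n
  have : IsIso (adj.counit.app X) := (Triangle.isZero₃_iff_isIso₁ _ hT).1 h3
  exact ⟨_, ⟨asIso (adj.counit.app X)⟩⟩

/-- The bounded below part of the image of a colocalization functor with kernel detected by `E`. -/
theorem mem_essImage_of_rightPerp {RH : DerivedCategory 𝒜 ⥤ DerivedCategory ℬ}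
    (adj : G.mapDerivedCategory ⊣ RH) [RH.Full] [RH.Faithful] {E : ℬ}
    (hE : ∀ n, functorKernel G.mapDerivedCategory ((singleFunctor ℬ n).obj E))
    (hG : ∀ M : ℬ, IsZero (G.obj M) → ¬ IsZero M → ∃ f : E ⟶ M, f ≠ 0)
    {X : DerivedCategory ℬ} (n : ℤ) [hn : X.IsGE n] (hX : rightPerp E X) : RH.essImage X := by
  obtain ⟨Z, p, δ, hT, hZ, hp⟩ := exists_unit_triangle adj X
  have h1 : rightPerp E Z := rightPerp_iff.2 fun n f =>
    (hp _ (hE n)).1 ((rightPerp_iff.1 hX n _).trans zero_comp.symm)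
  have := isGE_mapDerivedCategory_obj (G := G) X n
  have := isGE_rightAdjoint_obj adj (G.mapDerivedCategory.obj X) n
  have h2 : Z.IsGE n := by
    refine TStructure.t.isGE₂ _ (inv_rot_of_distTriang _ hT) n ?_ hn
    have : ((RH.obj (G.mapDerivedCategory.obj X))⟦(-1 : ℤ)⟧).IsGE (n + 1) :=
      TStructure.t.isGE_shift _ n (-1) (n + 1)
    exact TStructure.t.isGE_of_ge ((RH.obj (G.mapDerivedCategory.obj X))⟦(-1 : ℤ)⟧) n (n + 1)
  have h3 : IsZero Z := isZero_of_rightPerp_of_isGE h1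
    (fun i => hG _ ((isZero_mapDerivedCategory_obj_iff _ _).1 hZ i)) n
  have : IsIso (adj.unit.app X) := (Triangle.isZero₁_iff_isIso₂ _ hT).1 h3
  exact ⟨_, ⟨(asIso (adj.unit.app X)).symm⟩⟩

end Bounded

section Semisimple

variable {S : Type u} [Ring S] [IsSemisimpleRing S] [HasDerivedCategory.{w₁} (ModuleCat.{u} S)]

/-- Cohomology embeds into the opcycles, whose elements are detected by maps to `S` because `S` is
semisimple; such maps come from the complex in every degree, so no bound is needed. -/
theorem isZero_of_leftPerp_regular {X : DerivedCategory (ModuleCat.{u} S)}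
    (hX : leftPerp (ModuleCat.of S S) X) : IsZero X := by
  let K := DerivedCategory.Q.objPreimage X
  let e : DerivedCategory.Q.obj K ≅ X := DerivedCategory.Q.objObjPreimageIso X
  refine (isZero_iff_homology X).2 fun n => ?_
  refine IsZero.of_iso (?_ : IsZero (K.homology n))
    ((homologyFunctor _ n).mapIso e.symm ≪≫ (homologyFunctorFactors _ n).app K)
  have : Subsingleton (K.homology n) := by
    refine subsingleton_of_forall_eq 0 fun x => ?_
    by_contra hx
    have h1 : K.homologyι n x ≠ 0 := fun h0 => hx
      ((ModuleCat.mono_iff_injective (K.homologyι n)).1 inferInstance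
        (h0.trans (map_zero (K.homologyι n).hom).symm))
    obtain ⟨f, hf⟩ := exists_linearMap_apply_ne_zero (S := S) h1
    have h2 := homologyι_comp_eq_zero (K := K) (n := n) (ModuleCat.ofHom f) fun g => by
      rw [← cancel_epi e.inv, comp_zero]
      exact leftPerp_iff.1 hX n _
    exact hf (ConcreteCategory.congr_hom h2 x)
  exact ModuleCat.isZero_of_subsingleton _

end Semisimple

end NodalOrder

/-! ### The kernels of the two corner functors and their orthogonals -/

namespace NodalOrder.IsNodalOrder

open DerivedCategory

variable {Λ : Type u} [Ring Λ] {A H : Subring Λ} (h : IsNodalOrder A H)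

theorem embA_one_smul_T (t : h.T) : h.embA 1 • t = 0 := by
  obtain ⟨e⟩ := h.nonempty_inflation_iso_T
  have h1 (x : (inflation h.toCoverQuotient).obj (ModuleCat.of h.CoverQuotient h.CoverQuotient)) :
      h.embA 1 • x = 0 := by
    change h.toCoverQuotient (h.embA 1) • (show h.CoverQuotient from x) = 0
    rw [toCoverQuotient_embA, zero_smul]
  have h2 : e.hom (h.embA 1 • e.inv t) = h.embA 1 • e.hom (e.inv t) := map_smul e.hom.hom _ _
  rw [h1] at h2
  have h3 : e.hom (e.inv t) = t := ConcreteCategory.congr_hom e.inv_hom_id t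
  rw [h3] at h2
  exact h2.symm.trans (map_zero e.hom.hom)

theorem isZero_functorG_embA_obj_T :
    IsZero ((functorG h.embA).obj (ModuleCat.of h.auslanderOrder h.T)) := by
  rw [isZero_functorG_obj_iff]
  exact h.embA_one_smul_T

/-- Modules killed by `e` are modules over the semisimple ring `H / C`, whose regular module is `T`.
-/
theorem addClosure_T_iff (M : ModuleCat.{u} h.auslanderOrder) :
    AddClosure h.auslanderOrder h.T M ↔ IsZero ((functorG h.embA).obj M) := by
  rw [isZero_functorG_obj_iff]
  constructor
  · exact fun hM m => hM.smul_eq_zero h.embA_one_smul_T m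
  · intro hM
    obtain ⟨e⟩ := h.nonempty_inflation_iso_T
    exact addClosure_of_forall_smul_eq_zero h.toCoverQuotient_surjective e M
      (fun b hb m => h.smul_eq_zero_of_toCoverQuotient hM b hb m)

section

variable [HasDerivedCategory.{w₁} (ModuleCat.{u} A)]
  [HasDerivedCategory.{w₃} (ModuleCat.{u} h.auslanderOrder)]

/-- The complexes with cohomology in `Add(T)` are those killed by `Hom_B(P, -)`. -/
theorem derivedSupport_T_eq : derivedSupport h.auslanderOrder h.T =
    functorKernel (functorG h.embA).mapDerivedCategory := by
  ext X
  refine Iff.trans (forall_congr' fun n => h.addClosure_T_iff _)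
    (isZero_mapDerivedCategory_obj_iff _ _).symm

theorem functorKernel_single_T (n : ℤ) : functorKernel (functorG h.embA).mapDerivedCategory
    ((singleFunctor _ n).obj (ModuleCat.of h.auslanderOrder h.T)) :=
  ((singleFunctor _ n).map_isZero h.isZero_functorG_embA_obj_T).of_iso
    (((functorG h.embA).mapDerivedCategorySingleFunctor n).app _)

variable {LF RH : DerivedCategory (ModuleCat.{u} A) ⥤
    DerivedCategory (ModuleCat.{u} h.auslanderOrder)}

/-- The bound lets the single module `T` stand for the whole kernel: the cone of the counit is
bounded above, and a nonzero top cohomology, being an `H / C`-module, would map to `T`. -/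
theorem mem_essImage_iff_leftPerp_T (adj : LF ⊣ (functorG h.embA).mapDerivedCategory) [LF.Full]
    [LF.Faithful] (X : DerivedCategory (ModuleCat.{u} h.auslanderOrder)) (n : ℤ) (hX : X.IsLE n) :
    LF.essImage X ↔ leftPerp (ModuleCat.of h.auslanderOrder h.T) X := by
  constructor
  · rw [essImage_eq_leftOrthogonal adj]
    exact fun hX => leftPerp_iff.2 fun n f => hX f (h.functorKernel_single_T n)
  · refine mem_essImage_of_leftPerp adj h.functorKernel_single_T (fun M hM hM' => ?_) n
    obtain ⟨e⟩ := h.nonempty_inflation_iso_T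
    rw [isZero_functorG_obj_iff] at hM
    exact exists_hom_from_ne_zero h.toCoverQuotient_surjective e M
      (fun b hb m => h.smul_eq_zero_of_toCoverQuotient hM b hb m) hM'

theorem mem_essImage_iff_rightPerp_T (adj : (functorG h.embA).mapDerivedCategory ⊣ RH) [RH.Full]
    [RH.Faithful] (X : DerivedCategory (ModuleCat.{u} h.auslanderOrder)) (n : ℤ) (hX : X.IsGE n) :
    RH.essImage X ↔ rightPerp (ModuleCat.of h.auslanderOrder h.T) X := by
  constructor
  · rw [essImage_eq_rightOrthogonal adj]
    exact fun hX => rightPerp_iff.2 fun n f => hX f (h.functorKernel_single_T n)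
  · refine mem_essImage_of_rightPerp adj h.functorKernel_single_T (fun M hM hM' => ?_) n
    obtain ⟨e⟩ := h.nonempty_inflation_iso_T
    rw [isZero_functorG_obj_iff] at hM
    exact exists_hom_to_ne_zero h.toCoverQuotient_surjective e M
      (fun b hb m => h.smul_eq_zero_of_toCoverQuotient hM b hb m) hM'

theorem exists_isRecollement_derivedSupport (adj₁ : LF ⊣ (functorG h.embA).mapDerivedCategory)
    (adj₂ : (functorG h.embA).mapDerivedCategory ⊣ RH) [LF.Full] [LF.Faithful] [RH.Full]
    [RH.Faithful] :
    ∃ (_ : (derivedSupport h.auslanderOrder h.T).IsTriangulated)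
      (JL JR : DerivedCategory (ModuleCat.{u} h.auslanderOrder) ⥤
        (derivedSupport h.auslanderOrder h.T).FullSubcategory),
      IsRecollement (derivedSupport h.auslanderOrder h.T).ι JL JR
        (functorG h.embA).mapDerivedCategory LF RH := by
  rw [h.derivedSupport_T_eq]
  refine ⟨inferInstance, exists_isRecollement _ ?_ adj₁ adj₂⟩
  ext X
  constructor
  · rintro ⟨Y, ⟨e⟩⟩
    exact ObjectProperty.prop_of_iso _ e Y.2
  · exact fun hX => ⟨⟨X, hX⟩, ⟨Iso.refl _⟩⟩

end

section

variable [HasDerivedCategory.{w₂} (ModuleCat.{u} H)]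
  [HasDerivedCategory.{w₃} (ModuleCat.{u} h.auslanderOrder)]
  [HasDerivedCategory.{w₄} (ModuleCat.{u} h.QuotientRing)]

omit [HasDerivedCategory.{w₂} (ModuleCat.{u} H)] in
theorem nonempty_inflation_single_iso (n : ℤ) :
    Nonempty ((inflation h.toQuotientRing).mapDerivedCategory.obj
          ((singleFunctor _ n).obj (ModuleCat.of h.QuotientRing h.QuotientRing)) ≅
        (singleFunctor _ n).obj (ModuleCat.of h.auslanderOrder h.S)) := by
  obtain ⟨e⟩ := h.nonempty_inflation_iso_S
  exact ⟨((inflation h.toQuotientRing).mapDerivedCategorySingleFunctor n).app _ ≪≫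
    (singleFunctor _ n).mapIso e⟩

omit [HasDerivedCategory.{w₄} (ModuleCat.{u} h.QuotientRing)] in
theorem functorKernel_single_S (n : ℤ) : functorKernel (functorG h.embH).mapDerivedCategory
    ((singleFunctor _ n).obj (ModuleCat.of h.auslanderOrder h.S)) := by
  obtain ⟨e⟩ := h.nonempty_inflation_iso_S
  exact ((singleFunctor _ n).map_isZero ((h.isZero_functorG_embH_obj_inflation _).of_iso
      ((functorG h.embH).mapIso e.symm))).of_iso
    (((functorG h.embH).mapDerivedCategorySingleFunctor n).app _)

variable {LF RH : DerivedCategory (ModuleCat.{u} H) ⥤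
    DerivedCategory (ModuleCat.{u} h.auslanderOrder)}

/-- The cone of the counit comes from `D(A / C)` and is still left orthogonal to the regular module;
as `A / C` is semisimple, it vanishes. -/
theorem essImage_eq_leftPerp_S (adj : LF ⊣ (functorG h.embH).mapDerivedCategory) [LF.Full]
    [LF.Faithful] : LF.essImage = leftPerp (ModuleCat.of h.auslanderOrder h.S) := by
  rw [essImage_eq_leftOrthogonal adj]
  ext X
  constructor
  · exact fun hX => leftPerp_iff.2 fun n f => hX f (h.functorKernel_single_S n)
  · intro hX Y f hY
    obtain ⟨_, _, hI⟩ := h.inflation_mapDerivedCategory_full_faithful_essImage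
    obtain ⟨Z, p, δ, hT, hZ, hp⟩ := exists_counit_triangle adj X
    obtain ⟨f, rfl⟩ := (hp Y hY).2 f
    have hZ' := hZ
    rw [← hI] at hZ'
    obtain ⟨W, ⟨e⟩⟩ := hZ'
    have hW : IsZero W := isZero_of_leftPerp_regular (leftPerp_iff.2 fun n f => by
      obtain ⟨ε⟩ := h.nonempty_inflation_single_iso n
      apply (inflation h.toQuotientRing).mapDerivedCategory.map_injective
      rw [Functor.map_zero, ← cancel_mono ε.hom, ← cancel_epi e.inv]
      refine (hp _ (h.functorKernel_single_S n)).1 ?_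
      exact (leftPerp_iff.1 hX n _).trans (leftPerp_iff.1 hX n _).symm)
    have : IsZero Z := (Functor.map_isZero _ hW).of_iso e.symm
    dsimp only
    rw [this.eq_of_src f 0, comp_zero]

/-- Here the vanishing in `D(A / C)` comes from generation by the regular module, which holds over
any ring. -/
theorem essImage_eq_rightPerp_S (adj : (functorG h.embH).mapDerivedCategory ⊣ RH) [RH.Full]
    [RH.Faithful] : RH.essImage = rightPerp (ModuleCat.of h.auslanderOrder h.S) := by
  rw [essImage_eq_rightOrthogonal adj]
  ext X
  constructor
  · exact fun hX => rightPerp_iff.2 fun n f => hX f (h.functorKernel_single_S n)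
  · intro hX Y f hY
    obtain ⟨_, _, hI⟩ := h.inflation_mapDerivedCategory_full_faithful_essImage
    obtain ⟨Z, p, δ, hT, hZ, hp⟩ := exists_unit_triangle adj X
    obtain ⟨f, rfl⟩ := (hp Y hY).2 f
    have hZ' := hZ
    rw [← hI] at hZ'
    obtain ⟨W, ⟨e⟩⟩ := hZ'
    have hW : IsZero W := isZero_of_forall_single_regular _ fun n f => by
      obtain ⟨ε⟩ := h.nonempty_inflation_single_iso n
      apply (inflation h.toQuotientRing).mapDerivedCategory.map_injective
      rw [Functor.map_zero, ← cancel_mono e.hom, ← cancel_epi ε.inv]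
      refine (hp _ (h.functorKernel_single_S n)).1 ?_
      exact (rightPerp_iff.1 hX n _).trans (rightPerp_iff.1 hX n _).symm
    have : IsZero Z := (Functor.map_isZero _ hW).of_iso e.symm
    dsimp only
    rw [this.eq_of_tgt f 0, zero_comp]

end

end NodalOrder.IsNodalOrder

/-! ### Projective dimension under localization and passage to a corner -/

namespace NodalOrder

section Dimension

variable {S : Type u} [Ring S]

theorem globalDimension_le_iff (n : ℕ) :
    globalDimension S ≤ n ↔ ∀ M : ModuleCat.{u} S, HasProjectiveDimensionLT M (n + 1) :=
  iSup_le_iff.trans (forall_congr' fun M => projectiveDimension_le_iff M n)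

theorem hasProjectiveDimensionLT_of_globalDimension_lt {n : ℕ} (h : globalDimension S < n)
    (M : ModuleCat.{u} S) : HasProjectiveDimensionLT M n :=
  projectiveDimension_lt_iff.1 ((le_iSup projectiveDimension M).trans_lt h)

/-- Subobjects of projective objects are projective in global dimension one. -/
theorem projective_of_mono_of_projective {𝒜 : Type*} [Category* 𝒜] [Abelian 𝒜]
    (h : ∀ M : 𝒜, HasProjectiveDimensionLT M 2) {K Y : 𝒜} (i : K ⟶ Y) [Mono i]
    [hY : Projective Y] : Projective K := by
  let T := ShortComplex.mk i (cokernel.π i) (cokernel.condition i)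
  have hT : T.ShortExact :=
    { exact := ShortComplex.exact_of_g_is_cokernel _ (cokernelIsCokernel i) }
  rw [projective_iff_hasProjectiveDimensionLT_one]
  exact (hT.hasProjectiveDimensionLT_X₃_iff 0 hY).1 (h _)

theorem exists_mul_eq_one_of_sub_one_mem_jacobson {x : S} (hx : x - 1 ∈ Ring.jacobson S) :
    ∃ z, z * x = 1 ∧ x * z = 1 := by
  have key (x : S) (hx : x - 1 ∈ Ring.jacobson S) : ∃ z, z * x = 1 := by
    rw [← Ideal.jacobson_bot, Ideal.mem_jacobson_iff] at hx
    obtain ⟨z, hz⟩ := hx 1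
    refine ⟨z, sub_eq_zero.1 ?_⟩
    rw [Ideal.mem_bot] at hz
    rw [← hz]
    noncomm_ring
  obtain ⟨z, hz⟩ := key x hx
  obtain ⟨w, hw⟩ := key z (by
    have : z - 1 = -(z * (x - 1)) := by rw [mul_sub, hz, mul_one, neg_sub]
    rw [this]
    exact neg_mem (Ideal.mul_mem_left _ z hx))
  have : x = w := by rw [← one_mul x, ← hw, mul_assoc, hz, mul_one]
  exact ⟨z, hz, this ▸ hw⟩

/-- `S / rad S` is projective, so the quotient map splits. The section sends `1` to an element
congruent to `1` modulo the radical, hence a unit, which the radical annihilates. -/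
theorem jacobson_eq_bot_of_globalDimension_lt_one (h : globalDimension S < 1) :
    Ring.jacobson S = ⊥ := by
  have hproj : Module.Projective S (S ⧸ Ring.jacobson S) :=
    (IsProjective.iff_projective _).2 ((projective_iff_hasProjectiveDimensionLT_one).2
      (hasProjectiveDimensionLT_of_globalDimension_lt (n := 1) h
        (ModuleCat.of S (S ⧸ Ring.jacobson S))))
  obtain ⟨s, hs⟩ := Module.projective_lifting_property (Submodule.mkQ (Ring.jacobson S))
    LinearMap.id (Submodule.mkQ_surjective _)
  let v : S := s (Submodule.mkQ _ 1)
  have hv (x : S) (hx : x ∈ Ring.jacobson S) : x * v = 0 := by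
    have h0 : x • Submodule.mkQ (Ring.jacobson S) 1 = 0 :=
      (Submodule.Quotient.mk_eq_zero _).2 (by simpa using hx)
    exact (map_smul s x _).symm.trans ((congrArg s h0).trans (map_zero s))
  have hv' : v - 1 ∈ Ring.jacobson S :=
    (Submodule.Quotient.eq _).1 (DFunLike.congr_fun hs (Submodule.mkQ _ 1))
  obtain ⟨z, -, hz⟩ := exists_mul_eq_one_of_sub_one_mem_jacobson hv'
  refine (Submodule.eq_bot_iff _).2 fun x hx => ?_
  rw [← mul_one x, ← hz, ← mul_assoc, hv x hx, zero_mul]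

end Dimension

section Adjunction

variable {𝒜 ℬ : Type*} [Category* 𝒜] [Abelian 𝒜] [Category* ℬ] [Abelian ℬ]

/-- Kernel and cokernel of `c` are killed by `G`; the two short exact sequences through the image of
`c` then bound `Y`. -/
theorem hasProjectiveDimensionLT_of_isIso_map (G : ℬ ⥤ 𝒜) [PreservesFiniteLimits G]
    [PreservesFiniteColimits G] {X Y : ℬ} (c : X ⟶ Y) [IsIso (G.map c)]
    (hG : ∀ M, IsZero (G.obj M) → HasProjectiveDimensionLT M 2)
    (hX : HasProjectiveDimensionLT X 2) : HasProjectiveDimensionLT Y 3 := by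
  have : G.PreservesZeroMorphisms := (G.preservesZeroMorphisms_of_preserves_terminal_object)
  let e := Abelian.factorThruImage c
  let m := Abelian.image.ι c
  have hem : G.map e ≫ G.map m = G.map c := by
    rw [← Functor.map_comp, Abelian.image.fac]
  have h1 : HasProjectiveDimensionLT (kernel e) 2 := by
    refine hG _ (IsZero.of_mono_eq_zero (G.map (kernel.ι e)) ?_)
    rw [← cancel_mono (G.map c), ← hem, ← Category.assoc, ← Functor.map_comp, kernel.condition,
      Functor.map_zero, zero_comp, zero_comp]
  have h2 : HasProjectiveDimensionLT (cokernel m) 2 := by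
    refine hG _ (IsZero.of_epi_eq_zero (G.map (cokernel.π m)) ?_)
    rw [← cancel_epi (G.map c), ← hem, Category.assoc, ← Functor.map_comp, cokernel.condition,
      Functor.map_zero, comp_zero, comp_zero]
  let T₁ := ShortComplex.mk (kernel.ι e) e (kernel.condition e)
  have hT₁ : T₁.ShortExact := { exact := ShortComplex.exact_of_f_is_kernel _ (kernelIsKernel _) }
  let T₂ := ShortComplex.mk m (cokernel.π m) (cokernel.condition m)
  have hT₂ : T₂.ShortExact :=
    { exact := ShortComplex.exact_of_g_is_cokernel _ (cokernelIsCokernel m) }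
  have h4 : HasProjectiveDimensionLT T₂.X₁ 3 := hT₁.hasProjectiveDimensionLT_X₃ 2 h1
    (hasProjectiveDimensionLT_of_ge _ 2 3 (by lia))
  exact hT₂.hasProjectiveDimensionLT_X₂ 3 h4 (hasProjectiveDimensionLT_of_ge _ 2 3 (by lia))

variable {F : 𝒜 ⥤ ℬ} {G : ℬ ⥤ 𝒜} (adj : F ⊣ G) [IsIso adj.unit]

omit [Abelian 𝒜] [Abelian ℬ] in
theorem isIso_map_counit (N : ℬ) : IsIso (G.map (adj.counit.app N)) := by
  have h1 := adj.right_triangle_components N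
  have : IsIso (adj.unit.app (G.obj N) ≫ G.map (adj.counit.app N)) := by
    rw [h1]
    exact IsIso.id (G.obj N)
  exact IsIso.of_isIso_comp_left (adj.unit.app (G.obj N)) _

include adj in
-- The syzygy `K ⊆ P₀` of `N` is projective: the image of `F K → F P₀` is projective as a subobject
-- of a projective, and a retract of `F P₁` for a projective `P₁` onto `K`. Applying `G`, which
-- undoes `F`, gives a retract of `P₁`; it is `K`, since `G` is exact and turns `F K → F P₀` back
-- into `K → P₀`.
theorem hasProjectiveDimensionLT_two_of_adjunction [EnoughProjectives 𝒜] [PreservesFiniteLimits G]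
    [PreservesFiniteColimits G] (hℬ : ∀ M : ℬ, HasProjectiveDimensionLT M 2) (N : 𝒜) :
    HasProjectiveDimensionLT N 2 := by
  let π := Projective.π N
  let K := kernel π
  let k : K ⟶ Projective.over N := kernel.ι π
  let T := ShortComplex.mk k π (kernel.condition π)
  have hT : T.ShortExact := { exact := ShortComplex.exact_of_f_is_kernel _ (kernelIsKernel _) }
  let e := Abelian.factorThruImage (F.map k)
  let m := Abelian.image.ι (F.map k)
  have : Projective (F.obj (Projective.over N)) := adj.map_projective _ inferInstance
  have hM : Projective (Abelian.image (F.map k)) := projective_of_mono_of_projective hℬ m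
  have : F.PreservesEpimorphisms := Functor.preservesEpimorphisms_of_adjunction adj
  let q : F.obj (Projective.over K) ⟶ Abelian.image (F.map k) := F.map (Projective.π K) ≫ e
  let r : Retract (Abelian.image (F.map k)) (F.obj (Projective.over K)) :=
    { i := Projective.factorThru (𝟙 _) q
      r := q
      retract := Projective.factorThru_comp _ _ }
  have hGM : Projective (G.obj (Abelian.image (F.map k))) :=
    ((r.map G).trans (Retract.ofIso (asIso (adj.unit.app (Projective.over K))).symm)).projective
  have hem : adj.unit.app K ≫ G.map e ≫ G.map m = k ≫ adj.unit.app _ := by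
    rw [← Functor.map_comp, Abelian.image.fac]
    exact (adj.unit.naturality k).symm
  have : Mono (adj.unit.app K ≫ G.map e) := by
    have : Mono ((adj.unit.app K ≫ G.map e) ≫ G.map m) := by
      rw [Category.assoc, hem]
      exact mono_comp k (adj.unit.app (Projective.over N))
    exact mono_of_mono _ (G.map m)
  have : IsIso (adj.unit.app K ≫ G.map e) := isIso_of_mono_of_epi _
  have hK : Projective T.X₁ := Projective.of_iso (asIso (adj.unit.app K ≫ G.map e)).symm hGM
  exact (hT.hasProjectiveDimensionLT_X₃_iff 0 (Projective.projective_over N)).2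
    (projective_iff_hasProjectiveDimensionLT_one.1 hK)

end Adjunction

end NodalOrder

/-! ### The global dimension of the Auslander order -/

namespace NodalOrder.IsNodalOrder

variable {Λ : Type u} [Ring Λ] {A H : Subring Λ} (h : IsNodalOrder A H)

include h in
theorem hasProjectiveDimensionLT_cover (M : ModuleCat.{u} H) : HasProjectiveDimensionLT M 2 :=
  (globalDimension_le_iff 1).1 h.hereditary.le M

theorem projective_functorF {T B : Type u} [Ring T] [Ring B] (φ : T →ₙ+* B)
    (Y : ModuleCat.{u} T) [hY : Projective Y] : Projective ((functorF φ).obj Y) :=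
  (adjunctionFG φ).map_projective Y hY

/-- `Q ⊗_H -` is exact and preserves projectives, so it preserves resolutions of length one. -/
theorem hasProjectiveDimensionLT_functorF_embH (M : ModuleCat.{u} H) :
    HasProjectiveDimensionLT ((functorF h.embH).obj M) 2 := by
  let T := ShortComplex.mk (kernel.ι (Projective.π M)) (Projective.π M) (kernel.condition _)
  have hT : T.ShortExact :=
    { exact := ShortComplex.exact_of_f_is_kernel _ (kernelIsKernel _) }
  have : Projective T.X₁ :=
    projective_of_mono_of_projective h.hasProjectiveDimensionLT_cover (kernel.ι (Projective.π M))
  exact (h.functorF_embH_map_shortExact T hT).hasProjectiveDimensionLT_X₃ 1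
    (projective_iff_hasProjectiveDimensionLT_one |>.1 (projective_functorF h.embH T.X₁))
    (have : Projective T.X₂ := Projective.projective_over M
     have : Projective ((functorF h.embH).obj T.X₂) := projective_functorF h.embH T.X₂
     inferInstanceAs (HasProjectiveDimensionLT ((functorF h.embH).obj T.X₂) 2))

/-- The second row of an element of the Auslander order. -/
def secondRow : h.auslanderOrder →+ H × H :=
  AddMonoidHom.mk' (fun b => (⟨b.1 1 0, h.le b.2.2.2.1.1⟩, ⟨b.1 1 1, b.2.2.2.2⟩)) fun _ _ => rfl

theorem secondRow_embH_mul (t : H) (b : h.auslanderOrder) :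
    h.secondRow (h.embH t * b) = t • h.secondRow b := by
  refine Prod.ext (Subtype.ext ?_) (Subtype.ext ?_)
  · change ((h.embH t).1 * b.1) 1 0 = t * b.1 1 0
    simp [embH_eq_mat, mat, Matrix.mul_apply]
  · change ((h.embH t).1 * b.1) 1 1 = t * b.1 1 1
    simp [embH_eq_mat, mat, Matrix.mul_apply]

theorem eq_zero_of_secondRow_eq_zero (b : h.auslanderOrder) (hb : h.secondRow b = 0)
    (hb' : h.embH 1 * b = b) : b = 0 := by
  obtain ⟨a, x, c, y, rfl⟩ := h.exists_eq_mat b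
  have h1 : (c : Λ) = 0 := congrArg (fun p => (p.1 : Λ)) hb
  have h2 : (y : Λ) = 0 := congrArg (fun p => (p.2 : Λ)) hb
  rw [← hb', embH_one_mul_mat]
  refine Subtype.ext ?_
  ext i j
  fin_cases i <;> fin_cases j <;> simp [mat, h1, h2]

/-- The second row embeds `f B` into `H × H`, so `f` of a free `B`-module is a submodule of a free
module over the hereditary ring `H`. -/
theorem projective_functorG_embH_obj_finsupp (ι : Type u) :
    Projective ((functorG h.embH).obj (ModuleCat.of h.auslanderOrder (ι →₀ h.auslanderOrder))) := by
  let E := ModuleCat.of h.auslanderOrder (ι →₀ h.auslanderOrder)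
  let g : BimoduleHom h.auslanderOrder h.Q E →ₗ[H] (ι →₀ H × H) :=
    { toFun := fun f => Finsupp.mapRange.addMonoidHom h.secondRow (f (Column.gen h.embH))
      map_add' := fun f f' => map_add (Finsupp.mapRange.addMonoidHom h.secondRow) _ _
      map_smul' := fun t f => by
        refine Finsupp.ext fun i => ?_
        have h1 : f (MulOpposite.op t • Column.gen h.embH) = h.embH t • f (Column.gen h.embH) := by
          rw [BimoduleHom.column_apply h.embH f]
          refine congrArg (· • f (Column.gen h.embH)) ?_
          change h.embH 1 * h.embH t = h.embH t
          rw [← map_mul, one_mul]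
        exact (congrArg (fun z : E => h.secondRow (z i)) h1).trans
          (h.secondRow_embH_mul t (f (Column.gen h.embH) i)) }
  have hg : Function.Injective g := by
    refine (injective_iff_map_eq_zero g).2 fun f hf => BimoduleHom.ext fun p => ?_
    have h1 : f (Column.gen h.embH) = (0 : E) := Finsupp.ext fun i =>
      h.eq_zero_of_secondRow_eq_zero _ (DFunLike.congr_fun hf i)
        (DFunLike.congr_fun (BimoduleHom.map_one_smul_gen h.embH f) i)
    exact (BimoduleHom.column_apply h.embH f p).trans (by rw [h1, smul_zero]; rfl)
  let g' : (functorG h.embH).obj E ⟶ ModuleCat.of H (ι →₀ H × H) := ModuleCat.ofHom g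
  have : Mono g' := (ModuleCat.mono_iff_injective _).2 hg
  have : Projective (ModuleCat.of H (ι →₀ H × H)) := (IsProjective.iff_projective _).1 inferInstance
  exact projective_of_mono_of_projective h.hasProjectiveDimensionLT_cover g'

/-- `B`-modules killed by `f` have projective dimension at most one. -/
theorem hasProjectiveDimensionLT_of_isZero_functorG (M : ModuleCat.{u} h.auslanderOrder)
    (hM : IsZero ((functorG h.embH).obj M)) : HasProjectiveDimensionLT M 2 := by
  rw [isZero_functorG_obj_iff] at hM
  obtain ⟨N, ⟨e⟩⟩ := exists_inflation_iso h.toQuotientRing_surjective M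
    (fun b hb m => h.smul_eq_zero_of_toQuotientRing hM b hb m)
  obtain ⟨F, adj, _, hadj⟩ := exists_inflation_leftAdjoint h.toQuotientRing_surjective
  let E := ModuleCat.of h.auslanderOrder (M →₀ h.auslanderOrder)
  -- For `E` free, `0 → B f ⊗ f E → E → E / B f E → 0` is a projective resolution of the quotient.
  obtain ⟨zero, hS⟩ := h.exists_counit_unit_shortExact E adj hadj (fun y hy hy' =>
    Finsupp.ext fun i => h.eq_zero_of_matE_mul_eq_zero (y i) (DFunLike.congr_fun hy i)
      (DFunLike.congr_fun hy' i))
  have hE : Projective E := (IsProjective.iff_projective _).1 inferInstance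
  have := h.projective_functorG_embH_obj_finsupp M
  have : Projective ((functorF h.embH).obj ((functorG h.embH).obj E)) := projective_functorF _ _
  have h1 : HasProjectiveDimensionLT ((inflation h.toQuotientRing).obj (F.obj E)) 2 :=
    (hS.hasProjectiveDimensionLT_X₃_iff 0 hE).2
      ((projective_iff_hasProjectiveDimensionLT_one).1 this)
  let p : E ⟶ M := ModuleCat.ofHom (Finsupp.linearCombination h.auslanderOrder (id : M → M))
  have : Epi p := (ModuleCat.epi_iff_surjective _).2 (Finsupp.linearCombination_id_surjective _ _)
  let q : F.obj E ⟶ N := (adj.homEquiv _ _).symm (p ≫ e.inv)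
  have hq : adj.unit.app E ≫ (inflation h.toQuotientRing).map q = p ≫ e.inv := by
    exact (adj.homEquiv_unit _ _ _).symm.trans ((adj.homEquiv E N).apply_symm_apply _)
  have : Epi ((inflation h.toQuotientRing).map q) := by
    have : Epi (adj.unit.app E ≫ (inflation h.toQuotientRing).map q) := by
      rw [hq]
      infer_instance
    exact epi_of_epi (adj.unit.app E) _
  have hqs : Function.Surjective q :=
    (ModuleCat.epi_iff_surjective ((inflation h.toQuotientRing).map q)).1 this
  have : Epi q := (ModuleCat.epi_iff_surjective _).2 hqs
  have : Module.Projective h.QuotientRing N := Module.projective_of_isSemisimpleRing _ _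
  have : Projective N := (IsProjective.iff_projective _).1 this
  -- Over the semisimple ring `A / C` the module `N` is projective, hence a summand of `E / B f E`.
  have r : Retract N (F.obj E) :=
    { i := Projective.factorThru (𝟙 N) q
      r := q
      retract := Projective.factorThru_comp _ _ }
  have h2 := (r.map (inflation h.toQuotientRing)).hasProjectiveDimensionLT 2
  exact hasProjectiveDimensionLT_of_iso e 2

/-- The counit `B f ⊗ f N → N` becomes invertible under `f`, so its kernel and cokernel have
projective dimension at most one, as does its source. -/
theorem hasProjectiveDimensionLT_auslanderOrder (N : ModuleCat.{u} h.auslanderOrder) :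
    HasProjectiveDimensionLT N 3 := by
  have : IsIso ((functorG h.embH).map ((adjunctionFG h.embH).counit.app N)) :=
    isIso_map_counit (adjunctionFG h.embH) N
  exact hasProjectiveDimensionLT_of_isIso_map (functorG h.embH)
    ((adjunctionFG h.embH).counit.app N) h.hasProjectiveDimensionLT_of_isZero_functorG
    (h.hasProjectiveDimensionLT_functorF_embH _)

theorem globalDimension_auslanderOrder_le : globalDimension h.auslanderOrder ≤ 2 :=
  (globalDimension_le_iff 2).2 h.hasProjectiveDimensionLT_auslanderOrder

include h in
-- Otherwise `rad A`, and with it `rad H`, vanishes; then `H` is semisimple, against its global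
-- dimension being one.
theorem not_globalDimension_lt_one : ¬ globalDimension A < 1 := by
  intro hA
  have h1 := jacobson_eq_bot_of_globalDimension_lt_one hA
  have h2 : Ring.jacobson H = ⊥ := by
    refine (Submodule.eq_bot_iff _).2 fun x hx => ?_
    obtain ⟨hxA, hx'⟩ := (h.radical x).2 ⟨x.2, hx⟩
    rw [h1] at hx'
    exact Subtype.ext (congrArg (Subtype.val : A → Λ) hx')
  have := h.isSemisimpleRing_cover_quotient_jacobson
  have hinj : Function.Injective (Ideal.Quotient.mk (Ring.jacobson H)) := by
    refine (injective_iff_map_eq_zero _).2 fun x hx => ?_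
    rw [Ideal.Quotient.eq_zero_iff_mem, h2] at hx
    exact hx
  have : IsSemisimpleRing H := (RingEquiv.ofBijective _
    ⟨hinj, Ideal.Quotient.mk_surjective (I := Ring.jacobson H)⟩).symm.isSemisimpleRing
  have h3 : globalDimension H ≤ (0 : ℕ) := (globalDimension_le_iff 0).2 fun M =>
    (projective_iff_hasProjectiveDimensionLT_one).1 ((IsProjective.iff_projective _).1
      (Module.projective_of_isSemisimpleRing H M))
  rw [h.hereditary] at h3
  exact absurd h3 (by decide)

/-- Global dimension at most one would descend from `B` to its corner `A`, and values below one are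
excluded for `A`. -/
theorem globalDimension_auslanderOrder_eq (hA : globalDimension A ≠ 1) :
    globalDimension h.auslanderOrder = 2 := by
  by_contra hB
  have h1 : globalDimension h.auslanderOrder < (2 : ℕ) :=
    lt_of_le_of_ne h.globalDimension_auslanderOrder_le hB
  have h2 : globalDimension A ≤ (1 : ℕ) := (globalDimension_le_iff 1).2
    (hasProjectiveDimensionLT_two_of_adjunction (adjunctionFG h.embA) (hasProjectiveDimensionLT_of_globalDimension_lt h1))
  exact h.not_globalDimension_lt_one (lt_of_le_of_ne h2 hA)

end NodalOrder.IsNodalOrder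

/-! ### The main theorem -/

theorem mainTheorem5 {Λ : Type u} [Ring Λ] {A H : Subring Λ}
    (h : NodalOrder.IsNodalOrder A H)
    [HasDerivedCategory.{w₁} (ModuleCat.{u} A)]
    [HasDerivedCategory.{w₂} (ModuleCat.{u} H)]
    [HasDerivedCategory.{w₃} (ModuleCat.{u} h.auslanderOrder)]
    [HasDerivedCategory.{w₄} (ModuleCat.{u} h.QuotientRing)] :
    (∃ (LF RH : DerivedCategory (ModuleCat.{u} A) ⥤
          DerivedCategory (ModuleCat.{u} h.auslanderOrder))
        (LF' RH' : DerivedCategory (ModuleCat.{u} H) ⥤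
          DerivedCategory (ModuleCat.{u} h.auslanderOrder)),
      -- the derived functors of `F = P ⊗_A -`, `H = Hom_A(P^∨, -)` and
      -- `F' = Q ⊗_H -`, `H' = Hom_H(Q^∨, -)`
      NodalOrder.IsTotalLeftDerived (NodalOrder.functorF h.embA) LF ∧
      NodalOrder.IsTotalRightDerived (NodalOrder.functorH h.embA) RH ∧
      NodalOrder.IsTotalLeftDerived (NodalOrder.functorF h.embH) LF' ∧
      NodalOrder.IsTotalRightDerived (NodalOrder.functorH h.embH) RH' ∧
      -- adjoint triples
      (Nonempty (LF ⊣ (NodalOrder.functorG h.embA).mapDerivedCategory) ∧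
        Nonempty ((NodalOrder.functorG h.embA).mapDerivedCategory ⊣ RH)) ∧
      (Nonempty (LF' ⊣ (NodalOrder.functorG h.embH).mapDerivedCategory) ∧
        Nonempty ((NodalOrder.functorG h.embH).mapDerivedCategory ⊣ RH')) ∧
      -- the outer functors are fully faithful, the middle ones essentially surjective
      (LF.Full ∧ LF.Faithful) ∧ (LF'.Full ∧ LF'.Faithful) ∧
      (RH.Full ∧ RH.Faithful) ∧ (RH'.Full ∧ RH'.Faithful) ∧
      (NodalOrder.functorG h.embA).mapDerivedCategory.EssSurj ∧
      (NodalOrder.functorG h.embH).mapDerivedCategory.EssSurj ∧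
      -- essential images of `LF'` and `RH'`
      LF'.essImage = NodalOrder.leftPerp (ModuleCat.of h.auslanderOrder h.S) ∧
      RH'.essImage = NodalOrder.rightPerp (ModuleCat.of h.auslanderOrder h.S) ∧
      -- essential images of `LF` and `RH`
      LF.essImage = (NodalOrder.derivedSupport h.auslanderOrder h.T).leftOrthogonal ∧
      RH.essImage = (NodalOrder.derivedSupport h.auslanderOrder h.T).rightOrthogonal ∧
      (∀ (X : DerivedCategory (ModuleCat.{u} h.auslanderOrder)) (n : ℤ), X.IsLE n →
        (LF.essImage X ↔ NodalOrder.leftPerp (ModuleCat.of h.auslanderOrder h.T) X)) ∧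
      (∀ (X : DerivedCategory (ModuleCat.{u} h.auslanderOrder)) (n : ℤ), X.IsGE n →
        (RH.essImage X ↔ NodalOrder.rightPerp (ModuleCat.of h.auslanderOrder h.T) X)) ∧
      -- the recollement of `D(B)` by `D(A / C)` and `D(H)`, which sends `A / C` to `S`
      (∃ IL IR : DerivedCategory (ModuleCat.{u} h.auslanderOrder) ⥤
          DerivedCategory (ModuleCat.{u} h.QuotientRing),
        NodalOrder.IsRecollement (NodalOrder.inflation h.toQuotientRing).mapDerivedCategory IL IR
          (NodalOrder.functorG h.embH).mapDerivedCategory LF' RH') ∧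
      Nonempty ((NodalOrder.inflation h.toQuotientRing).mapDerivedCategory.obj
          ((DerivedCategory.singleFunctor _ 0).obj (ModuleCat.of h.QuotientRing h.QuotientRing)) ≅
        (DerivedCategory.singleFunctor _ 0).obj (ModuleCat.of h.auslanderOrder h.S)) ∧
      -- the recollement of `D(B)` by `D_T(B)` and `D(A)`
      (∃ (_ : (NodalOrder.derivedSupport h.auslanderOrder h.T).IsTriangulated)
          (JL JR : DerivedCategory (ModuleCat.{u} h.auslanderOrder) ⥤
            (NodalOrder.derivedSupport h.auslanderOrder h.T).FullSubcategory),
        NodalOrder.IsRecollement (NodalOrder.derivedSupport h.auslanderOrder h.T).ι JL JR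
          (NodalOrder.functorG h.embA).mapDerivedCategory LF RH)) ∧
    -- the global dimension of `B`
    NodalOrder.globalDimension h.auslanderOrder ≤ 2 ∧
    (NodalOrder.globalDimension A ≠ 1 → NodalOrder.globalDimension h.auslanderOrder = 2) := by
  obtain ⟨LF, RH, hLF, hRH, ⟨adjL⟩, ⟨adjR⟩, hLF', hRH', hG⟩ := NodalOrder.exists_derived_triple
    (NodalOrder.adjunctionFG h.embA) (NodalOrder.adjunctionGH h.embA)
    CochainComplex.exists_isKProjective CochainComplex.exists_isKInjective
  obtain ⟨LF₂, RH₂, hLF₂, hRH₂, ⟨adjL₂⟩, ⟨adjR₂⟩, hLF₂', hRH₂', hG₂⟩ :=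
    NodalOrder.exists_derived_triple
      (NodalOrder.adjunctionFG h.embH) (NodalOrder.adjunctionGH h.embH)
      CochainComplex.exists_isKProjective CochainComplex.exists_isKInjective
  obtain ⟨_, _, hI⟩ := h.inflation_mapDerivedCategory_full_faithful_essImage
  have := hLF'.1
  have := hLF'.2
  have := hRH'.1
  have := hRH'.2
  have := hLF₂'.1
  have := hLF₂'.2
  have := hRH₂'.1
  have := hRH₂'.2
  refine ⟨⟨LF, RH, LF₂, RH₂, hLF, hRH, hLF₂, hRH₂, ⟨⟨adjL⟩, ⟨adjR⟩⟩, ⟨⟨adjL₂⟩, ⟨adjR₂⟩⟩,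
    hLF', hLF₂', hRH', hRH₂', hG, hG₂, h.essImage_eq_leftPerp_S adjL₂,
    h.essImage_eq_rightPerp_S adjR₂, ?_, ?_, h.mem_essImage_iff_leftPerp_T adjL,
    h.mem_essImage_iff_rightPerp_T adjR, NodalOrder.exists_isRecollement _ hI adjL₂ adjR₂,
    h.nonempty_inflation_single_iso 0, h.exists_isRecollement_derivedSupport adjL adjR⟩,
    h.globalDimension_auslanderOrder_le, h.globalDimension_auslanderOrder_eq⟩
  · rw [h.derivedSupport_T_eq]
    exact NodalOrder.essImage_eq_leftOrthogonal adjL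
  · rw [h.derivedSupport_T_eq]
    exact NodalOrder.essImage_eq_rightOrthogonal adjR
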